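/- **Setting.** A *curve* is the image of a continuous map $[0,1]\to\mathbb C$, regarded as a compact subset of the plane; sets of curves carry the Borel $\sigma$-algebra of the Hausdorff topology, and $|\gamma|$ is the diameter of $\gamma$. Let $\mu$ be a measure on curves which is invariant under $\gamma\mapsto z+\gamma$ ($z\in\mathbb C$) and $\gamma\mapsto\rho\gamma$ ($\rho>0$), locally finite ($\mu$ gives finite mass to the curves of diameter greater than $1$ contained in $[-1,1]^2$), not one-dimensional (for every real $\theta$, $\mu(\{\gamma:\exists x,y\in\gamma,\ x-y\notin e^{i\theta}\mathbb R\})\neq0$), and supported on simple loops. Let $O(\gamma)$ be the interior of the loop $\gamma$. Let $D\subset\mathbb C$ be a bounded domain, $\mu_D=\mu 1_{\gamma\subset D}$ and $c>0$. A *soup of intensity $c\mu_D$* is a Poisson point process of curves with this intensity. Two loops are *linked* if $\gamma\cap\gamma'\ne\emptyset$ and $O(\gamma)\cap O(\gamma')\neq\emptyset$. For a set $S$ of loops and $\gamma\in S$, the cluster $\mathrm{Cl}(\gamma,S)$ is the union of all loops of $S$ that can be joined to $\gamma$ by a finite chain of loops of $S$ in which successive loops are linked. The clusters of a soup are ordered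 in decreasing order of the diameter of the largest loop they contain. **Proposition.** Let $\Gamma',\Gamma_1,\Gamma_2,\dots$ be independent soups of intensity $c\mu_D$. Define recursively, for $n\ge1$: * $\gamma^n$ is the loop of largest diameter among the loops of $\Gamma'$ that avoid the earlier clusters $K_1,\dots,K_{n-1}$; * $\Gamma_n'$ is the set of loops of $\Gamma_n$ that have diameter smaller than $|\gamma^n|$ and avoid $K_1,\dots,K_{n-1}$; * $K_n=\mathrm{Cl}(\gamma^n,\Gamma_n'\cup\{\gamma^n\})$. (If no loop of $\Gamma'$ avoids the earlier clusters, put $K_n=\emptyset$; likewise the sequence of the clusters of a soup is continued by $\emptyset$ if there are only finitely many.) 1. If "$\gamma$ avoids $K_1,\dots,K_{n-1}$" means that $\gamma$ is neither one of the loops forming these clusters nor linked to any of them, then the sequence $(K_n)_{n\ge1}$ has the same law as the ordered sequence of the clusters of a soup of intensity $c\mu_D$. 2. If, almost surely, any two distinct loops of a soup of intensity $c\mu_D$ that intersect also have intersecting interiors, then the same holds when "$\gamma$ avoids $K_1,\dots,K_{n-1}$" means $\gamma\cap\bigcup_{i<n}K_i=\emptyset$. Here the law of a sequence of random subsets of the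 plane is taken on the product of the $\sigma$-algebras generated by the events $\{K\cap F\neq\emptyset\}$, $F$ compact; it is part of the claim that both sequences are measurable up to null sets. -/

import Mathlib

open MeasureTheory ProbabilityTheory TopologicalSpace
open scoped NNReal ENNReal

noncomputable section

namespace RandomSoup

/-! ### Planar curves and the invariant measures on them -/

/-- Curves are viewed as non-empty compact subsets of the plane, with the Hausdorff topology. That
the measures below only charge (simple) curves is part of the hypotheses on these measures. -/
abbrev Curve : Type := NonemptyCompacts ℂ

/-- The Borel σ-algebra of the Hausdorff topology. -/
instance : MeasurableSpace Curve := borel Curve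

instance : BorelSpace Curve := ⟨rfl⟩

/-- `γ` is the image of a continuous function on `[0,1]`. -/
def IsCurve (γ : Curve) : Prop :=
  ∃ f : unitInterval → ℂ, Continuous f ∧ Set.range f = (γ : Set ℂ)

/-- `γ` is the image of an injective continuous map from the unit circle. -/
def IsSimpleLoop (γ : Curve) : Prop :=
  ∃ f : Circle → ℂ, Continuous f ∧ Function.Injective f ∧ Set.range f = (γ : Set ℂ)

/-- The Euclidean diameter `|γ|`. -/
def diam (γ : Curve) : ℝ := Metric.diam (γ : Set ℂ)

/-- The translate `z + γ`. -/
def translate (z : ℂ) (γ : Curve) : Curve :=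
  NonemptyCompacts.map (fun w => z + w) (continuous_const.add continuous_id) γ

/-- The dilate `ρ γ`. -/
def dilate (ρ : ℝ) (γ : Curve) : Curve :=
  NonemptyCompacts.map (fun w => (ρ : ℂ) * w) (continuous_const.mul continuous_id) γ

/-- The class of translation-invariant, scale-invariant, locally finite measures on the set of
compact planar curves that are not one-dimensional. -/
structure IsInvariantCurveMeasure (μ : Measure Curve) : Prop where
  supported : ∀ᵐ γ ∂μ, IsCurve γ
  translation_invariant : ∀ z : ℂ, μ.map (translate z) = μ
  scale_invariant : ∀ ρ : ℝ, 0 < ρ → μ.map (dilate ρ) = μ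
  locally_finite :
    μ {γ | 1 < diam γ ∧ (γ : Set ℂ) ⊆ Set.Icc (-1 : ℝ) 1 ×ℂ Set.Icc (-1 : ℝ) 1} < ∞
  not_one_dimensional : ∀ θ : ℝ,
    μ {γ | ∃ x ∈ (γ : Set ℂ), ∃ y ∈ (γ : Set ℂ),
      ¬ ∃ r : ℝ, x - y = Complex.exp (θ * Complex.I) * r} ≠ 0

/-- The restriction `μ_D` of `μ` to the curves that are contained in `D`. -/
def restrictTo (μ : Measure Curve) (D : Set ℂ) : Measure Curve :=
  μ.restrict {γ | (γ : Set ℂ) ⊆ D}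

/-! ### Soups (Poisson point processes of curves) -/

/-- A configuration: a set of curves. -/
@[ext] structure Config where
  curves : Set Curve

/-- The number of curves of the configuration that lie in `A`. -/
def Config.count (A : Set Curve) (S : Config) : ℕ∞ := (S.curves ∩ A).encard

/-- The σ-algebra generated by the counts of the curves in Borel sets. -/
instance : MeasurableSpace Config :=
  ⨆ A : {A : Set Curve // MeasurableSet A}, MeasurableSpace.comap (Config.count A.1) ⊤

/-- `Γ` is a soup of intensity `ν`, that is, a Poisson point process: a random countable collection
of curves such that the numbers of curves in disjoint Borel sets are independent, and the number of
curves in `A` is a Poisson variable with mean `ν A` (infinite almost surely if `ν A = ∞`). -/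
structure IsSoup {Ω : Type*} [MeasurableSpace Ω] (Γ : Ω → Config) (ν : Measure Curve)
    (P : Measure Ω) : Prop where
  measurable : Measurable Γ
  countable : ∀ᵐ ω ∂P, (Γ ω).curves.Countable
  poisson : ∀ A : Set Curve, MeasurableSet A → ν A ≠ ∞ →
    P.map (fun ω => (Γ ω).count A) =
      (poissonMeasure (ν A).toNNReal).map (fun k : ℕ => (k : ℕ∞))
  infinite : ∀ A : Set Curve, MeasurableSet A → ν A = ∞ → ∀ᵐ ω ∂P, (Γ ω).count A = ⊤
  independent : ∀ (m : ℕ) (A : Fin m → Set Curve), (∀ i, MeasurableSet (A i)) →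
    Pairwise (fun i j => Disjoint (A i) (A j)) →
    iIndepFun (fun i ω => (Γ ω).count (A i)) P

/-! ### Clusters -/

/-- The interior of a loop: the bounded components of its complement. -/
def inside (γ : Curve) : Set ℂ :=
  {z | z ∉ (γ : Set ℂ) ∧ Bornology.IsBounded (connectedComponentIn (γ : Set ℂ)ᶜ z)}

/-- The two curves intersect. -/
def Meets (γ η : Curve) : Prop := ((γ : Set ℂ) ∩ (η : Set ℂ)).Nonempty

/-- The two curves intersect and their interiors intersect. -/
def Linked (γ η : Curve) : Prop := Meets γ η ∧ (inside γ ∩ inside η).Nonempty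

/-- The curves of the cluster of `γ` inside `S`: those that are joined to `γ` by a finite chain
of curves of `S` in which successive curves are linked. -/
def clusterCurves (γ : Curve) (S : Set Curve) : Set Curve :=
  {η ∈ S | Relation.ReflTransGen (fun a b => a ∈ S ∧ b ∈ S ∧ Linked a b) γ η}

/-- The union, as a subset of the plane, of a set of curves. A cluster, as a subset of the plane,
is the `trace` of its set of curves. -/
def trace (S : Set Curve) : Set ℂ := ⋃ γ ∈ S, (γ : Set ℂ)

/-- `γ` is the curve of `S` with (strictly) largest diameter. -/
def IsLargest (S : Set Curve) (γ : Curve) : Prop :=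
  γ ∈ S ∧ ∀ η ∈ S, η ≠ γ → diam η < diam γ

/-! ### The ordered clusters of a soup -/

/-- The cluster in `S` of the largest curve of `S` that is not in `E`
(empty if there is no such curve). -/
def soupNext (S E : Set Curve) : Set Curve :=
  {η | ∃ γ, IsLargest (S \ E) γ ∧ η ∈ clusterCurves γ S}

/-- The curves of the first `n` clusters of `S`, for the ordering of the clusters in decreasing
order of the diameter of the largest curve that they contain. -/
def soupBefore (S : Set Curve) : ℕ → Set Curve
  | 0 => ∅
  | n + 1 => soupBefore S n ∪ soupNext S (soupBefore S n)

/-- The clusters of `S`, ordered in decreasing order of the largest curve that they contain,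
numbered from `0` (and empty beyond the last cluster). -/
def soupCluster (S : Set Curve) (n : ℕ) : Set ℂ := trace (soupNext S (soupBefore S n))

/-! ### The sequential construction -/

/-- `γ` does not intersect the union of the curves of `E`. -/
def AvoidsTrace (γ : Curve) (E : Set Curve) : Prop := Disjoint (γ : Set ℂ) (trace E)

/-- `γ` neither belongs to `E` nor is linked to a curve of `E`. -/
def AvoidsLinks (γ : Curve) (E : Set Curve) : Prop := ∀ η ∈ E, γ ≠ η ∧ ¬ Linked γ η

/-- One step of the construction, where `E` is the set of all curves of the earlier clusters: `γ`
is the largest curve of `S₀` that avoids the earlier clusters, and its cluster is taken in the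
set consisting of `γ` and of the curves of `S` that have smaller diameter than `γ` and avoid the
earlier clusters (empty if there is no such `γ`). -/
def exploreNext (avoids : Curve → Set Curve → Prop) (S₀ S E : Set Curve) : Set Curve :=
  {η | ∃ γ, IsLargest {ξ ∈ S₀ | avoids ξ E} γ ∧
    η ∈ clusterCurves γ ({ξ ∈ S | diam ξ < diam γ ∧ avoids ξ E} ∪ {γ})}

/-- The curves of the first `n` clusters of the construction. The set `S 0` plays the role of `Γ'`
and the set `S (n + 1)` is used to build the cluster number `n` (numbered from `0`). -/
def exploreBefore (avoids : Curve → Set Curve → Prop) (S : ℕ → Set Curve) : ℕ → Set Curve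
  | 0 => ∅
  | n + 1 => exploreBefore avoids S n ∪
      exploreNext avoids (S 0) (S (n + 1)) (exploreBefore avoids S n)

/-- The clusters of the construction, as subsets of the plane, numbered from `0`. -/
def exploreCluster (avoids : Curve → Set Curve → Prop) (S : ℕ → Set Curve) (n : ℕ) : Set ℂ :=
  trace (exploreNext avoids (S 0) (S (n + 1)) (exploreBefore avoids S n))

/-! ### Laws of sequences of random planar sets -/

/-- Subsets of the plane, as values of a random set. -/
@[ext] structure PlaneSet where
  carrier : Set ℂ

/-- The σ-algebra generated by the events that the random set hits a given compact set. -/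
instance : MeasurableSpace PlaneSet :=
  MeasurableSpace.generateFrom
    {𝒜 | ∃ F : Set ℂ, IsCompact F ∧ 𝒜 = {K : PlaneSet | (K.carrier ∩ F).Nonempty}}

/-- Two sequences of random planar sets are (almost everywhere) measurable and have the same
law. -/
def SameLaw {Ω Ω' : Type*} [MeasurableSpace Ω] [MeasurableSpace Ω']
    (K : Ω → ℕ → Set ℂ) (K' : Ω' → ℕ → Set ℂ) (P : Measure Ω) (P' : Measure Ω') : Prop :=
  IdentDistrib (fun ω n => PlaneSet.mk (K ω n)) (fun ω n => PlaneSet.mk (K' ω n)) P P'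

end RandomSoup

end

noncomputable section

namespace RandomSoup

/-! ### Measurability of geometric properties of curves -/

/-! The engine is the spatial Markov property of a Poisson process. It is used in the weak form
`IsCompletelyRandom`: diameters are positive and distinct, finitely many exceed any given positive
level, and the void probabilities of disjoint Borel sets multiply. A soup has these properties
because its intensity is diffuse (`IsDiffuse`): local finiteness and invariance bound the mass of
the large loops in a bounded set, and scaling excludes atoms of the diameter. Void events form a
π-system, so every identity in law is checked on events "no curve lies in `A`".

Two resampling facts carry the argument. Given the largest curve γ of a soup in a region `W` of
curve space, the smaller curves in `W` may be replaced by those of an independent copy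
(`IsCompletelyRandom.lintegral_top`; the random level |γ| is discretised from below). When the
cluster of γ is explored generation by generation, curves not linked to what has been found have not
been looked at, so there too the soup may be replaced by a copy
(`IsCompletelyRandom.lintegral_grow`).

In the sequential construction γ¹ comes from Γ', while its cluster uses Γ₁ instead of the smaller
loops of Γ'. The region left after this step depends only on γ¹ and Γ₁, and given γ¹ the smaller
loops of Γ' are still fresh; hence Γ' can be used again in that region. By induction the clusters of
the first n steps, completed by an independent soup in the remaining region, have the void
probabilities of a soup on sets of curves bounded away from diameter zero
(`IsCompletelyRandom.lintegral_seen`). Loops of any given size are exhausted after finitely many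
steps, so the union of all explored clusters is a soup in law (`IsCompletelyRandom.map_allSeen`).

What remains is deterministic. Clusters of different steps are unlinked and their largest loops
decrease, so they are exactly the ordered clusters of their union (`soupCluster_allSeen`). Both
sequences are therefore one measurable function of two random sets with the same law. The two rules
of avoidance differ only if distinct loops meet with disjoint interiors; the absence of such pairs
within one soup passes to pairs of independent soups, again by splitting curve space
(`IsCompletelyRandom.ae_not_touching`). -/

theorem Linked.symm {γ η : Curve} (h : Linked γ η) : Linked η γ :=
  ⟨by simpa [Meets, Set.inter_comm] using h.1, by simpa [Set.inter_comm] using h.2⟩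

theorem isBounded_curve (γ : Curve) : Bornology.IsBounded (γ : Set ℂ) :=
  γ.isCompact.isBounded

theorem diam_nonneg (γ : Curve) : 0 ≤ diam γ := Metric.diam_nonneg

/-- The diameter is lower semicontinuous: two points at distance greater than `r` persist in all
nearby compact sets. -/
theorem measurable_diam : Measurable diam := by
  refine measurable_of_Ioi fun r => IsOpen.measurableSet ?_
  rcases lt_or_ge r 0 with hr | hr
  · convert isOpen_univ
    ext γ
    simpa using hr.trans_le (diam_nonneg γ)
  rw [isOpen_iff_mem_nhds]
  intro γ hγ
  obtain ⟨x, hx, y, hy, hxy⟩ : ∃ x ∈ (γ : Set ℂ), ∃ y ∈ (γ : Set ℂ), r < dist x y := by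
    by_contra! h
    exact absurd (Metric.diam_le_of_forall_dist_le hr h) (not_le.2 hγ)
  -- Moving each of the two points by less than half of the excess keeps their distance above `r`.
  set ε := (dist x y - r) / 2 with hε
  have hε0 : 0 < ε := by linarith
  filter_upwards [(NonemptyCompacts.isOpen_inter_nonempty_of_isOpen
    (Metric.isOpen_ball (x := x) (ε := ε))).mem_nhds
      (show ((γ : Set ℂ) ∩ Metric.ball x ε).Nonempty from ⟨x, hx, Metric.mem_ball_self hε0⟩),
    (NonemptyCompacts.isOpen_inter_nonempty_of_isOpen
    (Metric.isOpen_ball (x := y) (ε := ε))).mem_nhds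
      (show ((γ : Set ℂ) ∩ Metric.ball y ε).Nonempty from ⟨y, hy, Metric.mem_ball_self hε0⟩)]
    with η h1 h2
  obtain ⟨a, ha, hax⟩ := h1
  obtain ⟨b, hb, hby⟩ := h2
  have h3 : dist a b ≤ diam η := Metric.dist_le_diam_of_mem (isBounded_curve η) ha hb
  have h4 : dist x y ≤ dist a x + dist a b + dist b y := by
    have := dist_triangle4 x a b y
    rwa [dist_comm x a] at this
  rw [Metric.mem_ball] at hax hby
  change r < diam η
  linarith

theorem measurableSet_hits {F : Set ℂ} (hF : IsClosed F) :
    MeasurableSet {γ : Curve | ((γ : Set ℂ) ∩ F).Nonempty} :=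
  (NonemptyCompacts.isClosed_inter_nonempty_of_isClosed hF).measurableSet

theorem measurableSet_subset_closed {U : Set ℂ} (hU : IsClosed U) :
    MeasurableSet {γ : Curve | (γ : Set ℂ) ⊆ U} :=
  (NonemptyCompacts.isClosed_subsets_of_isClosed hU).measurableSet

theorem measurableSet_meets : MeasurableSet {p : Curve × Curve | Meets p.1 p.2} := by
  refine IsClosed.measurableSet ⟨?_⟩
  rw [isOpen_iff_mem_nhds]
  rintro ⟨γ, η⟩ h
  have hd : Disjoint (γ : Set ℂ) (η : Set ℂ) := by
    simpa [Meets, Set.not_nonempty_iff_eq_empty, Set.disjoint_iff_inter_eq_empty] using h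
  obtain ⟨U, V, hU, hV, hγU, hηV, hUV⟩ := SeparatedNhds.of_isCompact_isCompact γ.isCompact
    η.isCompact hd
  filter_upwards [prod_mem_nhds
    ((NonemptyCompacts.isOpen_subsets_of_isOpen hU).mem_nhds (show (γ : Set ℂ) ⊆ U from hγU))
    ((NonemptyCompacts.isOpen_subsets_of_isOpen hV).mem_nhds (show (η : Set ℂ) ⊆ V from hηV))]
  rintro ⟨a, b⟩ ⟨ha, hb⟩ ⟨z, hza, hzb⟩
  exact Set.disjoint_left.1 hUV (ha hza) (hb hzb)

theorem isOpen_inside (γ : Curve) : IsOpen (inside γ) := by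
  have hc : IsOpen (γ : Set ℂ)ᶜ := γ.isCompact.isClosed.isOpen_compl
  rw [isOpen_iff_mem_nhds]
  rintro z ⟨hz, hb⟩
  filter_upwards [hc.connectedComponentIn.mem_nhds (mem_connectedComponentIn hz)] with w hw
  exact ⟨connectedComponentIn_subset _ _ hw, by rwa [← connectedComponentIn_eq hw]⟩

/-- The curves that separate neither `z` from infinity nor contain `z` form an open set. -/
theorem isOpen_outside (z : ℂ) :
    IsOpen {γ : Curve | z ∉ (γ : Set ℂ) ∧
      ¬ Bornology.IsBounded (connectedComponentIn (γ : Set ℂ)ᶜ z)} := by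
  rw [isOpen_iff_mem_nhds]
  rintro γ ⟨hz, hunb⟩
  have hc : IsOpen (γ : Set ℂ)ᶜ := γ.isCompact.isClosed.isOpen_compl
  obtain ⟨R, hR0, hR⟩ := (isBounded_curve γ).subset_ball_lt 0 0
  obtain ⟨w, hw, hwR⟩ : ∃ w ∈ connectedComponentIn (γ : Set ℂ)ᶜ z, R < ‖w‖ := by
    by_contra! h
    exact hunb ((Metric.isBounded_closedBall (x := (0 : ℂ)) (r := R)).subset
      fun w hw => by simpa using h w hw)
  have hpc : IsPathConnected (connectedComponentIn (γ : Set ℂ)ᶜ z) :=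
    (hc.connectedComponentIn.isConnected_iff_isPathConnected).1
      (isConnected_connectedComponentIn_iff.2 hz)
  obtain ⟨p, hp⟩ := hpc.joinedIn z (mem_connectedComponentIn hz) w hw
  set L : Set ℂ := Set.range p
  have hL : IsClosed L := (isCompact_range p.continuous).isClosed
  have hLγ : (γ : Set ℂ) ⊆ Lᶜ := by
    rintro x hx ⟨t, rfl⟩
    exact connectedComponentIn_subset _ _ (hp t) hx
  filter_upwards [(NonemptyCompacts.isOpen_subsets_of_isOpen hL.isOpen_compl).mem_nhds
      (show (γ : Set ℂ) ⊆ Lᶜ from hLγ),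
    (NonemptyCompacts.isOpen_subsets_of_isOpen (Metric.isOpen_ball (x := (0 : ℂ))
      (ε := R))).mem_nhds (show (γ : Set ℂ) ⊆ Metric.ball 0 R from hR)] with η h1 h2
  have hzL : z ∈ L := ⟨0, by simp⟩
  have hwL : w ∈ L := ⟨1, by simp⟩
  refine ⟨fun h => h1 h hzL, fun hb => ?_⟩
  -- `L` is a path from `z` to a point `w` outside a ball that contains the curve, and `M` is the
  -- radial ray from `w` to infinity. A nearby curve misses `L` and stays in the ball, so it misses
  -- `M` as well.
  set M : Set ℂ := (fun s : ℝ => (s : ℂ) * w) '' Set.Ici 1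
  have hM : IsPreconnected M :=
    isPreconnected_Ici.image _ (by fun_prop)
  have hwM : w ∈ M := ⟨1, by simp, by simp⟩
  have hpre : IsPreconnected (L ∪ M) :=
    (isPreconnected_range p.continuous).union w hwL hwM hM
  have hsub : L ∪ M ⊆ connectedComponentIn (η : Set ℂ)ᶜ z := by
    refine hpre.subset_connectedComponentIn (Or.inl hzL) ?_
    rintro x (hx | ⟨s, hs, rfl⟩) hxη
    · exact h1 hxη hx
    · have := h2 hxη
      rw [mem_ball_zero_iff, norm_mul, Complex.norm_real, Real.norm_eq_abs] at this
      have h4 : (1 : ℝ) ≤ |s| := le_trans hs (le_abs_self s)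
      nlinarith [norm_nonneg w]
  obtain ⟨N, hN0, hN⟩ := hb.subset_ball_lt 0 0
  have hw0 : 0 < ‖w‖ := hR0.trans hwR
  have := hN (hsub (Or.inr ⟨max 1 (N / ‖w‖), Set.mem_Ici.2 (le_max_left _ _), rfl⟩))
  rw [mem_ball_zero_iff, norm_mul, Complex.norm_real, Real.norm_eq_abs,
    abs_of_pos (lt_of_lt_of_le one_pos (le_max_left _ _))] at this
  have h5 : N / ‖w‖ * ‖w‖ = N := div_mul_cancel₀ _ hw0.ne'
  nlinarith [le_max_right 1 (N / ‖w‖)]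

theorem measurableSet_mem_inside (z : ℂ) : MeasurableSet {γ : Curve | z ∈ inside γ} := by
  have h1 : MeasurableSet {γ : Curve | ((γ : Set ℂ) ∩ {z}).Nonempty} :=
    measurableSet_hits isClosed_singleton
  convert (h1.union (isOpen_outside z).measurableSet).compl using 1
  ext γ
  simp only [inside, Set.mem_ofPred_eq, Set.mem_compl_iff, Set.mem_union,
    Set.inter_singleton_nonempty]
  tauto

/-- Interiors are open, so a common point may be sought in a countable dense set. -/
theorem measurableSet_inside_inter :
    MeasurableSet {p : Curve × Curve | (inside p.1 ∩ inside p.2).Nonempty} := by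
  have : {p : Curve × Curve | (inside p.1 ∩ inside p.2).Nonempty} =
      ⋃ n : ℕ, {p | denseSeq ℂ n ∈ inside p.1} ∩ {p | denseSeq ℂ n ∈ inside p.2} := by
    ext p
    simp only [Set.mem_ofPred_eq, Set.mem_iUnion, Set.mem_inter_iff]
    constructor
    · intro h
      exact (denseRange_denseSeq ℂ).exists_mem_open
        ((isOpen_inside p.1).inter (isOpen_inside p.2)) h
    · rintro ⟨n, h⟩
      exact ⟨_, h⟩
  rw [this]
  exact MeasurableSet.iUnion fun n => (measurable_fst (measurableSet_mem_inside _)).inter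
    (measurable_snd (measurableSet_mem_inside _))

theorem measurableSet_linked : MeasurableSet {p : Curve × Curve | Linked p.1 p.2} :=
  measurableSet_meets.inter measurableSet_inside_inter

/-! ### Random sets of curves and their void probabilities -/

/-- Sets of curves, as values of a random set of curves. -/
structure CurveSet where
  curves : Set Curve

/-- `S` contains no curve of `A`. -/
def Void (S A : Set Curve) : Prop := ∀ ξ ∈ S, ξ ∉ A

theorem Void.mono {S S' A A' : Set Curve} (h : Void S A) (hS : S' ⊆ S) (hA : A' ⊆ A) :
    Void S' A' := fun ξ hξ hξA => h ξ (hS hξ) (hA hξA)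

theorem void_union_right {S A B : Set Curve} : Void S (A ∪ B) ↔ Void S A ∧ Void S B := by
  simp only [Void, Set.mem_union, not_or]
  exact ⟨fun h => ⟨fun ξ hξ => (h ξ hξ).1, fun ξ hξ => (h ξ hξ).2⟩,
    fun h ξ hξ => ⟨h.1 ξ hξ, h.2 ξ hξ⟩⟩

theorem void_union_left {S T A : Set Curve} : Void (S ∪ T) A ↔ Void S A ∧ Void T A := by
  simp only [Void, Set.mem_union]
  exact ⟨fun h => ⟨fun ξ hξ => h ξ (Or.inl hξ), fun ξ hξ => h ξ (Or.inr hξ)⟩,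
    fun h ξ hξ => hξ.elim (h.1 ξ) (h.2 ξ)⟩

theorem void_inter_left {S W A : Set Curve} : Void (S ∩ W) A ↔ Void S (W ∩ A) :=
  ⟨fun h ξ hξ hA => h ξ ⟨hξ, hA.1⟩ hA.2, fun h ξ hξ hA => h ξ hξ.1 ⟨hξ.2, hA⟩⟩

/-- The events that a random set of curves avoids a Borel set. -/
def voidEvents : Set (Set CurveSet) :=
  {𝒜 | ∃ A : Set Curve, MeasurableSet A ∧ 𝒜 = {S : CurveSet | Void S.curves A}}

instance : MeasurableSpace CurveSet := MeasurableSpace.generateFrom voidEvents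

theorem isPiSystem_voidEvents : IsPiSystem voidEvents := by
  rintro _ ⟨A, hA, rfl⟩ _ ⟨B, hB, rfl⟩ -
  exact ⟨A ∪ B, hA.union hB, by ext S; exact void_union_right.symm⟩

theorem univ_mem_voidEvents : Set.univ ∈ voidEvents :=
  ⟨∅, MeasurableSet.empty, by ext S; simp [Void]⟩

theorem measurableSet_void {A : Set Curve} (hA : MeasurableSet A) :
    MeasurableSet {S : CurveSet | Void S.curves A} :=
  MeasurableSpace.measurableSet_generateFrom ⟨A, hA, rfl⟩

theorem measurable_curveSet_iff {T : Type*} [MeasurableSpace T] {f : T → CurveSet} :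
    Measurable f ↔ ∀ A, MeasurableSet A → MeasurableSet {t | Void (f t).curves A} := by
  refine ⟨fun h A hA => h (measurableSet_void hA), fun h => measurable_generateFrom ?_⟩
  rintro _ ⟨A, hA, rfl⟩
  exact h A hA

/-- Void probabilities determine the law because the void events are stable under intersection:
avoiding `A` and `B` is avoiding `A ∪ B`. -/
theorem CurveSet.ext_measure {m m' : Measure CurveSet} [IsProbabilityMeasure m]
    [IsProbabilityMeasure m']
    (h : ∀ A, MeasurableSet A → m {S | Void S.curves A} = m' {S | Void S.curves A}) : m = m' := by
  refine ext_of_generate_finite voidEvents rfl isPiSystem_voidEvents ?_ (by simp)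
  rintro _ ⟨A, hA, rfl⟩
  exact h A hA

/-- The restriction of a set of curves to `W`. -/
def CurveSet.inter (W : Set Curve) (S : CurveSet) : CurveSet := ⟨S.curves ∩ W⟩

theorem measurable_inter {W : Set Curve} (hW : MeasurableSet W) :
    Measurable (CurveSet.inter W) := by
  refine measurable_curveSet_iff.2 fun A hA => ?_
  simp only [CurveSet.inter, void_inter_left]
  exact measurableSet_void (hW.inter hA)

/-- A countable basis separates points, which turns "at most one curve" into a countable combination
of void events. -/
theorem subsingleton_iff_basis (S : Set Curve) :
    S.Subsingleton ↔ ∀ U ∈ countableBasis Curve, Void S U ∨ Void S Uᶜ := by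
  constructor
  · intro h U _
    by_contra! h'
    simp only [Void, not_forall] at h'
    obtain ⟨⟨x, hx, hxU⟩, y, hy, hyU⟩ := h'
    rw [h hx hy] at hxU
    exact hyU hxU
  · intro h x hx y hy
    by_contra hxy
    obtain ⟨U, hU, hxU, hUy⟩ := (isBasis_countableBasis Curve).exists_subset_of_mem_open
      (show x ∈ ({y}ᶜ : Set Curve) from hxy) isOpen_compl_singleton
    rcases h U hU with h | h
    · exact h x hx (not_not.2 hxU |> not_not.1)
    · exact h y hy fun hyU => hUy hyU rfl

theorem measurableSet_subsingleton {B : Set Curve} (hB : MeasurableSet B) :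
    MeasurableSet {S : CurveSet | (S.curves ∩ B).Subsingleton} := by
  simp only [subsingleton_iff_basis, void_inter_left]
  have : {S : CurveSet | ∀ U ∈ countableBasis Curve,
      Void S.curves (B ∩ U) ∨ Void S.curves (B ∩ Uᶜ)} = ⋂ U ∈ countableBasis Curve,
      ({S : CurveSet | Void S.curves (B ∩ U)} ∪ {S | Void S.curves (B ∩ Uᶜ)}) := by
    ext S; simp
  rw [this]
  refine MeasurableSet.biInter (countable_countableBasis Curve) fun U hU => ?_
  have hU' := (isOpen_of_mem_countableBasis hU).measurableSet
  exact (measurableSet_void (hB.inter hU')).union (measurableSet_void (hB.inter hU'.compl))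

/-! ### Diameter levels, the largest curve, and enumeration by decreasing size -/

/-- The curves of diameter greater than `r`. -/
def above (r : ℝ) : Set Curve := {γ | r < diam γ}

/-- The curves of diameter less than `r`. -/
def below (r : ℝ) : Set Curve := {γ | diam γ < r}

theorem measurableSet_above (r : ℝ) : MeasurableSet (above r) :=
  measurableSet_lt measurable_const measurable_diam

theorem measurableSet_below (r : ℝ) : MeasurableSet (below r) :=
  measurableSet_lt measurable_diam measurable_const

/-- A curve of diameter zero, which marks the absence of a curve. -/
def dummy : Curve := {0}

theorem diam_dummy : diam dummy = 0 := by
  simp [diam, dummy]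

/-- `γ` is the largest curve of `S`, and it is separated from the others by a rational level. -/
def IsTop (S : Set Curve) (γ : Curve) : Prop := ∃ q : ℚ, 0 < q ∧ S ∩ above q = {γ}

theorem IsTop.diam_pos {S : Set Curve} {γ : Curve} (h : IsTop S γ) : 0 < diam γ := by
  obtain ⟨q, hq, h⟩ := h
  have : γ ∈ S ∩ above q := h ▸ rfl
  exact lt_trans (by exact_mod_cast hq) this.2

theorem IsTop.isLargest {S : Set Curve} {γ : Curve} (h : IsTop S γ) : IsLargest S γ := by
  obtain ⟨q, hq, h⟩ := h
  have hγ : γ ∈ S ∩ above q := h ▸ rfl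
  refine ⟨hγ.1, fun η hη hne => ?_⟩
  by_contra! hle
  have : η ∈ S ∩ above q := ⟨hη, hγ.2.trans_le hle⟩
  rw [h] at this
  exact hne this

theorem IsLargest.unique {S : Set Curve} {γ η : Curve} (h : IsLargest S γ) (h' : IsLargest S η) :
    γ = η := by
  by_contra hne
  exact lt_asymm (h.2 η h'.1 (Ne.symm hne)) (h'.2 γ h.1 hne)

open Classical in
/-- The largest curve of `S` (the dummy curve if there is none). -/
def top (S : Set Curve) : Curve := if h : ∃ γ, IsTop S γ then h.choose else dummy

theorem top_eq_of_isTop {S : Set Curve} {γ : Curve} (h : IsTop S γ) : top S = γ := by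
  have h' : ∃ γ, IsTop S γ := ⟨γ, h⟩
  rw [top, dif_pos h']
  exact h'.choose_spec.isLargest.unique h.isLargest

theorem top_eq_dummy {S : Set Curve} (h : ¬ ∃ γ, IsTop S γ) : top S = dummy := by
  rw [top, dif_neg h]

theorem isTop_top {S : Set Curve} (h : 0 < diam (top S)) : IsTop S (top S) := by
  by_cases h' : ∃ γ, IsTop S γ
  · obtain ⟨γ, hγ⟩ := h'
    rwa [top_eq_of_isTop hγ]
  · rw [top_eq_dummy h', diam_dummy] at h
    exact absurd h (lt_irrefl _)

/-- The rational level in `IsTop` makes this a countable union: for some `q`, at most one curve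
exceeds `q`, and some curve exceeding `q` lies in `A`. -/
theorem measurable_top : Measurable fun S : CurveSet => top S.curves := by
  have key : ∀ A : Set Curve, MeasurableSet A →
      MeasurableSet {S : CurveSet | ∃ γ ∈ A, IsTop S.curves γ} := by
    intro A hA
    have : {S : CurveSet | ∃ γ ∈ A, IsTop S.curves γ} = ⋃ q : {q : ℚ // 0 < q},
        ({S : CurveSet | (S.curves ∩ above q).Subsingleton} ∩
          {S : CurveSet | Void S.curves (above q ∩ A)}ᶜ) := by
      ext S
      simp only [Set.mem_ofPred_eq, Set.mem_iUnion, Set.mem_inter_iff, Set.mem_compl_iff]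
      constructor
      · rintro ⟨γ, hγA, q, hq, h⟩
        have hγ : γ ∈ S.curves ∩ above q := h ▸ rfl
        exact ⟨⟨q, hq⟩, by simp [h], fun hv => hv γ hγ.1 ⟨hγ.2, hγA⟩⟩
      · rintro ⟨⟨q, hq⟩, hs, hv⟩
        simp only [Void, not_forall, not_not] at hv
        obtain ⟨γ, hγS, hγq, hγA⟩ := hv
        exact ⟨γ, hγA, q, hq, hs.eq_singleton_of_mem ⟨hγS, hγq⟩⟩
    rw [this]
    exact MeasurableSet.iUnion fun q => (measurableSet_subsingleton (measurableSet_above _)).inter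
      (measurableSet_void ((measurableSet_above _).inter hA)).compl
  intro A hA
  have hpre : (fun S : CurveSet => top S.curves) ⁻¹' A =
      {S : CurveSet | ∃ γ ∈ A, IsTop S.curves γ} ∪
        ({S : CurveSet | ∃ γ ∈ Set.univ, IsTop S.curves γ}ᶜ ∩ {_S | dummy ∈ A}) := by
    ext S
    simp only [Set.mem_preimage, Set.mem_union, Set.mem_inter_iff, Set.mem_compl_iff,
      Set.mem_ofPred_eq, Set.mem_univ, true_and]
    by_cases h : ∃ γ, IsTop S.curves γ
    · obtain ⟨γ, hγ⟩ := h
      rw [top_eq_of_isTop hγ]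
      refine ⟨fun hA => Or.inl ⟨γ, hA, hγ⟩, ?_⟩
      rintro (⟨η, hη, hη'⟩ | ⟨h, -⟩)
      · rwa [hγ.isLargest.unique hη'.isLargest]
      · exact absurd ⟨γ, hγ⟩ h
    · rw [top_eq_dummy h]
      refine ⟨fun hA => Or.inr ⟨h, hA⟩, ?_⟩
      rintro (⟨η, hη, hη'⟩ | ⟨-, h⟩)
      · exact absurd ⟨η, hη'⟩ h
      · exact h
  rw [hpre]
  exact (key A hA).union ((key _ MeasurableSet.univ).compl.inter (MeasurableSet.const _))

/-- The properties that a soup has almost surely: its curves have distinct positive diameters, and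
finitely many of them are larger than any given positive number. -/
structure Good (S : Set Curve) : Prop where
  pos : ∀ γ ∈ S, 0 < diam γ
  finite : ∀ r : ℝ, 0 < r → (S ∩ above r).Finite
  inj : ∀ γ ∈ S, ∀ η ∈ S, diam γ = diam η → γ = η

theorem Good.mono {S T : Set Curve} (h : Good S) (hT : T ⊆ S) : Good T where
  pos γ hγ := h.pos γ (hT hγ)
  finite r hr := (h.finite r hr).subset (Set.inter_subset_inter_left _ hT)
  inj γ hγ η hη := h.inj γ (hT hγ) η (hT hη)

theorem Good.exists_isTop {S : Set Curve} (h : Good S) (hne : S.Nonempty) : ∃ γ, IsTop S γ := by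
  obtain ⟨ξ, hξ⟩ := hne
  have hξ0 := h.pos ξ hξ
  set F := S ∩ above (diam ξ / 2) with hF
  have hFf : F.Finite := h.finite _ (by linarith)
  have hξF : ξ ∈ F := ⟨hξ, show diam ξ / 2 < diam ξ by linarith⟩
  obtain ⟨γ, hγ, hmax⟩ := Set.exists_max_image F diam hFf ⟨ξ, hξF⟩
  have hfin : (insert (diam ξ / 2) (diam '' (F \ {γ}))).Finite :=
    ((hFf.subset Set.sdiff_subset).image _).insert _
  -- `M` is the second largest diameter in `F`, or `diam ξ / 2` if `γ` is alone there; a rational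
  -- between `M` and `diam γ` isolates `γ`.
  obtain ⟨M, hM, hMmax⟩ := Set.exists_max_image _ id hfin (Set.insert_nonempty _ _)
  have hMγ : M < diam γ := by
    rcases hM with rfl | ⟨η, ⟨hηF, hηγ⟩, rfl⟩
    · have := hmax ξ hξF
      linarith
    · exact lt_of_le_of_ne (hmax η hηF) fun he => hηγ (h.inj _ hηF.1 _ hγ.1 he)
  obtain ⟨q, hMq, hqγ⟩ := exists_rat_btwn hMγ
  have h1 : diam ξ / 2 ≤ M := hMmax _ (Set.mem_insert _ _)
  refine ⟨γ, q, by exact_mod_cast (show (0 : ℝ) < q by linarith), ?_⟩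
  ext η
  simp only [Set.mem_inter_iff, Set.mem_singleton_iff]
  constructor
  · rintro ⟨hηS, hηq⟩
    by_contra hne
    have hηq' : (q : ℝ) < diam η := hηq
    have : diam η ≤ M := hMmax _ (Set.mem_insert_of_mem _ ⟨η, ⟨⟨hηS,
      show diam ξ / 2 < diam η by linarith⟩, hne⟩, rfl⟩)
    linarith
  · rintro rfl
    exact ⟨hγ.1, hqγ⟩

theorem Good.isTop {S : Set Curve} (h : Good S) {γ : Curve} (hγ : IsLargest S γ) : IsTop S γ := by
  obtain ⟨η, hη⟩ := h.exists_isTop ⟨γ, hγ.1⟩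
  rwa [hγ.unique hη.isLargest]

theorem Good.top_eq {S : Set Curve} (h : Good S) {γ : Curve} (hγ : IsLargest S γ) : top S = γ :=
  top_eq_of_isTop (h.isTop hγ)

/-- An enumeration of the curves of `S`, completed with dummy curves. -/
def enum (S : Set Curve) (q : ℚ) : Curve := top (S ∩ below q)

/-- The curves that appear in an enumeration. -/
def pts (x : ℚ → Curve) : Set Curve := {γ | 0 < diam γ ∧ ∃ i, x i = γ}

theorem pts_enum {S : Set Curve} (h : Good S) : pts (enum S) = S := by
  ext ξ
  constructor
  · rintro ⟨h0, q, rfl⟩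
    exact (isTop_top h0).isLargest.1.1
  · intro hξ
    refine ⟨h.pos ξ hξ, ?_⟩
    -- The minimum of this set is the next diameter above that of `ξ`, capped by `diam ξ + 1` so
    -- that the set is never empty. For a rational `q` just below it, `ξ` is the largest curve below
    -- `q`.
    have hfin : (insert (diam ξ + 1) (diam '' (S ∩ above (diam ξ)))).Finite :=
      ((h.finite _ (h.pos ξ hξ)).image _).insert _
    obtain ⟨M, hM, hMmin⟩ := Set.exists_min_image _ id hfin (Set.insert_nonempty _ _)
    have hMξ : diam ξ < M := by
      rcases hM with rfl | ⟨η, ⟨_, hη⟩, rfl⟩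
      · linarith
      · exact hη
    obtain ⟨q, hq, hqM⟩ := exists_rat_btwn hMξ
    refine ⟨q, (h.mono Set.inter_subset_left).top_eq ⟨⟨hξ, hq⟩, ?_⟩⟩
    rintro η ⟨hηS, hηq⟩ hne
    rcases lt_trichotomy (diam η) (diam ξ) with hlt | heq | hgt
    · exact hlt
    · exact absurd (h.inj _ hηS _ hξ heq) hne
    · have : M ≤ diam η := hMmin _ (Set.mem_insert_of_mem _ ⟨η, ⟨hηS, hgt⟩, rfl⟩)
      exact absurd (show diam η < q from hηq) (not_lt.2 (hqM.le.trans this))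

theorem measurable_enum : Measurable fun S : CurveSet => enum S.curves :=
  measurable_pi_lambda _ fun q => measurable_top.comp (measurable_inter (measurableSet_below q))

theorem void_pts {x : ℚ → Curve} {A : Set Curve} :
    Void (pts x) A ↔ ∀ i, 0 < diam (x i) → x i ∉ A :=
  ⟨fun h i hi => h _ ⟨hi, i, rfl⟩, fun h _ ⟨h0, i, hi⟩ => hi ▸ h i (hi ▸ h0)⟩

theorem measurable_pts : Measurable fun x : ℚ → Curve => CurveSet.mk (pts x) := by
  refine measurable_curveSet_iff.2 fun A hA => ?_
  simp only [void_pts, Set.ofPred_forall]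
  refine MeasurableSet.iInter fun i => ?_
  exact (measurableSet_lt measurable_const (measurable_diam.comp (measurable_pi_apply i))).imp
    (measurable_pi_apply (X := fun _ : ℚ => Curve) i hA.compl)

/-- The curves whose diameter lies in the `k`-th interval of length `1 / m`. -/
def gridCell (m k : ℕ) : Set Curve := {γ | ⌊(m : ℝ) * diam γ⌋₊ = k}

theorem measurableSet_gridCell (m k : ℕ) : MeasurableSet (gridCell m k) :=
  (Nat.measurable_floor.comp (measurable_const.mul measurable_diam))
    (MeasurableSet.singleton k)

theorem mul_abs_sub_lt_one_of_floor_eq {m : ℕ} {a b : ℝ} (ha : 0 ≤ a) (hb : 0 ≤ b)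
    (h : ⌊(m : ℝ) * a⌋₊ = ⌊(m : ℝ) * b⌋₊) : (m : ℝ) * |a - b| < 1 := by
  have hm : (0 : ℝ) ≤ m := m.cast_nonneg
  have e1 := Nat.floor_le (mul_nonneg hm ha)
  have e2 := Nat.lt_floor_add_one ((m : ℝ) * a)
  have e3 := Nat.floor_le (mul_nonneg hm hb)
  have e4 := Nat.lt_floor_add_one ((m : ℝ) * b)
  rw [h] at e1 e2
  rw [← abs_of_nonneg hm, ← abs_mul, mul_sub, abs_lt]
  constructor <;> linarith

/-- If the diameters of the curves in the finite sets `F` and `G` are distinct, a fine grid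
separates them. -/
theorem exists_gridCell_separating {F G : Set Curve} (hF : F.Finite) (hG : G.Finite) :
    ∃ m₀ : ℕ, ∀ m ≥ m₀, ∀ ξ ∈ F, ∀ η ∈ G, diam ξ ≠ diam η →
      ⌊(m : ℝ) * diam ξ⌋₊ ≠ ⌊(m : ℝ) * diam η⌋₊ := by
  obtain ⟨M, hM⟩ := ((hF.prod hG).image
    fun p : Curve × Curve => 1 / |diam p.1 - diam p.2|).bddAbove
  obtain ⟨m₀, hm₀⟩ := exists_nat_ge M
  refine ⟨m₀, fun m hm ξ hξ η hη hne he => ?_⟩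
  have h1 : 1 / |diam ξ - diam η| ≤ m :=
    ((hM ⟨(ξ, η), ⟨hξ, hη⟩, rfl⟩).trans hm₀).trans (Nat.cast_le.2 hm)
  have hd : 0 < |diam ξ - diam η| := abs_pos.2 (sub_ne_zero.2 hne)
  rw [div_le_iff₀ hd] at h1
  exact absurd (mul_abs_sub_lt_one_of_floor_eq (diam_nonneg ξ) (diam_nonneg η) he) (not_lt.2 h1)

/-- A countable reformulation, for measurability. Above a level `q`, finitely many distinct
diameters fall into different cells of a fine grid; conversely, with no diameter above `m`, only
finitely many cells are available. -/
theorem good_iff {S : Set Curve} : Good S ↔ Void S {γ | diam γ = 0} ∧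
    ∀ q : {q : ℚ // 0 < q}, ∃ m : ℕ, Void S (above m) ∧
      ∀ k : ℕ, (S ∩ (above q ∩ gridCell m k)).Subsingleton := by
  constructor
  · refine fun h => ⟨fun ξ hξ h0 => (h.pos ξ hξ).ne' h0, fun ⟨q, hq⟩ => ?_⟩
    have hq' : (0 : ℝ) < q := by exact_mod_cast hq
    have hF := h.finite q hq'
    obtain ⟨m₁, hm₁⟩ : ∃ m : ℕ, ∀ ξ ∈ S ∩ above q, diam ξ ≤ m := by
      obtain ⟨M, hM⟩ := (hF.image diam).bddAbove
      obtain ⟨m, hm⟩ := exists_nat_ge M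
      exact ⟨m, fun ξ hξ => (hM ⟨ξ, hξ, rfl⟩).trans hm⟩
    obtain ⟨m₂, hm₂⟩ := exists_gridCell_separating hF hF
    obtain ⟨m₃, hm₃⟩ := exists_nat_ge (q : ℝ)
    -- `m₁` bounds the diameters above `q`, `m₂` makes the grid separate them, and `m₃ ≥ q` ensures
    -- that a curve above the new level is one of those bounded by `m₁`.
    refine ⟨m₁ + m₂ + m₃, fun ξ hξ hξm => ?_, fun k ξ hξ η hη => ?_⟩
    · have hξm' : ((m₁ + m₂ + m₃ : ℕ) : ℝ) < diam ξ := hξm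
      push_cast at hξm'
      have h2 : (0 : ℝ) ≤ m₂ := m₂.cast_nonneg
      have h1 : (0 : ℝ) ≤ m₁ := m₁.cast_nonneg
      have := hm₁ ξ ⟨hξ, show (q : ℝ) < diam ξ by linarith⟩
      linarith
    · by_contra hne
      exact hm₂ (m₁ + m₂ + m₃) (by omega) ξ ⟨hξ.1, hξ.2.1⟩ η ⟨hη.1, hη.2.1⟩
        (fun he => hne (h.inj _ hξ.1 _ hη.1 he)) (hξ.2.2.trans hη.2.2.symm)
  · rintro ⟨h0, h⟩
    have pos : ∀ γ ∈ S, 0 < diam γ := fun γ hγ =>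
      lt_of_le_of_ne (diam_nonneg γ) fun he => h0 γ hγ he.symm
    refine ⟨pos, fun r hr => ?_, fun γ hγ η hη he => ?_⟩
    · obtain ⟨q, hq, hqr⟩ := exists_rat_btwn hr
      have hq0 : 0 < q := by exact_mod_cast hq
      obtain ⟨m, hm, hk⟩ := h ⟨q, hq0⟩
      refine Set.Finite.subset (s := S ∩ above q) ?_
        (Set.inter_subset_inter_right _ fun ξ (hξ : r < diam ξ) => hqr.trans hξ)
      refine Set.Finite.of_finite_image (f := fun ξ => ⌊(m : ℝ) * diam ξ⌋₊) ?_ ?_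
      · refine (Set.finite_Iic (⌊(m : ℝ) * m⌋₊)).subset ?_
        rintro _ ⟨ξ, hξ, rfl⟩
        refine Nat.floor_mono (mul_le_mul_of_nonneg_left ?_ m.cast_nonneg)
        exact not_lt.1 (hm ξ hξ.1)
      · intro ξ hξ η hη he
        exact hk _ ⟨hξ.1, hξ.2, rfl⟩ ⟨hη.1, hη.2, he.symm⟩
    · obtain ⟨q, hq, hqr⟩ := exists_rat_btwn (pos γ hγ)
      have hq0 : 0 < q := by exact_mod_cast hq
      obtain ⟨m, hm, hk⟩ := h ⟨q, hq0⟩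
      exact hk _ ⟨hγ, hqr, rfl⟩ ⟨hη, show (q : ℝ) < diam η from he ▸ hqr,
        show ⌊(m : ℝ) * diam η⌋₊ = _ by rw [he]⟩

theorem measurableSet_good : MeasurableSet {S : CurveSet | Good S.curves} := by
  simp only [good_iff, Set.ofPred_and, Set.ofPred_forall, Set.ofPred_exists]
  refine (measurableSet_void (measurable_diam (MeasurableSet.singleton 0))).inter
    (MeasurableSet.iInter fun q => MeasurableSet.iUnion fun m =>
      (measurableSet_void (measurableSet_above _)).inter (MeasurableSet.iInter fun k =>
        measurableSet_subsingleton ((measurableSet_above _).inter (measurableSet_gridCell m k))))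

/-! ### Completely random sets of curves -/

open Classical in
/-- The indicator of a proposition, as an extended non-negative real. -/
def ind (p : Prop) : ℝ≥0∞ := if p then 1 else 0

theorem ind_le_one (p : Prop) : ind p ≤ 1 := by
  unfold ind; split_ifs <;> simp

theorem ind_and (p q : Prop) : ind (p ∧ q) = ind p * ind q := by
  unfold ind; by_cases hp : p <;> by_cases hq : q <;> simp [hp, hq]

theorem ind_congr {p q : Prop} (h : p ↔ q) : ind p = ind q := by rw [propext h]

theorem ind_true {p : Prop} (h : p) : ind p = 1 := if_pos h

theorem ind_false {p : Prop} (h : ¬ p) : ind p = 0 := if_neg h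

theorem measurable_ind {T : Type*} [MeasurableSpace T] {p : T → Prop}
    (h : MeasurableSet {t | p t}) : Measurable fun t => ind (p t) := by
  classical
  exact Measurable.ite h measurable_const measurable_const

theorem lintegral_ind {T : Type*} [MeasurableSpace T] {m : Measure T} {p : T → Prop}
    (h : MeasurableSet {t | p t}) : ∫⁻ t, ind (p t) ∂m = m {t | p t} := by
  rw [← lintegral_indicator_one h]
  refine lintegral_congr fun t => ?_
  by_cases ht : p t
  · rw [ind_true ht, Set.indicator_of_mem (show t ∈ {t | p t} from ht), Pi.one_apply]
  · rw [ind_false ht, Set.indicator_of_notMem (show t ∉ {t | p t} from ht)]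

theorem tendsto_ind {p : ℕ → Prop} {q : Prop} (h : ∀ᶠ n in Filter.atTop, p n ↔ q) :
    Filter.Tendsto (fun n => ind (p n)) Filter.atTop (nhds (ind q)) :=
  tendsto_const_nhds.congr' (h.mono fun _ hn => (ind_congr hn).symm)

/-- A family of sets of curves that depends measurably on a parameter. -/
def MeasurableFamily {T : Type*} [MeasurableSpace T] (W : T → Set Curve) : Prop :=
  MeasurableSet {p : T × Curve | p.2 ∈ W p.1}

/-! ### Stability of measurable families of regions of curve space -/

section Family

variable {T : Type*} [MeasurableSpace T] {V W : T → Set Curve}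

theorem MeasurableFamily.const {A : Set Curve} (hA : MeasurableSet A) :
    MeasurableFamily fun _ : T => A := measurable_snd hA

theorem MeasurableFamily.inter (hV : MeasurableFamily V) (hW : MeasurableFamily W) :
    MeasurableFamily fun t => V t ∩ W t := MeasurableSet.inter hV hW

theorem MeasurableFamily.union (hV : MeasurableFamily V) (hW : MeasurableFamily W) :
    MeasurableFamily fun t => V t ∪ W t := MeasurableSet.union hV hW

theorem MeasurableFamily.diff (hV : MeasurableFamily V) (hW : MeasurableFamily W) :
    MeasurableFamily fun t => V t \ W t := MeasurableSet.diff hV hW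

theorem MeasurableFamily.iUnion {ι : Type*} [Countable ι] {V : ι → T → Set Curve}
    (hV : ∀ i, MeasurableFamily (V i)) : MeasurableFamily fun t => ⋃ i, V i t := by
  have : {p : T × Curve | p.2 ∈ ⋃ i, V i p.1} = ⋃ i, {p | p.2 ∈ V i p.1} := by
    ext p; simp
  rw [MeasurableFamily, this]
  exact MeasurableSet.iUnion hV

theorem MeasurableFamily.iInter {ι : Type*} [Countable ι] {V : ι → T → Set Curve}
    (hV : ∀ i, MeasurableFamily (V i)) : MeasurableFamily fun t => ⋂ i, V i t := by
  have : {p : T × Curve | p.2 ∈ ⋂ i, V i p.1} = ⋂ i, {p | p.2 ∈ V i p.1} := by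
    ext p; simp
  rw [MeasurableFamily, this]
  exact MeasurableSet.iInter hV

theorem MeasurableFamily.mem (hW : MeasurableFamily W) {γ : T → Curve} (hγ : Measurable γ) :
    MeasurableSet {t | γ t ∈ W t} :=
  (measurable_id.prodMk hγ) hW

theorem MeasurableFamily.apply (hW : MeasurableFamily W) (t : T) : MeasurableSet (W t) :=
  measurable_prodMk_left hW

theorem MeasurableFamily.below {d : T → ℝ} (hd : Measurable d) :
    MeasurableFamily fun t => below (d t) :=
  measurableSet_lt (measurable_diam.comp measurable_snd) (hd.comp measurable_fst)

theorem MeasurableFamily.above {d : T → ℝ} (hd : Measurable d) :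
    MeasurableFamily fun t => above (d t) :=
  measurableSet_lt (hd.comp measurable_fst) (measurable_diam.comp measurable_snd)

theorem MeasurableFamily.pts {x : T → ℚ → Curve} (hx : Measurable x) :
    MeasurableFamily fun t => pts (x t) := by
  have : {p : T × Curve | p.2 ∈ RandomSoup.pts (x p.1)} =
      {p | 0 < diam p.2} ∩ ⋃ i, {p | x p.1 i = p.2} := by
    ext p; simp [RandomSoup.pts]
  rw [MeasurableFamily, this]
  refine (measurableSet_lt measurable_const (measurable_diam.comp measurable_snd)).inter
    (MeasurableSet.iUnion fun i => measurableSet_eq_fun ?_ measurable_snd)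
  exact (measurable_pi_apply i).comp (hx.comp measurable_fst)

theorem measurable_pts_inter (hW : MeasurableFamily W) {x : T → ℚ → Curve} (hx : Measurable x) :
    Measurable fun t => CurveSet.mk (pts (x t) ∩ W t) := by
  refine measurable_curveSet_iff.2 fun A hA => ?_
  simp only [void_inter_left, void_pts, Set.ofPred_forall]
  refine MeasurableSet.iInter fun i => ?_
  have hi : Measurable fun t => x t i := (measurable_pi_apply i).comp hx
  exact (measurableSet_lt measurable_const (measurable_diam.comp hi)).imp
    ((hW.inter (.const hA)).mem hi).compl

theorem measurableSet_void_pts_inter (hW : MeasurableFamily W) {x : T → ℚ → Curve}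
    (hx : Measurable x) {A : Set Curve} (hA : MeasurableSet A) :
    MeasurableSet {t | Void (pts (x t) ∩ W t) A} :=
  measurable_curveSet_iff.1 (measurable_pts_inter hW hx) A hA

theorem measurable_top_pts_inter (hW : MeasurableFamily W) {x : T → ℚ → Curve}
    (hx : Measurable x) : Measurable fun t => top (pts (x t) ∩ W t) :=
  measurable_top.comp (measurable_pts_inter hW hx)

end Family

/-- The law of the enumeration of a completely random set of curves: the events of avoiding
disjoint Borel sets are independent. -/
structure IsCompletelyRandom (q : Measure (ℚ → Curve)) : Prop where
  prob : IsProbabilityMeasure q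
  good : ∀ᵐ x ∂q, Good (pts x)
  void_mul : ∀ A B : Set Curve, MeasurableSet A → MeasurableSet B → Disjoint A B →
    q {x | Void (pts x) (A ∪ B)} = q {x | Void (pts x) A} * q {x | Void (pts x) B}

/-! ### Independence across disjoint regions, and resampling below the largest curve -/

section CompletelyRandom

variable {q : Measure (ℚ → Curve)}

/-- Void events of the two parts are void events of the disjoint sets `W ∩ A` and `Wᶜ ∩ B`, so
multiplicativity gives the product law on a generating π-system. -/
theorem map_inter_compl_of_void_mul {Ω : Type*} [MeasurableSpace Ω] {P : Measure Ω}
    [IsProbabilityMeasure P] {X : Ω → Set Curve} (hX : Measurable fun ω => CurveSet.mk (X ω))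
    (hmul : ∀ A B : Set Curve, MeasurableSet A → MeasurableSet B → Disjoint A B →
      P {ω | Void (X ω) (A ∪ B)} = P {ω | Void (X ω) A} * P {ω | Void (X ω) B})
    {W : Set Curve} (hW : MeasurableSet W) :
    P.map (fun ω => (CurveSet.mk (X ω ∩ W), CurveSet.mk (X ω ∩ Wᶜ))) =
      (P.map fun ω => CurveSet.mk (X ω ∩ W)).prod (P.map fun ω => CurveSet.mk (X ω ∩ Wᶜ)) := by
  have h1 : Measurable fun ω => CurveSet.mk (X ω ∩ W) := (measurable_inter hW).comp hX
  have h2 : Measurable fun ω => CurveSet.mk (X ω ∩ Wᶜ) := (measurable_inter hW.compl).comp hX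
  have := Measure.isProbabilityMeasure_map (μ := P) h1.aemeasurable
  have := Measure.isProbabilityMeasure_map (μ := P) h2.aemeasurable
  symm
  refine Measure.prod_eq_generateFrom (C := voidEvents) (D := voidEvents) rfl rfl
    isPiSystem_voidEvents isPiSystem_voidEvents
    ⟨fun _ => Set.univ, fun _ => univ_mem_voidEvents, fun _ => measure_lt_top _ _,
      Set.iUnion_const _⟩
    ⟨fun _ => Set.univ, fun _ => univ_mem_voidEvents, fun _ => measure_lt_top _ _,
      Set.iUnion_const _⟩ ?_
  rintro _ ⟨A, hA, rfl⟩ _ ⟨B, hB, rfl⟩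
  rw [Measure.map_apply (h1.prodMk h2) ((measurableSet_void hA).prod (measurableSet_void hB)),
    Measure.map_apply h1 (measurableSet_void hA), Measure.map_apply h2 (measurableSet_void hB)]
  have h := hmul (W ∩ A) (Wᶜ ∩ B) (hW.inter hA) (hW.compl.inter hB)
    (Set.disjoint_left.2 fun x hx hx' => hx'.1 hx.1)
  simp only [void_union_right, ← void_inter_left] at h
  exact h

/-- The parts of a completely random set inside and outside of `W` are independent. -/
theorem IsCompletelyRandom.lintegral_split (hq : IsCompletelyRandom q) {W : Set Curve}
    (hW : MeasurableSet W) (f : Set Curve → Set Curve → ℝ≥0∞)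
    (hf : Measurable fun p : (ℚ → Curve) × (ℚ → Curve) => f (pts p.1) (pts p.2)) :
    ∫⁻ x, f (pts x ∩ W) (pts x ∩ Wᶜ) ∂q = ∫⁻ x, ∫⁻ y, f (pts x ∩ W) (pts y ∩ Wᶜ) ∂q ∂q := by
  have := hq.prob
  have h1 : Measurable fun x : ℚ → Curve => CurveSet.mk (pts x ∩ W) :=
    measurable_pts_inter (.const hW) measurable_id
  have h2 : Measurable fun x : ℚ → Curve => CurveSet.mk (pts x ∩ Wᶜ) :=
    measurable_pts_inter (.const hW.compl) measurable_id
  -- The functional `f` is only assumed measurable along enumerations. Passing through `pts ∘ enum`,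
  -- which is the identity on good sets, makes it a measurable function of the sets themselves.
  set F : CurveSet × CurveSet → ℝ≥0∞ :=
    fun p => f (pts (enum p.1.curves)) (pts (enum p.2.curves)) with hF
  have hFm : Measurable F := hf.comp ((measurable_enum.comp measurable_fst).prodMk
    (measurable_enum.comp measurable_snd))
  have e := congrArg (fun m => ∫⁻ p, F p ∂m) 
    (map_inter_compl_of_void_mul measurable_pts hq.void_mul hW)
  beta_reduce at e
  rw [lintegral_map hFm (h1.prodMk h2), lintegral_prod _ hFm.aemeasurable,
    lintegral_map hFm.lintegral_prod_right' h1] at e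
  have e' : ∀ x, ∫⁻ S, F (CurveSet.mk (pts x ∩ W), S) ∂(q.map fun x => CurveSet.mk (pts x ∩ Wᶜ)) =
      ∫⁻ y, F (CurveSet.mk (pts x ∩ W), CurveSet.mk (pts y ∩ Wᶜ)) ∂q := fun x =>
    lintegral_map (hFm.comp measurable_prodMk_left) h2
  have hg : ∀ x, Good (pts x) → ∀ V, pts (enum (pts x ∩ V)) = pts x ∩ V := fun x hx V =>
    pts_enum (hx.mono Set.inter_subset_left)
  calc ∫⁻ x, f (pts x ∩ W) (pts x ∩ Wᶜ) ∂q
      = ∫⁻ x, F (CurveSet.mk (pts x ∩ W), CurveSet.mk (pts x ∩ Wᶜ)) ∂q := by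
        refine lintegral_congr_ae ?_
        filter_upwards [hq.good] with x hx
        simp only [hF, hg x hx]
    _ = ∫⁻ x, ∫⁻ y, F (CurveSet.mk (pts x ∩ W), CurveSet.mk (pts y ∩ Wᶜ)) ∂q ∂q := by
        rw [e]; exact lintegral_congr e'
    _ = _ := by
        refine lintegral_congr_ae ?_
        filter_upwards [hq.good] with x hx
        refine lintegral_congr_ae ?_
        filter_upwards [hq.good] with y hy
        simp only [hF, hg x hx, hg y hy]

/-- The index of the largest multiple of `1 / (n + 1)` that is smaller than `d`. -/
def levelIndex (n : ℕ) (d : ℝ) : ℕ := ⌈((n : ℝ) + 1) * d⌉₊ - 1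

/-- The largest multiple of `1 / (n + 1)` that is smaller than `d`. -/
def level (n : ℕ) (d : ℝ) : ℝ := levelIndex n d / (n + 1)

theorem levelIndex_zero (n : ℕ) : levelIndex n 0 = 0 := by simp [levelIndex]

theorem levelIndex_cast {n : ℕ} {d : ℝ} (hd : 0 < d) :
    (levelIndex n d : ℝ) = (⌈((n : ℝ) + 1) * d⌉₊ : ℝ) - 1 := by
  have : 0 < ((n : ℝ) + 1) * d := by positivity
  rw [levelIndex, Nat.cast_sub (Nat.one_le_iff_ne_zero.2 (Nat.ceil_pos.2 this).ne'), Nat.cast_one]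

/-- Subtracting one from the ceiling keeps the inequality strict even when `d` is itself a multiple
of `1 / (n + 1)`. -/
theorem level_lt {n : ℕ} {d : ℝ} (hd : 0 < d) : level n d < d := by
  have h0 : 0 < ((n : ℝ) + 1) := by positivity
  rw [level, div_lt_iff₀ h0, levelIndex_cast hd]
  have := Nat.ceil_lt_add_one (show 0 ≤ ((n : ℝ) + 1) * d by positivity)
  linarith

theorem le_level {n : ℕ} {d : ℝ} (hd : 0 < d) : d - 1 / ((n : ℝ) + 1) ≤ level n d := by
  have h0 : 0 < ((n : ℝ) + 1) := by positivity
  rw [level, le_div_iff₀ h0, levelIndex_cast hd, sub_mul, one_div, inv_mul_cancel₀ h0.ne']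
  have := Nat.le_ceil (((n : ℝ) + 1) * d)
  linarith

theorem measurable_levelIndex (n : ℕ) : Measurable (levelIndex n) :=
  (measurable_from_top (f := fun k : ℕ => k - 1)).comp
    (Nat.measurable_ceil.comp (measurable_const.mul measurable_id))

theorem measurable_level (n : ℕ) : Measurable (level n) :=
  ((measurable_from_top (f := fun k : ℕ => (k : ℝ))).comp (measurable_levelIndex n)).div_const _

/-- The curves above `k / (n + 1)` decide whether the discretised diameter of the largest curve has
index `k`. This makes the random threshold deterministic on each such event. -/
theorem Good.levelIndex_top_iff {S : Set Curve} (hS : Good S) (n k : ℕ) (B : Set Curve) :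
    (levelIndex n (diam (top S)) = k ∧ top S ∈ B) ↔
      (levelIndex n (diam (top (S ∩ above (k / ((n : ℝ) + 1))))) = k ∧
        top (S ∩ above (k / ((n : ℝ) + 1))) ∈ B) := by
  set t : ℝ := k / ((n : ℝ) + 1) with ht
  rcases S.eq_empty_or_nonempty with rfl | hne
  · simp
  obtain ⟨γ, hγ⟩ := hS.exists_isTop hne
  rw [top_eq_of_isTop hγ]
  rcases lt_or_ge t (diam γ) with hlt | hle
  · rw [(hS.mono Set.inter_subset_left).top_eq (γ := γ)
      ⟨⟨hγ.isLargest.1, hlt⟩, fun η hη => hγ.isLargest.2 η hη.1⟩]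
  · have hemp : S ∩ above t = ∅ := by
      refine Set.eq_empty_of_forall_notMem fun η hη => ?_
      have h1 : t < diam η := hη.2
      rcases eq_or_ne η γ with rfl | hne'
      · linarith
      · linarith [hγ.isLargest.2 η hη.1 hne']
    have hd : top (S ∩ above t) = dummy := by
      rw [hemp]
      refine top_eq_dummy ?_
      rintro ⟨η, hη⟩
      exact hη.isLargest.1
    rw [hd, diam_dummy, levelIndex_zero]
    -- If the largest curve is not above the threshold, the left side contradicts `level_lt`; on the
    -- right, the dummy curve has index `0`, so the threshold is `0`, below every positive diameter.
    refine iff_of_false (fun h => ?_) (fun h => ?_)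
    · have := level_lt (n := n) hγ.diam_pos
      rw [level, h.1] at this
      linarith
    · have := hγ.diam_pos
      rw [ht, ← h.1] at hle
      simp at hle
      linarith

/-- The levels approach `d` strictly from below, so each given diameter below `d` is eventually at
most the level. For `d = 0` both regions contain no curve of positive diameter. -/
theorem void_level_iff {y : Set Curve} (hy : ∀ ξ ∈ y, 0 < diam ξ) (d : ℝ) (hd : 0 ≤ d)
    (A : Set Curve) : ∀ᶠ n : ℕ in Filter.atTop,
      (Void (y ∩ (above (level n d))ᶜ) A ↔ Void (y ∩ below d) A) := by
  rcases hd.eq_or_lt with rfl | hd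
  · refine Filter.Eventually.of_forall fun n => iff_of_true ?_ ?_
    · rintro ξ ⟨h1, h2⟩
      refine absurd (hy ξ h1) fun h => h2 ?_
      simpa [above, level, levelIndex_zero] using h
    · rintro ξ ⟨h1, h2⟩
      exact absurd (hy ξ h1) (not_lt.2 (le_of_lt h2))
  · by_cases hv : Void (y ∩ below d) A
    · refine Filter.Eventually.of_forall fun n => iff_of_true ?_ hv
      refine hv.mono (Set.inter_subset_inter_right _ fun ξ hξ => ?_) subset_rfl
      exact lt_of_le_of_lt (not_lt.1 (show ¬ level n d < diam ξ from hξ)) (level_lt hd)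
    · have hv' := hv
      simp only [Void, not_forall, not_not] at hv'
      obtain ⟨ξ, ⟨hξy, hξd⟩, hξA⟩ := hv'
      have hξd' : diam ξ < d := hξd
      have hlim := tendsto_one_div_add_atTop_nhds_zero_nat (𝕜 := ℝ)
      filter_upwards [hlim.eventually_lt_const (sub_pos.2 hξd')] with n hn
      refine iff_of_false (fun h => h ξ ⟨hξy, fun hab => ?_⟩ hξA) hv
      have h1 : level n d < diam ξ := hab
      linarith [le_level (n := n) hd]

/-- On the event that the level has index `k`, the threshold is the constant `k / (n + 1)` and
`lintegral_split` applies to the curves above and not above it; summing over `k` gives the claim. -/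
theorem IsCompletelyRandom.lintegral_level (hq : IsCompletelyRandom q) {W A B : Set Curve}
    (hW : MeasurableSet W) (hA : MeasurableSet A) (hB : MeasurableSet B) (n : ℕ) :
    ∫⁻ x, ind (top (pts x ∩ W) ∈ B ∧
        Void (pts x ∩ W ∩ (above (level n (diam (top (pts x ∩ W)))))ᶜ) A) ∂q =
      ∫⁻ x, ∫⁻ y, ind (top (pts x ∩ W) ∈ B ∧
        Void (pts y ∩ W ∩ (above (level n (diam (top (pts x ∩ W)))))ᶜ) A) ∂q ∂q := by
  have := hq.prob
  have hg : Measurable fun x : ℚ → Curve => top (pts x ∩ W) :=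
    measurable_top_pts_inter (.const hW) measurable_id
  have key : ∀ k : ℕ, ∫⁻ x, ind ((levelIndex n (diam (top (pts x ∩ W))) = k ∧
        top (pts x ∩ W) ∈ B) ∧ Void (pts x ∩ W ∩ (above (k / ((n : ℝ) + 1)))ᶜ) A) ∂q =
      ∫⁻ x, ∫⁻ y, ind ((levelIndex n (diam (top (pts x ∩ W))) = k ∧
        top (pts x ∩ W) ∈ B) ∧ Void (pts y ∩ W ∩ (above (k / ((n : ℝ) + 1)))ᶜ) A) ∂q ∂q := by
    intro k
    have := hq.lintegral_split (measurableSet_above (k / ((n : ℝ) + 1)))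
      (fun S R => ind ((levelIndex n (diam (top (S ∩ W))) = k ∧
        top (S ∩ W) ∈ B) ∧ Void (R ∩ W) A)) ?_
    · convert this using 1
      · refine lintegral_congr_ae ?_
        filter_upwards [hq.good] with x hx
        rw [Set.inter_right_comm (pts x) _ W, Set.inter_right_comm (pts x) _ W]
        exact ind_congr (and_congr_left' ((hx.mono Set.inter_subset_left).levelIndex_top_iff n k B))
      · refine lintegral_congr_ae ?_
        filter_upwards [hq.good] with x hx
        refine lintegral_congr fun y => ?_
        rw [Set.inter_right_comm (pts x) _ W, Set.inter_right_comm (pts y) _ W]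
        exact ind_congr (and_congr_left' ((hx.mono Set.inter_subset_left).levelIndex_top_iff n k B))
    · refine measurable_ind (MeasurableSet.inter (MeasurableSet.inter ?_ ?_) ?_)
      · exact ((measurable_levelIndex n).comp (measurable_diam.comp (hg.comp measurable_fst)))
          (MeasurableSet.singleton k)
      · exact (hg.comp measurable_fst) hB
      · exact measurableSet_void_pts_inter (.const hW) measurable_snd hA
  have hsum : ∀ x y : ℚ → Curve, ind (top (pts x ∩ W) ∈ B ∧
      Void (pts y ∩ W ∩ (above (level n (diam (top (pts x ∩ W)))))ᶜ) A) =
      ∑' k : ℕ, ind ((levelIndex n (diam (top (pts x ∩ W))) = k ∧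
        top (pts x ∩ W) ∈ B) ∧ Void (pts y ∩ W ∩ (above (k / ((n : ℝ) + 1)))ᶜ) A) := by
    intro x y
    rw [tsum_eq_single (levelIndex n (diam (top (pts x ∩ W))))]
    · exact ind_congr ⟨fun h => ⟨⟨rfl, h.1⟩, h.2⟩, fun h => ⟨h.1.2, h.2⟩⟩
    · intro k hk
      exact ind_false fun h => hk h.1.1.symm
  have hm : ∀ k : ℕ, Measurable fun p : (ℚ → Curve) × (ℚ → Curve) =>
      ind ((levelIndex n (diam (top (pts p.1 ∩ W))) = k ∧
        top (pts p.1 ∩ W) ∈ B) ∧ Void (pts p.2 ∩ W ∩ (above (k / ((n : ℝ) + 1)))ᶜ) A) := by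
    intro k
    refine measurable_ind (MeasurableSet.inter (MeasurableSet.inter ?_ ?_) ?_)
    · exact ((measurable_levelIndex n).comp (measurable_diam.comp (hg.comp measurable_fst)))
        (MeasurableSet.singleton k)
    · exact (hg.comp measurable_fst) hB
    · simp only [Set.inter_assoc]
      exact measurableSet_void_pts_inter (.const (hW.inter (measurableSet_above _).compl))
        measurable_snd hA
  simp only [hsum]
  have hdiag : Measurable fun x : ℚ → Curve => (x, x) := measurable_id.prodMk measurable_id
  refine (lintegral_tsum fun k => ((hm k).comp hdiag).aemeasurable).trans ?_
  refine (tsum_congr key).trans ?_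
  refine (lintegral_tsum fun k => (hm k).lintegral_prod_right'.aemeasurable).symm.trans ?_
  exact lintegral_congr fun x =>
    (lintegral_tsum fun k => ((hm k).comp measurable_prodMk_left).aemeasurable).symm

/-- The limit of `lintegral_level` as the mesh tends to zero. -/
theorem IsCompletelyRandom.lintegral_top_void (hq : IsCompletelyRandom q) {W A B : Set Curve}
    (hW : MeasurableSet W) (hA : MeasurableSet A) (hB : MeasurableSet B) :
    ∫⁻ x, ind (top (pts x ∩ W) ∈ B ∧
        Void (pts x ∩ W ∩ below (diam (top (pts x ∩ W)))) A) ∂q =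
      ∫⁻ x, ∫⁻ y, ind (top (pts x ∩ W) ∈ B ∧
        Void (pts y ∩ W ∩ below (diam (top (pts x ∩ W)))) A) ∂q ∂q := by
  have := hq.prob
  have hg : Measurable fun x : ℚ → Curve => top (pts x ∩ W) :=
    measurable_top_pts_inter (.const hW) measurable_id
  have hm : ∀ n : ℕ, Measurable fun p : (ℚ → Curve) × (ℚ → Curve) =>
      ind (top (pts p.1 ∩ W) ∈ B ∧
        Void (pts p.2 ∩ W ∩ (above (level n (diam (top (pts p.1 ∩ W)))))ᶜ) A) := by
    intro n
    refine measurable_ind (MeasurableSet.inter ((hg.comp measurable_fst) hB) ?_)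
    simp only [Set.inter_assoc]
    refine measurableSet_void_pts_inter ((MeasurableFamily.const hW).inter ?_) measurable_snd hA
    exact MeasurableSet.compl (MeasurableFamily.above
      ((measurable_level n).comp (measurable_diam.comp (hg.comp measurable_fst))))
  have hlim : ∀ x y : ℚ → Curve, Filter.Tendsto (fun n => ind (top (pts x ∩ W) ∈ B ∧
        Void (pts y ∩ W ∩ (above (level n (diam (top (pts x ∩ W)))))ᶜ) A)) Filter.atTop
        (nhds (ind (top (pts x ∩ W) ∈ B ∧
          Void (pts y ∩ W ∩ below (diam (top (pts x ∩ W)))) A))) := fun x y =>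
    tendsto_ind ((void_level_iff (fun ξ hξ => hξ.1.1) _ (diam_nonneg _) A).mono
      fun n hn => and_congr_right' hn)
  have t1 := tendsto_lintegral_of_dominated_convergence (μ := q) (fun _ => 1)
    (fun n => (hm n).comp (measurable_id.prodMk measurable_id))
    (fun n => Filter.Eventually.of_forall fun x => ind_le_one _) (by simp)
    (Filter.Eventually.of_forall fun x => hlim x x)
  have t2 := tendsto_lintegral_of_dominated_convergence (μ := q) (fun _ => 1)
    (fun n => (hm n).lintegral_prod_right')
    (fun n => Filter.Eventually.of_forall fun x =>
      (lintegral_mono fun y => ind_le_one _).trans (by simp)) (by simp)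
    (Filter.Eventually.of_forall fun x =>
      tendsto_lintegral_of_dominated_convergence (μ := q) (fun _ => 1)
        (fun n => (hm n).comp (measurable_prodMk_left (x := x)))
        (fun n => Filter.Eventually.of_forall fun y => ind_le_one _) (by simp)
        (Filter.Eventually.of_forall fun y => hlim x y))
  refine tendsto_nhds_unique t1 (t2.congr fun n => ?_)
  exact (hq.lintegral_level hW hA hB n).symm

/-- Given the largest curve of a completely random set in `W`, the smaller curves in `W` may be
resampled. -/
theorem IsCompletelyRandom.lintegral_top (hq : IsCompletelyRandom q) {W : Set Curve}
    (hW : MeasurableSet W) (f : Curve → Set Curve → ℝ≥0∞)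
    (hf : Measurable fun p : Curve × (ℚ → Curve) => f p.1 (pts p.2)) :
    ∫⁻ x, f (top (pts x ∩ W)) (pts x ∩ W ∩ below (diam (top (pts x ∩ W)))) ∂q =
      ∫⁻ x, ∫⁻ y, f (top (pts x ∩ W)) (pts y ∩ W ∩ below (diam (top (pts x ∩ W)))) ∂q ∂q := by
  have := hq.prob
  have hg : Measurable fun x : ℚ → Curve => top (pts x ∩ W) :=
    measurable_top_pts_inter (.const hW) measurable_id
  have hr : Measurable fun p : (ℚ → Curve) × (ℚ → Curve) => (top (pts p.1 ∩ W),
      CurveSet.mk (pts p.2 ∩ W ∩ below (diam (top (pts p.1 ∩ W))))) := by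
    refine (hg.comp measurable_fst).prodMk ?_
    simp only [Set.inter_assoc]
    exact measurable_pts_inter ((MeasurableFamily.const hW).inter
      (.below (measurable_diam.comp (hg.comp measurable_fst)))) measurable_snd
  have hs : Measurable fun x : ℚ → Curve => (top (pts x ∩ W),
      CurveSet.mk (pts x ∩ W ∩ below (diam (top (pts x ∩ W))))) :=
    hr.comp (measurable_id.prodMk measurable_id)
  -- Indicators of "top in `B`" and "remainder void on `A`" generate the product σ-algebra, so the
  -- preceding lemma is an equality of joint laws.
  have hm : q.map (fun x => (top (pts x ∩ W),
      CurveSet.mk (pts x ∩ W ∩ below (diam (top (pts x ∩ W)))))) =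
      (q.prod q).map (fun p => (top (pts p.1 ∩ W),
      CurveSet.mk (pts p.2 ∩ W ∩ below (diam (top (pts p.1 ∩ W)))))) := by
    have hp1 := Measure.isProbabilityMeasure_map (μ := q) hs.aemeasurable
    have hp2 := Measure.isProbabilityMeasure_map (μ := q.prod q) hr.aemeasurable
    refine ext_of_generate_finite _ (generateFrom_eq_prod (C := {s : Set Curve | MeasurableSet s})
      (D := voidEvents) MeasurableSpace.generateFrom_measurableSet rfl
      ⟨fun _ => Set.univ, fun _ => MeasurableSet.univ (α := Curve), Set.iUnion_const _⟩
      ⟨fun _ => Set.univ, fun _ => univ_mem_voidEvents, Set.iUnion_const _⟩).symm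
      (MeasurableSpace.isPiSystem_measurableSet.prod isPiSystem_voidEvents) ?_ ?_
    · rintro _ ⟨B, hB, _, ⟨A, hA, rfl⟩, rfl⟩
      have hBA := (show MeasurableSet B from hB).prod (measurableSet_void hA)
      refine (?_ : q.map _ (B ×ˢ {S : CurveSet | Void S.curves A}) =
        (q.prod q).map _ (B ×ˢ {S : CurveSet | Void S.curves A}))
      rw [Measure.map_apply hs hBA, Measure.map_apply hr hBA]
      have h := hq.lintegral_top_void hW hA hB
      refine (lintegral_ind (hs hBA)).symm.trans (h.trans ?_)
      refine (lintegral_prod (fun p : (ℚ → Curve) × (ℚ → Curve) => ind (top (pts p.1 ∩ W) ∈ B ∧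
        Void (pts p.2 ∩ W ∩ below (diam (top (pts p.1 ∩ W)))) A))
          (measurable_ind (hr hBA)).aemeasurable).symm.trans (lintegral_ind (hr hBA))
    · exact hp1.measure_univ.trans hp2.measure_univ.symm
  set F : Curve × CurveSet → ℝ≥0∞ := fun p => f p.1 (pts (enum p.2.curves)) with hF
  have hFm : Measurable F :=
    hf.comp (measurable_fst.prodMk (measurable_enum.comp measurable_snd))
  have e := congrArg (fun m => ∫⁻ p, F p ∂m) hm
  beta_reduce at e
  rw [lintegral_map hFm hs, lintegral_map hFm hr] at e
  replace e := e.trans (lintegral_prod _ (hFm.comp hr).aemeasurable)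
  have hgd : ∀ x, Good (pts x) → ∀ U V, pts (enum (pts x ∩ U ∩ V)) = pts x ∩ U ∩ V :=
    fun x hx U V => pts_enum (hx.mono (Set.inter_subset_left.trans Set.inter_subset_left))
  convert e using 1
  · refine lintegral_congr_ae ?_
    filter_upwards [hq.good] with x hx
    simp only [hF, hgd x hx]
  · refine lintegral_congr fun x => lintegral_congr_ae ?_
    filter_upwards [hq.good] with y hy
    simp only [hF, hgd y hy]

end CompletelyRandom

/-! ### Exploration of a cluster by generations -/

/-- The curves that belong to `F` or are linked to a curve of `F`. -/
def linkTo (F : Set Curve) : Set Curve := {ξ | ∃ η ∈ F, ξ = η ∨ Linked ξ η}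

theorem linkTo_union (F G : Set Curve) : linkTo (F ∪ G) = linkTo F ∪ linkTo G := by
  ext ξ
  simp only [linkTo, Set.mem_ofPred_eq, Set.mem_union, or_and_right, exists_or]

theorem linkTo_iUnion {ι : Type*} (F : ι → Set Curve) : linkTo (⋃ i, F i) = ⋃ i, linkTo (F i) := by
  ext ξ
  simp only [linkTo, Set.mem_ofPred_eq, Set.mem_iUnion]
  constructor
  · rintro ⟨η, ⟨i, hi⟩, h⟩
    exact ⟨i, η, hi, h⟩
  · rintro ⟨i, η, hi, h⟩
    exact ⟨η, ⟨i, hi⟩, h⟩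

theorem linkTo_mono {F G : Set Curve} (h : F ⊆ G) : linkTo F ⊆ linkTo G :=
  fun _ ⟨η, hη, h'⟩ => ⟨η, h hη, h'⟩

theorem notMem_linkTo_iff {ξ : Curve} {F : Set Curve} : ξ ∉ linkTo F ↔ AvoidsLinks ξ F := by
  simp only [linkTo, AvoidsLinks, Set.mem_ofPred_eq, not_exists, not_and, not_or, ne_eq]

/-- The first `k` generations of the exploration, among the curves of `S` in `W`, that starts from
the curves of `F`. -/
def spread : ℕ → Set Curve → Set Curve → Set Curve → Set Curve
  | 0, _, _, _ => ∅
  | k + 1, F, W, S => S ∩ (linkTo F ∩ W) ∪ spread k (S ∩ (linkTo F ∩ W)) (W \ linkTo F) S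

/-- The part of `W` that has not been looked at after `k` generations of the exploration. -/
def unseen : ℕ → Set Curve → Set Curve → Set Curve → Set Curve
  | 0, _, W, _ => W
  | k + 1, F, W, S => unseen k (S ∩ (linkTo F ∩ W)) (W \ linkTo F) S

/-- The exploration reads `S` only inside `W`. Hence the generations after the first depend on `S`
only outside `linkTo F`, the part independent of the first generation. -/
theorem spread_inter (k : ℕ) {F W V S : Set Curve} (h : W ⊆ V) :
    spread k F W (S ∩ V) = spread k F W S := by
  induction k generalizing F W with
  | zero => rfl
  | succ k ih =>
    have e : S ∩ V ∩ (linkTo F ∩ W) = S ∩ (linkTo F ∩ W) := by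
      rw [Set.inter_assoc, Set.inter_eq_right.2 (Set.inter_subset_right.trans h)]
    simp only [spread, e, ih (Set.sdiff_subset.trans h)]

theorem unseen_inter (k : ℕ) {F W V S : Set Curve} (h : W ⊆ V) :
    unseen k F W (S ∩ V) = unseen k F W S := by
  induction k generalizing F W with
  | zero => rfl
  | succ k ih =>
    have e : S ∩ V ∩ (linkTo F ∩ W) = S ∩ (linkTo F ∩ W) := by
      rw [Set.inter_assoc, Set.inter_eq_right.2 (Set.inter_subset_right.trans h)]
    simp only [unseen, e, ih (Set.sdiff_subset.trans h)]

theorem spread_subset (k : ℕ) (F W S : Set Curve) : spread k F W S ⊆ S ∩ W := by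
  induction k generalizing F W with
  | zero => exact Set.empty_subset _
  | succ k ih =>
    exact Set.union_subset (Set.inter_subset_inter_right _ Set.inter_subset_right)
      ((ih _ _).trans (Set.inter_subset_inter_right _ Set.sdiff_subset))

theorem spread_subset_succ (k : ℕ) (F W S : Set Curve) :
    spread k F W S ⊆ spread (k + 1) F W S := by
  induction k generalizing F W with
  | zero => exact Set.empty_subset _
  | succ k ih => exact Set.union_subset_union_right _ (ih _ _)

theorem spread_mono (F W S : Set Curve) : Monotone fun k => spread k F W S :=
  monotone_nat_of_le_succ fun k => spread_subset_succ k F W S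

/-- The index is shifted because step `k + 1` removes the neighbours of generation `k`, while the
neighbours of the newest generation have not been examined. -/
theorem unseen_succ (k : ℕ) (F W S : Set Curve) :
    unseen (k + 1) F W S = W \ linkTo (F ∪ spread k F W S) := by
  induction k generalizing F W with
  | zero => simp [unseen, spread]
  | succ k ih =>
    rw [unseen, ih, spread, linkTo_union F, Set.sdiff_sdiff]

theorem unseen_antitone (F W S : Set Curve) : Antitone fun k => unseen k F W S := by
  refine antitone_nat_of_succ_le fun k => ?_
  cases k with
  | zero => exact (unseen_succ 0 F W S).trans_subset Set.sdiff_subset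
  | succ k =>
    rw [unseen_succ, unseen_succ]
    exact Set.sdiff_subset_sdiff_right
      (linkTo_mono (Set.union_subset_union_right _ (spread_subset_succ k F W S)))

/-- The cluster of the curves of `F`, together with the curves of `S` in `W`. -/
def grow (F W S : Set Curve) : Set Curve := F ∪ ⋃ k, spread k F W S

theorem iInter_unseen (F W S : Set Curve) : ⋂ k, unseen k F W S = W \ linkTo (grow F W S) := by
  have h1 : ⋂ k, unseen k F W S = ⋂ k, unseen (k + 1) F W S :=
    ((unseen_antitone F W S).iInter_nat_add 1).symm
  rw [h1, grow]
  simp only [unseen_succ, linkTo_union, linkTo_iUnion]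
  ext ξ
  simp only [Set.mem_iInter, Set.mem_sdiff, Set.mem_union, Set.mem_iUnion, not_or, not_exists]
  exact ⟨fun h => ⟨(h 0).1, (h 0).2.1, fun k => (h k).2.2⟩, fun h k => ⟨h.1, h.2.1, h.2.2 k⟩⟩

/-- Either `b` is already linked to `F` and belongs to the first generation, or it survives in `W \
linkTo F` and the induction continues from that generation. -/
theorem mem_spread_succ (k : ℕ) {F W S : Set Curve} {a b : Curve} (ha : a ∈ F ∪ spread k F W S)
    (hb : b ∈ S ∩ W) (hab : Linked b a) : b ∈ spread (k + 1) F W S := by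
  induction k generalizing F W with
  | zero =>
    refine Or.inl ⟨hb.1, ⟨a, ?_, Or.inr hab⟩, hb.2⟩
    simpa [spread] using ha
  | succ k ih =>
    by_cases hF : b ∈ linkTo F
    · exact Or.inl ⟨hb.1, hF, hb.2⟩
    · refine Or.inr (ih ?_ ⟨hb.1, hb.2, hF⟩)
      rcases ha with ha | ha
      · exact absurd ⟨a, ha, Or.inr hab⟩ hF
      · exact ha

theorem mem_grow_of_linked {F W S : Set Curve} {a b : Curve} (ha : a ∈ grow F W S)
    (hb : b ∈ S ∩ W) (hab : Linked b a) : b ∈ grow F W S := by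
  rcases ha with ha | ha
  · exact Or.inr (Set.mem_iUnion.2 ⟨1, mem_spread_succ 0 (Or.inl ha) hb hab⟩)
  · obtain ⟨k, hk⟩ := Set.mem_iUnion.1 ha
    exact Or.inr (Set.mem_iUnion.2 ⟨k + 1, mem_spread_succ k (Or.inr hk) hb hab⟩)

theorem grow_subset (F W S : Set Curve) : grow F W S ⊆ F ∪ S ∩ W :=
  Set.union_subset_union_right _ (Set.iUnion_subset fun k => spread_subset k F W S)

theorem spread_subset_cluster (k : ℕ) {γ : Curve} {F W S U : Set Curve} (hU : S ∩ W ⊆ U)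
    (hFU : F ⊆ clusterCurves γ U) : spread k F W S ⊆ clusterCurves γ U := by
  induction k generalizing F W with
  | zero => exact Set.empty_subset _
  | succ k ih =>
    have h1 : S ∩ (linkTo F ∩ W) ⊆ clusterCurves γ U := by
      rintro ξ ⟨hξS, ⟨η, hη, hl⟩, hξW⟩
      rcases hl with rfl | hl
      · exact hFU hη
      · have hξU := hU ⟨hξS, hξW⟩
        exact ⟨hξU, (hFU hη).2.tail ⟨(hFU hη).1, hξU, hl.symm⟩⟩
    exact Set.union_subset h1
      (ih ((Set.inter_subset_inter_right _ Set.sdiff_subset).trans hU) h1)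

/-- The exploration by generations yields the cluster. -/
theorem clusterCurves_eq_grow (γ : Curve) (W S : Set Curve) :
    clusterCurves γ (S ∩ W ∪ {γ}) = grow {γ} W S := by
  refine Set.Subset.antisymm ?_ ?_
  · rintro η ⟨-, h⟩
    induction h with
    | refl => exact Or.inl rfl
    | tail _ hbc ih =>
      obtain ⟨-, hc, hl⟩ := hbc
      rcases hc with hc | rfl
      · exact mem_grow_of_linked ih hc hl.symm
      · exact Or.inl rfl
  · have hγ : ({γ} : Set Curve) ⊆ clusterCurves γ (S ∩ W ∪ {γ}) := by
      rintro _ rfl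
      exact ⟨Or.inr rfl, .refl⟩
    exact Set.union_subset hγ (Set.iUnion_subset fun k =>
      spread_subset_cluster k Set.subset_union_left hγ)

/-! ### Measurability of the exploration by generations -/

section Measurability

variable {T : Type*} [MeasurableSpace T]

open Classical in
/-- The enumeration of the curves in `A`. -/
def restrictSeq (x : ℚ → Curve) (A : Set Curve) (i : ℚ) : Curve := if x i ∈ A then x i else dummy

/-- Each generation stays in enumerated form, so it can serve as the starting set of the next one in
measurability inductions. -/
theorem pts_restrictSeq (x : ℚ → Curve) (A : Set Curve) : pts (restrictSeq x A) = pts x ∩ A := by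
  ext ξ
  constructor
  · rintro ⟨h0, i, hi⟩
    by_cases h : x i ∈ A
    · rw [restrictSeq, if_pos h] at hi
      exact ⟨⟨h0, i, hi⟩, hi ▸ h⟩
    · rw [restrictSeq, if_neg h] at hi
      rw [← hi, diam_dummy] at h0
      exact absurd h0 (lt_irrefl _)
  · rintro ⟨⟨h0, i, rfl⟩, hA⟩
    exact ⟨h0, i, if_pos hA⟩

theorem measurable_restrictSeq {W : T → Set Curve} (hW : MeasurableFamily W) {x : T → ℚ → Curve}
    (hx : Measurable x) : Measurable fun t => restrictSeq (x t) (W t) := by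
  refine measurable_pi_lambda _ fun i => ?_
  have hi : Measurable fun t => x t i := (measurable_pi_apply i).comp hx
  classical
  exact Measurable.ite (hW.mem hi) hi measurable_const

theorem pts_const {γ : Curve} (h : 0 < diam γ) : pts (fun _ => γ) = {γ} := by
  ext ξ
  constructor
  · rintro ⟨_, _, h'⟩
    exact h'.symm
  · rintro rfl
    exact ⟨h, 0, rfl⟩

theorem pts_const_eq_empty {γ : Curve} (h : ¬ 0 < diam γ) : pts (fun _ => γ) = ∅ :=
  Set.eq_empty_of_forall_notMem fun _ ⟨h0, _, hi⟩ => h (by rwa [← show γ = _ from hi] at h0)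

theorem MeasurableFamily.linkTo {x : T → ℚ → Curve} (hx : Measurable x) :
    MeasurableFamily fun t => linkTo (RandomSoup.pts (x t)) := by
  have : {p : T × Curve | p.2 ∈ RandomSoup.linkTo (RandomSoup.pts (x p.1))} =
      ⋃ i, {p | 0 < diam (x p.1 i)} ∩ ({p | p.2 = x p.1 i} ∪ {p | Linked p.2 (x p.1 i)}) := by
    ext p
    simp only [RandomSoup.linkTo, RandomSoup.pts, Set.mem_ofPred_eq, Set.mem_iUnion,
      Set.mem_inter_iff, Set.mem_union]
    constructor
    · rintro ⟨η, ⟨h0, i, rfl⟩, h⟩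
      exact ⟨i, h0, h⟩
    · rintro ⟨i, h0, h⟩
      exact ⟨_, ⟨h0, i, rfl⟩, h⟩
  rw [MeasurableFamily, this]
  refine MeasurableSet.iUnion fun i => ?_
  have hi : Measurable fun p : T × Curve => x p.1 i :=
    (measurable_pi_apply i).comp (hx.comp measurable_fst)
  exact (measurableSet_lt measurable_const (measurable_diam.comp hi)).inter
    ((measurableSet_eq_fun measurable_snd hi).union
      ((measurable_snd.prodMk hi) measurableSet_linked))

theorem MeasurableFamily.spread_unseen (k : ℕ) {W : T → Set Curve} (hW : MeasurableFamily W)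
    {x y : T → ℚ → Curve} (hx : Measurable x) (hy : Measurable y) :
    MeasurableFamily (fun t => spread k (RandomSoup.pts (y t)) (W t) (RandomSoup.pts (x t))) ∧
      MeasurableFamily
        (fun t => unseen k (RandomSoup.pts (y t)) (W t) (RandomSoup.pts (x t))) := by
  induction k generalizing W y with
  | zero => exact ⟨MeasurableSet.empty, hW⟩
  | succ k ih =>
    have hl := MeasurableFamily.linkTo hy
    have h := ih (hW.diff hl) (measurable_restrictSeq (hl.inter hW) hx)
    simp only [pts_restrictSeq] at h
    exact ⟨((MeasurableFamily.pts hx).inter (hl.inter hW)).union h.1, h.2⟩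

theorem MeasurableFamily.grow {W : T → Set Curve} (hW : MeasurableFamily W)
    {x y : T → ℚ → Curve} (hx : Measurable x) (hy : Measurable y) :
    MeasurableFamily (fun t => grow (RandomSoup.pts (y t)) (W t) (RandomSoup.pts (x t))) :=
  (MeasurableFamily.pts hy).union
    (MeasurableFamily.iUnion fun k => (MeasurableFamily.spread_unseen k hW hx hy).1)

theorem MeasurableFamily.diff_linkTo_grow {W : T → Set Curve} (hW : MeasurableFamily W)
    {x y : T → ℚ → Curve} (hx : Measurable x) (hy : Measurable y) :
    MeasurableFamily (fun t => W t \ RandomSoup.linkTo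
      (RandomSoup.grow (RandomSoup.pts (y t)) (W t) (RandomSoup.pts (x t)))) := by
  simp only [← iInter_unseen]
  exact MeasurableFamily.iInter fun k => (MeasurableFamily.spread_unseen k hW hx hy).2

/-- If `V t` consists of curves of an enumeration, avoiding a Borel set is a measurable event. -/
theorem MeasurableFamily.measurableSet_void {V : T → Set Curve} (hV : MeasurableFamily V)
    {x : T → ℚ → Curve} (hx : Measurable x) (hVx : ∀ t, V t ⊆ RandomSoup.pts (x t))
    {A : Set Curve} (hA : MeasurableSet A) : MeasurableSet {t | Void (V t) A} := by
  have h := measurableSet_void_pts_inter hV hx hA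
  simp only [fun t => Set.inter_eq_right.2 (hVx t)] at h
  exact h

theorem measurableSet_void_pts {W : T → Set Curve} (hW : MeasurableFamily W) {x : T → ℚ → Curve}
    (hx : Measurable x) : MeasurableSet {t | Void (pts (x t)) (W t)} := by
  have := measurableSet_void_pts_inter hW hx MeasurableSet.univ
  simpa only [void_inter_left, Set.inter_univ] using this

end Measurability

/-! ### The Markov property of the exploration of a cluster -/

section CompletelyRandom

variable {q : Measure (ℚ → Curve)}

theorem lintegral_void_pts {A : Set Curve} (hA : MeasurableSet A) :
    ∫⁻ x, ind (Void (pts x) A) ∂q = q {x | Void (pts x) A} :=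
  lintegral_ind (measurableSet_void_pts (.const hA) measurable_id)

/-- The curves found in `k` generations, completed in the unseen region by an independent copy, have
the void probabilities of the original set in `W`. The first generation lives in `linkTo F` and the
later ones read only the complement, so the soup outside `linkTo F` can be resampled before the
induction hypothesis is applied to the first generation. -/
theorem IsCompletelyRandom.lintegral_spread (hq : IsCompletelyRandom q) (k : ℕ) {A W : Set Curve}
    (hA : MeasurableSet A) (hW : MeasurableSet W) (y : ℚ → Curve) :
    ∫⁻ x, ∫⁻ z, ind (Void (spread k (pts y) W (pts x)) A ∧
        Void (pts z) (A ∩ unseen k (pts y) W (pts x))) ∂q ∂q = q {x | Void (pts x) (A ∩ W)} := by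
  have := hq.prob
  induction k generalizing W y with
  | zero =>
    simp only [spread, unseen, lintegral_const, measure_univ, mul_one]
    rw [← lintegral_void_pts (hA.inter hW)]
    exact lintegral_congr fun z => ind_congr ⟨fun h => h.2, fun h => ⟨by simp [Void], h⟩⟩
  | succ k ih =>
    set L := linkTo (pts y) with hL
    have hLm : MeasurableSet L :=
      (MeasurableFamily.linkTo (T := Unit) (x := fun _ => y) measurable_const).apply ()
    set G : Set Curve → Set Curve → (ℚ → Curve) → Prop := fun F R z =>
      Void (spread k F (W \ L) R) A ∧ Void (pts z) (A ∩ unseen k F (W \ L) R) with hG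
    have hGm : MeasurableSet {p : ((ℚ → Curve) × (ℚ → Curve)) × (ℚ → Curve) |
        G (pts p.1.1 ∩ W) (pts p.1.2) p.2} := by
      have hx : Measurable fun p : ((ℚ → Curve) × (ℚ → Curve)) × (ℚ → Curve) => p.1.2 := by
        fun_prop
      have h := MeasurableFamily.spread_unseen k (.const (hW.diff hLm)) hx
        (measurable_restrictSeq (.const hW) (measurable_fst.comp measurable_fst))
      simp only [pts_restrictSeq, Function.comp_apply] at h
      refine MeasurableSet.inter (h.1.measurableSet_void hx
        (fun t => (spread_subset _ _ _ _).trans Set.inter_subset_left) hA) ?_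
      exact measurableSet_void_pts ((MeasurableFamily.const hA).inter h.2) measurable_snd
    have hVm : MeasurableSet {p : (ℚ → Curve) × (ℚ → Curve) | Void (pts p.1 ∩ W) A} :=
      measurableSet_void_pts_inter (.const hW) measurable_fst hA
    have hsplit := hq.lintegral_split hLm
      (fun S R => ind (Void (S ∩ W) A) * ∫⁻ z, ind (G (S ∩ W) R z) ∂q)
      ((measurable_ind hVm).mul (measurable_ind hGm).lintegral_prod_right')
    have e1 : ∀ x : ℚ → Curve, pts x ∩ L ∩ W = pts x ∩ (L ∩ W) := fun x => Set.inter_assoc _ _ _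
    -- Restricting the second argument to `Lᶜ` changes nothing, which brings the split formula into
    -- the form needed below.
    have e2 : ∀ F S z, G F (S ∩ Lᶜ) z ↔ G F S z := fun F S z => by
      have : W \ L ⊆ Lᶜ := fun ξ hξ => hξ.2
      simp only [hG, spread_inter k this, unseen_inter k this]
    simp only [e1, ind_congr (e2 _ _ _)] at hsplit
    calc ∫⁻ x, ∫⁻ z, ind (Void (spread (k + 1) (pts y) W (pts x)) A ∧
          Void (pts z) (A ∩ unseen (k + 1) (pts y) W (pts x))) ∂q ∂q
        = ∫⁻ x, ind (Void (pts x ∩ (L ∩ W)) A) *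
            ∫⁻ z, ind (G (pts x ∩ (L ∩ W)) (pts x) z) ∂q ∂q := by
          refine lintegral_congr fun x => ?_
          rw [← lintegral_const_mul' _ _ (ne_top_of_le_ne_top ENNReal.one_ne_top (ind_le_one _))]
          refine lintegral_congr fun z => ?_
          rw [← ind_and]
          refine ind_congr ?_
          simp only [hG, spread, unseen, void_union_left, and_assoc, ← hL]
      _ = ∫⁻ x, ∫⁻ x', ind (Void (pts x ∩ (L ∩ W)) A) *
            ∫⁻ z, ind (G (pts x ∩ (L ∩ W)) (pts x') z) ∂q ∂q ∂q := hsplit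
      _ = ∫⁻ x, ind (Void (pts x ∩ (L ∩ W)) A) * q {x | Void (pts x) (A ∩ (W \ L))} ∂q := by
          refine lintegral_congr fun x => ?_
          rw [lintegral_const_mul' _ _ (ne_top_of_le_ne_top ENNReal.one_ne_top (ind_le_one _)),
            ← ih (hW.diff hLm) (restrictSeq x (L ∩ W)), pts_restrictSeq]
      _ = q {x | Void (pts x) (A ∩ W)} := by
          simp only [void_inter_left (S := pts _)]
          rw [lintegral_mul_const' _ _ (measure_ne_top _ _),
            lintegral_void_pts ((hLm.inter hW).inter hA)]
          -- The first generation and the remainder occupy the disjoint regions `L ∩ W` and `W \ L`,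
          -- so their void probabilities recombine.
          have h := hq.void_mul (L ∩ W ∩ A) (A ∩ (W \ L)) ((hLm.inter hW).inter hA)
            (hA.inter (hW.diff hLm)) (Set.disjoint_left.2 fun ξ hξ hξ' => hξ'.2.2 hξ.1.1)
          have e3 : L ∩ W ∩ A ∪ A ∩ (W \ L) = A ∩ W := by
            ext ξ
            simp only [Set.mem_union, Set.mem_inter_iff, Set.mem_sdiff]
            tauto
          rw [e3] at h
          exact h.symm

theorem void_iUnion_iff {V : ℕ → Set Curve} (hV : Monotone V) (A : Set Curve) :
    ∀ᶠ n in Filter.atTop, (Void (V n) A ↔ Void (⋃ k, V k) A) := by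
  by_cases h : Void (⋃ k, V k) A
  · exact Filter.Eventually.of_forall fun n =>
      iff_of_true (h.mono (Set.subset_iUnion V n) subset_rfl) h
  · have h' := h
    simp only [Void, not_forall, not_not, Set.mem_iUnion] at h'
    obtain ⟨ξ, ⟨k, hk⟩, hξ⟩ := h'
    filter_upwards [Filter.eventually_ge_atTop k] with n hn
    exact iff_of_false (fun hv => hv ξ (hV hn hk) hξ) h

/-- For decreasing regions, void events pass to the limit only because finitely many curves of `S`
are concerned; this is why `A` is kept away from diameter zero. -/
theorem Good.void_iInter_iff {S : Set Curve} (hS : Good S) {V : ℕ → Set Curve} (hV : Antitone V)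
    {A : Set Curve} {r : ℝ} (hr : 0 < r) (hA : A ⊆ above r) :
    ∀ᶠ n in Filter.atTop, (Void S (A ∩ V n) ↔ Void S (A ∩ ⋂ k, V k)) := by
  by_cases h : Void S (A ∩ ⋂ k, V k)
  · have hev : ∀ ξ ∈ S ∩ above r, ∀ᶠ n in Filter.atTop, ξ ∉ A ∩ V n := by
      intro ξ hξ
      by_cases hξA : ξ ∈ A
      · have : ξ ∉ ⋂ k, V k := fun h' => h ξ hξ.1 ⟨hξA, h'⟩
        simp only [Set.mem_iInter, not_forall] at this
        obtain ⟨k, hk⟩ := this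
        filter_upwards [Filter.eventually_ge_atTop k] with n hn
        exact fun h' => hk (hV hn h'.2)
      · exact Filter.Eventually.of_forall fun n h' => hξA h'.1
    filter_upwards [(Filter.eventually_all_finite (hS.finite r hr)).2 hev] with n hn
    exact iff_of_true (fun ξ hξ hξ' => hn ξ ⟨hξ, hA hξ'.1⟩ hξ') h
  · exact Filter.Eventually.of_forall fun n => iff_of_false
      (fun hv => h (hv.mono subset_rfl (Set.inter_subset_inter_right _ (Set.iInter_subset V n)))) h

/-- The cluster of a curve inside a completely random set, together with a resampling of the curves
that are not linked to it, is distributed as the initial set. -/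
theorem IsCompletelyRandom.lintegral_grow (hq : IsCompletelyRandom q) {A W : Set Curve}
    (hA : MeasurableSet A) (hW : MeasurableSet W) {r : ℝ} (hr : 0 < r) (hAr : A ⊆ above r)
    (y : ℚ → Curve) :
    ∫⁻ x, ∫⁻ z, ind (Void (grow (pts y) W (pts x)) A ∧
        Void (pts z) (A ∩ (W \ linkTo (grow (pts y) W (pts x))))) ∂q ∂q =
      ind (Void (pts y) A) * q {x | Void (pts x) (A ∩ W)} := by
  have := hq.prob
  have hm : ∀ k, Measurable fun p : (ℚ → Curve) × (ℚ → Curve) =>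
      ind (Void (spread k (pts y) W (pts p.1)) A ∧
        Void (pts p.2) (A ∩ unseen k (pts y) W (pts p.1))) := by
    intro k
    have h := MeasurableFamily.spread_unseen (T := (ℚ → Curve) × (ℚ → Curve)) k (.const hW)
      measurable_fst (measurable_const (a := y))
    exact measurable_ind (MeasurableSet.inter (h.1.measurableSet_void measurable_fst
        (fun t => (spread_subset _ _ _ _).trans Set.inter_subset_left) hA)
      (measurableSet_void_pts ((MeasurableFamily.const hA).inter h.2) measurable_snd))
  have hlim : ∀ x z : ℚ → Curve, Good (pts z) → Filter.Tendsto
      (fun k => ind (Void (spread k (pts y) W (pts x)) A ∧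
        Void (pts z) (A ∩ unseen k (pts y) W (pts x)))) Filter.atTop
      (nhds (ind (Void (⋃ k, spread k (pts y) W (pts x)) A ∧
        Void (pts z) (A ∩ (W \ linkTo (grow (pts y) W (pts x))))))) := by
    intro x z hz
    rw [← iInter_unseen]
    refine tendsto_ind ?_
    filter_upwards [void_iUnion_iff (spread_mono (pts y) W (pts x)) A,
      hz.void_iInter_iff (unseen_antitone (pts y) W (pts x)) hr hAr] with n h1 h2
    exact and_congr h1 h2
  have t2 := tendsto_lintegral_of_dominated_convergence (μ := q) (fun _ => 1)
    (fun n => (hm n).lintegral_prod_right')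
    (fun n => Filter.Eventually.of_forall fun x =>
      (lintegral_mono fun y => ind_le_one _).trans (by simp)) (by simp)
    (Filter.Eventually.of_forall fun x =>
      tendsto_lintegral_of_dominated_convergence (μ := q) (fun _ => 1)
        (fun n => (hm n).comp (measurable_prodMk_left (x := x)))
        (fun n => Filter.Eventually.of_forall fun y => ind_le_one _) (by simp)
        (hq.good.mono fun z hz => hlim x z hz))
  have e := tendsto_nhds_unique t2
    (tendsto_const_nhds.congr fun n => (hq.lintegral_spread n hA hW y).symm)
  rw [← e, ← lintegral_const_mul' _ _
    (ne_top_of_le_ne_top ENNReal.one_ne_top (ind_le_one _))]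
  refine lintegral_congr fun x => ?_
  rw [← lintegral_const_mul' _ _ (ne_top_of_le_ne_top ENNReal.one_ne_top (ind_le_one _))]
  refine lintegral_congr fun z => ?_
  rw [← ind_and]
  refine ind_congr ?_
  conv_lhs => rw [show grow (pts y) W (pts x) = pts y ∪ ⋃ k, spread k (pts y) W (pts x) from rfl,
    void_union_left]
  exact and_assoc

end CompletelyRandom

/-! ### The sequential exploration of clusters -/

/-- The law of the sequence `a, b₀, b₁, …` for independent `a` and `b` is the product law. -/
theorem map_cons_infinitePi {X : Type*} [MeasurableSpace X] (q : Measure X)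
    [IsProbabilityMeasure q] :
    (q.prod (Measure.infinitePi fun _ : ℕ => q)).map
      (fun p i => Nat.casesOn (motive := fun _ => X) i p.1 p.2) =
      Measure.infinitePi fun _ : ℕ => q := by
  have hm : Measurable fun (p : X × (ℕ → X)) (i : ℕ) =>
      Nat.casesOn (motive := fun _ => X) i p.1 p.2 := by
    refine measurable_pi_lambda _ fun i => ?_
    cases i with
    | zero => exact measurable_fst
    | succ i => exact (measurable_pi_apply i).comp measurable_snd
  refine Measure.eq_infinitePi _ fun s t ht => ?_
  classical
  set u : ℕ → Set X := fun i => if i ∈ s then t i else Set.univ with hu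
  have hum : ∀ i, MeasurableSet (u i) := by
    intro i
    by_cases h : i ∈ s <;> simp [hu, h, ht]
  obtain ⟨N, hN⟩ : ∃ N, s ⊆ Finset.range (N + 1) :=
    ⟨s.sup id, fun i hi => Finset.mem_range_succ_iff.2 (Finset.le_sup (f := id) hi)⟩
  have e1 : (s : Set ℕ).pi t = (Finset.range (N + 1) : Set ℕ).pi u := by
    ext x
    simp only [Set.mem_pi, Finset.mem_coe]
    constructor
    · intro h i _
      by_cases hi : i ∈ s
      · simpa [hu, hi] using h i hi
      · simp [hu, hi]
    · intro h i hi
      simpa [hu, hi] using h i (hN hi)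
  have e2 : ∏ i ∈ s, q (t i) = ∏ i ∈ Finset.range (N + 1), q (u i) := by
    rw [← Finset.prod_subset hN (f := fun i => q (u i))]
    · exact Finset.prod_congr rfl fun i hi => by simp [hu, hi]
    · intro i _ hi
      simp [hu, hi]
  rw [e1, e2, Measure.map_apply hm (MeasurableSet.pi (Finset.countable_toSet _) fun i _ => hum i)]
  have e3 : (fun (p : X × (ℕ → X)) (i : ℕ) => Nat.casesOn (motive := fun _ => X) i p.1 p.2) ⁻¹'
      (Finset.range (N + 1) : Set ℕ).pi u =
      u 0 ×ˢ (Finset.range N : Set ℕ).pi (fun i => u (i + 1)) := by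
    ext p
    simp only [Set.mem_preimage, Set.mem_pi, Finset.mem_coe, Finset.mem_range, Set.mem_prod]
    constructor
    · exact fun h => ⟨h 0 (Nat.succ_pos _), fun i hi => h (i + 1) (by omega)⟩
    · rintro ⟨h0, h⟩ i hi
      cases i with
      | zero => exact h0
      | succ i => exact h i (by omega)
  rw [e3, Measure.prod_prod, Measure.infinitePi_pi _ fun i _ => hum _, Finset.prod_range_succ',
    mul_comm]

theorem lintegral_infinitePi_succ {X : Type*} [MeasurableSpace X] (q : Measure X)
    [IsProbabilityMeasure q] (g : X → (ℕ → X) → ℝ≥0∞)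
    (hg : Measurable fun p : X × (ℕ → X) => g p.1 p.2) :
    ∫⁻ x, g (x 0) (fun i => x (i + 1)) ∂(Measure.infinitePi fun _ : ℕ => q) =
      ∫⁻ a, ∫⁻ b, g a b ∂(Measure.infinitePi fun _ : ℕ => q) ∂q := by
  have hm : Measurable fun (p : X × (ℕ → X)) (i : ℕ) =>
      Nat.casesOn (motive := fun _ => X) i p.1 p.2 := by
    refine measurable_pi_lambda _ fun i => ?_
    cases i with
    | zero => exact measurable_fst
    | succ i => exact (measurable_pi_apply i).comp measurable_snd
  have h0 : Measurable fun x : ℕ → X => (x 0, fun i => x (i + 1)) :=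
    (measurable_pi_apply 0).prodMk (measurable_pi_lambda _ fun i => measurable_pi_apply (i + 1))
  have hs : Measurable fun x : ℕ → X => g (x 0) (fun i => x (i + 1)) := hg.comp h0
  have e := congrArg (fun m => ∫⁻ x, g (x 0) (fun i => x (i + 1)) ∂m) (map_cons_infinitePi q)
  exact e.symm.trans ((lintegral_map hs hm).trans (lintegral_prod _ (hs.comp hm).aemeasurable))

/-- The cluster of `γ`, together with the curves of `S` in `W` of smaller diameter. -/
def clusterAt (γ : Curve) (W S : Set Curve) : Set Curve :=
  grow (pts fun _ => γ) (W ∩ below (diam γ)) S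

/-- The curves in `W` of smaller diameter than `γ` that avoid its cluster. -/
def restAt (γ : Curve) (W S : Set Curve) : Set Curve :=
  (W ∩ below (diam γ)) \ linkTo (clusterAt γ W S)

section Exploration

variable (W S₀ : Set Curve) (S : ℕ → Set Curve)

/-- The curves that are still available after `n` steps of the exploration. -/
def left : ℕ → Set Curve
  | 0 => W
  | n + 1 => restAt (top (S₀ ∩ left n)) (left n) (S n)

/-- The curves of the cluster number `n`. -/
def stepCluster (n : ℕ) : Set Curve := clusterAt (top (S₀ ∩ left W S₀ S n)) (left W S₀ S n) (S n)

/-- The curves of the first `n` clusters. -/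
def seen : ℕ → Set Curve
  | 0 => ∅
  | n + 1 => seen n ∪ stepCluster W S₀ S n

/-- After one step the exploration is an exploration of the same kind, in a smaller region and with
the same `S₀`. This form permits induction on the number of steps for arbitrary `W`. -/
theorem left_succ' (n : ℕ) : left W S₀ S (n + 1) =
    left (restAt (top (S₀ ∩ W)) W (S 0)) S₀ (fun i => S (i + 1)) n := by
  induction n with
  | zero => rfl
  | succ n ih => rw [left, ih]; rfl

theorem stepCluster_succ' (n : ℕ) : stepCluster W S₀ S (n + 1) =
    stepCluster (restAt (top (S₀ ∩ W)) W (S 0)) S₀ (fun i => S (i + 1)) n := by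
  rw [stepCluster, left_succ']; rfl

theorem seen_succ' (n : ℕ) : seen W S₀ S (n + 1) = clusterAt (top (S₀ ∩ W)) W (S 0) ∪
    seen (restAt (top (S₀ ∩ W)) W (S 0)) S₀ (fun i => S (i + 1)) n := by
  induction n with
  | zero => simp [seen, stepCluster, left]
  | succ n ih => rw [seen, ih, stepCluster_succ', Set.union_assoc]; rfl

theorem restAt_subset (γ : Curve) (R : Set Curve) : restAt γ W R ⊆ W ∩ below (diam γ) :=
  Set.sdiff_subset

theorem left_antitone : Antitone (left W S₀ S) :=
  antitone_nat_of_succ_le fun _ => (restAt_subset _ _ _).trans Set.inter_subset_left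

-- Curves of `S₀` outside the region are never candidates. After the first step, `S₀` may thus be
-- replaced by its part in `W` below the first largest curve, which can be resampled.
variable {W} in
theorem left_inter {V : Set Curve} (h : W ⊆ V) (n : ℕ) :
    left W (S₀ ∩ V) S n = left W S₀ S n := by
  induction n with
  | zero => rfl
  | succ n ih =>
    have e : S₀ ∩ V ∩ left W S₀ S n = S₀ ∩ left W S₀ S n := by
      rw [Set.inter_assoc, Set.inter_eq_right.2 ((left_antitone W S₀ S (Nat.zero_le n)).trans h)]
    rw [left, left, ih, e]

variable {W} in
theorem stepCluster_inter {V : Set Curve} (h : W ⊆ V) (n : ℕ) :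
    stepCluster W (S₀ ∩ V) S n = stepCluster W S₀ S n := by
  have e : S₀ ∩ V ∩ left W S₀ S n = S₀ ∩ left W S₀ S n := by
    rw [Set.inter_assoc, Set.inter_eq_right.2 ((left_antitone W S₀ S (Nat.zero_le n)).trans h)]
  rw [stepCluster, stepCluster, left_inter S₀ S h, e]

variable {W} in
theorem seen_inter {V : Set Curve} (h : W ⊆ V) (n : ℕ) :
    seen W (S₀ ∩ V) S n = seen W S₀ S n := by
  induction n with
  | zero => rfl
  | succ n ih => rw [seen, seen, ih, stepCluster_inter S₀ S h]

end Exploration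

section Measurability

variable {T : Type*} [MeasurableSpace T]

theorem MeasurableFamily.clusterAt {γ : T → Curve} (hγ : Measurable γ) {W : T → Set Curve}
    (hW : MeasurableFamily W) {x : T → ℚ → Curve} (hx : Measurable x) :
    MeasurableFamily fun t => clusterAt (γ t) (W t) (RandomSoup.pts (x t)) :=
  MeasurableFamily.grow (hW.inter (.below (measurable_diam.comp hγ))) hx
    (measurable_pi_lambda _ fun _ => hγ)

theorem MeasurableFamily.restAt {γ : T → Curve} (hγ : Measurable γ) {W : T → Set Curve}
    (hW : MeasurableFamily W) {x : T → ℚ → Curve} (hx : Measurable x) :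
    MeasurableFamily fun t => restAt (γ t) (W t) (RandomSoup.pts (x t)) :=
  MeasurableFamily.diff_linkTo_grow (hW.inter (.below (measurable_diam.comp hγ))) hx
    (measurable_pi_lambda _ fun _ => hγ)

variable {W : T → Set Curve} {x₀ : T → ℚ → Curve} {x : T → ℕ → ℚ → Curve}

theorem MeasurableFamily.left (hW : MeasurableFamily W) (hx₀ : Measurable x₀) (hx : Measurable x)
    (n : ℕ) :
    MeasurableFamily fun t => left (W t) (RandomSoup.pts (x₀ t)) (fun k => RandomSoup.pts (x t k))
      n := by
  induction n with
  | zero => exact hW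
  | succ n ih =>
    exact MeasurableFamily.restAt (measurable_top_pts_inter ih hx₀) ih
      ((measurable_pi_apply n).comp hx)

theorem MeasurableFamily.stepCluster (hW : MeasurableFamily W) (hx₀ : Measurable x₀)
    (hx : Measurable x) (n : ℕ) :
    MeasurableFamily fun t => stepCluster (W t) (RandomSoup.pts (x₀ t))
      (fun k => RandomSoup.pts (x t k)) n :=
  MeasurableFamily.clusterAt
    (measurable_top_pts_inter (MeasurableFamily.left hW hx₀ hx n) hx₀)
    (MeasurableFamily.left hW hx₀ hx n) ((measurable_pi_apply n).comp hx)

theorem MeasurableFamily.seen (hW : MeasurableFamily W) (hx₀ : Measurable x₀)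
    (hx : Measurable x) (n : ℕ) :
    MeasurableFamily fun t => seen (W t) (RandomSoup.pts (x₀ t))
      (fun k => RandomSoup.pts (x t k)) n := by
  induction n with
  | zero => exact MeasurableSet.empty
  | succ n ih => exact ih.union (MeasurableFamily.stepCluster hW hx₀ hx n)

theorem measurableSet_void_of_subset_union {V : T → Set Curve} (hV : MeasurableFamily V)
    {y : T → ℕ → ℚ → Curve} (hy : Measurable y) (hVy : ∀ t, V t ⊆ ⋃ k, pts (y t k))
    {A : Set Curve} (hA : MeasurableSet A) : MeasurableSet {t | Void (V t) A} := by
  have : {t | Void (V t) A} = ⋂ k, {t | Void (pts (y t k) ∩ V t) A} := by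
    ext t
    simp only [Set.mem_ofPred_eq, Set.mem_iInter]
    constructor
    · exact fun h k => h.mono Set.inter_subset_right subset_rfl
    · intro h ξ hξ
      obtain ⟨k, hk⟩ := Set.mem_iUnion.1 (hVy t hξ)
      exact h k ξ ⟨hk, hξ⟩
  rw [this]
  exact MeasurableSet.iInter fun k =>
    measurableSet_void_pts_inter hV ((measurable_pi_apply k).comp hy) hA

theorem pts_const_top_subset (S : Set Curve) : (pts fun _ => top S) ⊆ S := by
  rintro ξ ⟨h0, i, rfl⟩
  exact (isTop_top h0).isLargest.1

theorem stepCluster_subset (W S₀ : Set Curve) (S : ℕ → Set Curve) (n : ℕ) :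
    stepCluster W S₀ S n ⊆ S₀ ∪ S n :=
  (grow_subset _ _ _).trans (Set.union_subset_union
    ((pts_const_top_subset _).trans Set.inter_subset_left) Set.inter_subset_left)

theorem seen_subset (W S₀ : Set Curve) (S : ℕ → Set Curve) (n : ℕ) :
    seen W S₀ S n ⊆ S₀ ∪ ⋃ k, S k := by
  induction n with
  | zero => exact Set.empty_subset _
  | succ n ih =>
    exact Set.union_subset ih ((stepCluster_subset W S₀ S n).trans
      (Set.union_subset_union_right _ (Set.subset_iUnion S n)))

theorem measurableSet_void_seen (hW : MeasurableFamily W) (hx₀ : Measurable x₀)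
    (hx : Measurable x) (n : ℕ) {A : Set Curve} (hA : MeasurableSet A) :
    MeasurableSet {t | Void (seen (W t) (pts (x₀ t)) (fun k => pts (x t k)) n) A} := by
  refine measurableSet_void_of_subset_union (MeasurableFamily.seen hW hx₀ hx n)
    (y := fun t k => Nat.casesOn (motive := fun _ => ℚ → Curve) k (x₀ t) (x t)) ?_ (fun t => ?_) hA
  · refine measurable_pi_lambda _ fun k => ?_
    cases k with
    | zero => exact hx₀
    | succ k => exact (measurable_pi_apply k).comp hx
  · refine (seen_subset _ _ _ n).trans (Set.union_subset ?_ (Set.iUnion_subset fun k => ?_))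
    · exact Set.subset_iUnion_of_subset 0 subset_rfl
    · exact Set.subset_iUnion_of_subset (k + 1) subset_rfl

theorem measurableSet_void_clusterAt {γ : T → Curve} (hγ : Measurable γ)
    (hW : MeasurableFamily W) (hx₀ : Measurable x₀) {A : Set Curve} (hA : MeasurableSet A) :
    MeasurableSet {t | Void (clusterAt (γ t) (W t) (pts (x₀ t))) A} := by
  refine measurableSet_void_of_subset_union (MeasurableFamily.clusterAt hγ hW hx₀)
    (y := fun t k => Nat.casesOn (motive := fun _ => ℚ → Curve) k (fun _ => γ t) fun _ => x₀ t)
    ?_ (fun t => ?_) hA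
  · refine measurable_pi_lambda _ fun k => ?_
    cases k with
    | zero => exact measurable_pi_lambda _ fun _ => hγ
    | succ k => exact hx₀
  · refine (grow_subset _ _ _).trans (Set.union_subset ?_ ?_)
    · exact Set.subset_iUnion_of_subset 0 subset_rfl
    · exact Set.inter_subset_left.trans (Set.subset_iUnion_of_subset 1 subset_rfl)

end Measurability

/-- Distinct diameters leave only the largest curve and strictly smaller ones. If `S` is empty, the
dummy curve contributes nothing. -/
theorem Good.eq_top_union {S : Set Curve} (hS : Good S) :
    S = (pts fun _ => top S) ∪ S ∩ below (diam (top S)) := by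
  refine Set.Subset.antisymm (fun ξ hξ => ?_)
    (Set.union_subset (pts_const_top_subset S) Set.inter_subset_left)
  obtain ⟨γ, hγ⟩ := hS.exists_isTop ⟨ξ, hξ⟩
  rw [top_eq_of_isTop hγ, pts_const hγ.diam_pos]
  rcases eq_or_ne ξ γ with rfl | hne
  · exact Or.inl rfl
  · exact Or.inr ⟨hξ, hγ.isLargest.2 ξ hξ hne⟩

/-! ### The Markov property of the sequential construction -/

section CompletelyRandom

variable {q : Measure (ℚ → Curve)}

/-- The first cluster of the exploration, together with a resampling of the curves that are still
available, is distributed as the initial set. -/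
theorem IsCompletelyRandom.lintegral_first_step (hq : IsCompletelyRandom q) {A W : Set Curve}
    (hA : MeasurableSet A) (hW : MeasurableSet W) {r : ℝ} (hr : 0 < r) (hAr : A ⊆ above r) :
    ∫⁻ x₀, ∫⁻ a, ind (Void (clusterAt (top (pts x₀ ∩ W)) W (pts a)) A) *
        q {z | Void (pts z) (A ∩ restAt (top (pts x₀ ∩ W)) W (pts a))} ∂q ∂q =
      q {x | Void (pts x) (A ∩ W)} := by
  have := hq.prob
  -- For a fixed starting curve, `lintegral_grow` recombines its cluster and the remaining region
  -- into the starting curve and a fresh set of smaller curves.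
  have h1 : ∀ γ : Curve, ∫⁻ a, ind (Void (clusterAt γ W (pts a)) A) *
        q {z | Void (pts z) (A ∩ restAt γ W (pts a))} ∂q =
      ∫⁻ y, ind (Void (pts fun _ => γ) A ∧ Void (pts y ∩ W ∩ below (diam γ)) A) ∂q := by
    intro γ
    have hWγ := hW.inter (measurableSet_below (diam γ))
    have h := hq.lintegral_grow hA hWγ hr hAr (fun _ => γ)
    have hrest : ∀ a, MeasurableSet (A ∩ restAt γ W (pts a)) := fun a =>
      hA.inter ((MeasurableFamily.restAt (T := Unit) measurable_const (.const hW)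
        (measurable_const (a := a))).apply ())
    simp only [ind_and, Set.inter_assoc, void_inter_left]
    rw [lintegral_const_mul' _ _ (ne_top_of_le_ne_top ENNReal.one_ne_top (ind_le_one _)),
      ← Set.inter_assoc W, lintegral_void_pts (hWγ.inter hA), Set.inter_comm (W ∩ _) A, ← h]
    refine lintegral_congr fun a => ?_
    rw [← lintegral_void_pts (hrest a), ← lintegral_const_mul' _ _
      (ne_top_of_le_ne_top ENNReal.one_ne_top (ind_le_one _))]
    simp only [ind_and]
    rfl
  simp only [h1]
  -- Read backwards, the resampling identity turns the largest curve and fresh smaller curves into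
  -- the original set.
  rw [← hq.lintegral_top hW (fun γ R => ind (Void (pts fun _ => γ) A ∧ Void R A)),
    ← lintegral_void_pts (hA.inter hW)]
  · refine lintegral_congr_ae ?_
    filter_upwards [hq.good] with x hx
    refine ind_congr ?_
    rw [← void_union_left, ← (hx.mono Set.inter_subset_left).eq_top_union, void_inter_left,
      Set.inter_comm]
  · refine measurable_ind (MeasurableSet.inter ?_ ?_)
    · exact measurableSet_void_pts (.const hA) (measurable_pi_lambda _ fun _ => measurable_fst)
    · exact measurableSet_void_pts (.const hA) measurable_snd

/-- The clusters found in the first `n` steps of the exploration, together with a resampling of the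
curves that are still available, are distributed as the initial set. -/
theorem IsCompletelyRandom.lintegral_seen (hq : IsCompletelyRandom q) {A W : Set Curve}
    (hA : MeasurableSet A) (hW : MeasurableSet W) {r : ℝ} (hr : 0 < r) (hAr : A ⊆ above r)
    (n : ℕ) :
    ∫⁻ x₀, ∫⁻ x, ∫⁻ z, ind (Void (seen W (pts x₀) (fun k => pts (x k)) n) A ∧
        Void (pts z) (A ∩ left W (pts x₀) (fun k => pts (x k)) n)) ∂q
        ∂(Measure.infinitePi fun _ : ℕ => q) ∂q =
      q {x | Void (pts x) (A ∩ W)} := by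
  have := hq.prob
  induction n generalizing W with
  | zero =>
    simp only [seen, left, lintegral_const, measure_univ, mul_one]
    rw [← lintegral_void_pts (hA.inter hW)]
    exact lintegral_congr fun z => ind_congr ⟨fun h => h.2, fun h => ⟨by simp [Void], h⟩⟩
  | succ n ih =>
    obtain ⟨g, hg⟩ : ∃ g : Curve → Set Curve → (ℚ → Curve) → (ℕ → ℚ → Curve) → (ℚ → Curve) → ℝ≥0∞,
      g = fun γ R a b z => ind (Void (seen (restAt γ W (pts a)) R (fun k => pts (b k)) n) A ∧
        Void (pts z) (A ∩ left (restAt γ W (pts a)) R (fun k => pts (b k)) n)) := ⟨_, rfl⟩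
    obtain ⟨c, hc⟩ : ∃ c : Curve → (ℚ → Curve) → ℝ≥0∞,
      c = fun γ a => ind (Void (clusterAt γ W (pts a)) A) := ⟨_, rfl⟩
    have hc_top : ∀ γ a, c γ a ≠ ∞ := fun γ a =>
      ne_top_of_le_ne_top ENNReal.one_ne_top (hc ▸ ind_le_one _)
    have hcm : Measurable fun p : Curve × (ℚ → Curve) => c p.1 p.2 := by
      rw [hc]
      exact measurable_ind (measurableSet_void_clusterAt measurable_fst (.const hW) measurable_snd hA)
    have hgm : Measurable fun p : (((Curve × (ℚ → Curve)) × (ℚ → Curve)) × (ℕ → ℚ → Curve)) ×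
        (ℚ → Curve) => g p.1.1.1.1 (pts p.1.1.1.2) p.1.1.2 p.1.2 p.2 := by
      have hrest : MeasurableFamily fun p : (((Curve × (ℚ → Curve)) × (ℚ → Curve)) ×
          (ℕ → ℚ → Curve)) × (ℚ → Curve) => restAt p.1.1.1.1 W (pts p.1.1.2) :=
        MeasurableFamily.restAt (by fun_prop) (.const hW) (by fun_prop)
      rw [hg]
      refine measurable_ind (MeasurableSet.inter ?_ ?_)
      · exact measurableSet_void_seen hrest (by fun_prop) (by fun_prop) n hA
      · exact measurableSet_void_pts ((MeasurableFamily.const hA).inter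
          (MeasurableFamily.left hrest (by fun_prop) (by fun_prop) n)) measurable_snd
    have hHm : Measurable fun p : ((Curve × (ℚ → Curve)) × (ℚ → Curve)) × (ℕ → ℚ → Curve) =>
        ∫⁻ z, g p.1.1.1 (pts p.1.1.2) p.1.2 p.2 z ∂q := hgm.lintegral_prod_right'
    obtain ⟨G, hG⟩ : ∃ G : Curve → Set Curve → (ℚ → Curve) → ℝ≥0∞, G = fun γ R a =>
      ∫⁻ b, ∫⁻ z, g γ R a b z ∂q ∂(Measure.infinitePi fun _ : ℕ => q) := ⟨_, rfl⟩
    have hGm : Measurable fun p : (Curve × (ℚ → Curve)) × (ℚ → Curve) =>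
        G p.1.1 (pts p.1.2) p.2 := by
      rw [hG]
      exact hHm.lintegral_prod_right'
    -- The steps after the first look only at those curves of the candidate set that lie in `W` and
    -- are smaller than the first curve.
    have hloc : ∀ γ R a, G γ (R ∩ W ∩ below (diam γ)) a = G γ R a := by
      intro γ R a
      have h : restAt γ W (pts a) ⊆ W ∩ below (diam γ) := restAt_subset W γ _
      simp only [hG, hg, Set.inter_assoc, seen_inter _ _ h, left_inter _ _ h]
    calc ∫⁻ x₀, ∫⁻ x, ∫⁻ z, ind (Void (seen W (pts x₀) (fun k => pts (x k)) (n + 1)) A ∧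
          Void (pts z) (A ∩ left W (pts x₀) (fun k => pts (x k)) (n + 1))) ∂q
          ∂(Measure.infinitePi fun _ : ℕ => q) ∂q
        = ∫⁻ x₀, ∫⁻ a, c (top (pts x₀ ∩ W)) a * G (top (pts x₀ ∩ W)) (pts x₀) a ∂q ∂q := by
          refine lintegral_congr fun x₀ => ?_
          set γ := top (pts x₀ ∩ W) with hγ
          have h := lintegral_infinitePi_succ q
            (fun a b => c γ a * ∫⁻ z, g γ (pts x₀) a b z ∂q) ?_
          · refine Eq.trans (lintegral_congr fun x => ?_) (h.trans (lintegral_congr fun a => ?_))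
            · rw [← lintegral_const_mul' _ _ (hc_top _ _)]
              refine lintegral_congr fun z => ?_
              rw [hc, hg, ← ind_and]
              refine ind_congr ?_
              rw [seen_succ', left_succ', void_union_left, and_assoc]
            · rw [lintegral_const_mul' _ _ (hc_top _ _), hG]
          · have e1 : Measurable fun p : (ℚ → Curve) × (ℕ → ℚ → Curve) => (γ, p.1) := by fun_prop
            have e2 : Measurable fun p : (ℚ → Curve) × (ℕ → ℚ → Curve) =>
              (((γ, x₀), p.1), p.2) := by fun_prop
            exact (hcm.comp e1).mul (hHm.comp e2)
      -- The smaller candidates are resampled as `y`, independent of the first curve and of the set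
      -- `a` that builds its cluster.
      _ = ∫⁻ x₀, ∫⁻ y, ∫⁻ a, c (top (pts x₀ ∩ W)) a * G (top (pts x₀ ∩ W)) (pts y) a ∂q ∂q ∂q := by
          have h := hq.lintegral_top hW (fun γ R => ∫⁻ a, c γ a * G γ R a ∂q) ?_
          · simpa only [hloc] using h
          · have e1 : Measurable fun p : (Curve × (ℚ → Curve)) × (ℚ → Curve) => (p.1.1, p.2) := by
              fun_prop
            exact ((hcm.comp e1).mul hGm).lintegral_prod_right'
      _ = ∫⁻ x₀, ∫⁻ a, c (top (pts x₀ ∩ W)) a *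
            q {z | Void (pts z) (A ∩ restAt (top (pts x₀ ∩ W)) W (pts a))} ∂q ∂q := by
          refine lintegral_congr fun x₀ => ?_
          set γ := top (pts x₀ ∩ W) with hγ
          -- With `a` integrated last, the remaining region is fixed while `y` and the later soups
          -- are integrated, so the induction hypothesis applies to that region.
          rw [lintegral_lintegral_swap]
          · refine lintegral_congr fun a => ?_
            rw [lintegral_const_mul' _ _ (hc_top _ _)]
            refine congrArg _ ?_
            rw [hG, hg]
            refine ih ?_
            exact (MeasurableFamily.restAt (T := Unit) measurable_const (.const hW)
              (measurable_const (a := a))).apply ()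
          · have e1 : Measurable fun p : (ℚ → Curve) × (ℚ → Curve) => (γ, p.2) := by fun_prop
            have e2 : Measurable fun p : (ℚ → Curve) × (ℚ → Curve) => ((γ, p.1), p.2) := by
              fun_prop
            exact ((hcm.comp e1).mul (hGm.comp e2)).aemeasurable
      _ = q {x | Void (pts x) (A ∩ W)} := by
          rw [hc]
          exact hq.lintegral_first_step hA hW hr hAr

end CompletelyRandom

/-! ### The explored clusters are the clusters of a soup -/

section Deterministic

variable {W S₀ : Set Curve} {S : ℕ → Set Curve}

theorem avoidsLinks_union {ξ : Curve} {E F : Set Curve} :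
    AvoidsLinks ξ (E ∪ F) ↔ AvoidsLinks ξ E ∧ AvoidsLinks ξ F := by
  simp only [← notMem_linkTo_iff, linkTo_union, Set.mem_union, not_or]

theorem AvoidsLinks.mono {ξ : Curve} {E F : Set Curve} (h : AvoidsLinks ξ F) (hE : E ⊆ F) :
    AvoidsLinks ξ E := fun η hη => h η (hE hη)

theorem mem_left_iff {ξ : Curve} {n : ℕ} : ξ ∈ left W S₀ S n ↔ ξ ∈ W ∧
    AvoidsLinks ξ (seen W S₀ S n) ∧ ∀ m < n, diam ξ < diam (top (S₀ ∩ left W S₀ S m)) := by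
  induction n with
  | zero => simp [left, seen, AvoidsLinks]
  | succ n ih =>
    have h : ξ ∈ left W S₀ S (n + 1) ↔ (ξ ∈ left W S₀ S n ∧
        diam ξ < diam (top (S₀ ∩ left W S₀ S n))) ∧ AvoidsLinks ξ (stepCluster W S₀ S n) := by
      rw [← notMem_linkTo_iff]; rfl
    rw [h, ih, seen, avoidsLinks_union, Nat.forall_lt_succ_right]
    tauto

theorem seen_mono : Monotone (seen W S₀ S) :=
  monotone_nat_of_le_succ fun _ => Set.subset_union_left

theorem stepCluster_subset_seen {m n : ℕ} (h : m < n) :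
    stepCluster W S₀ S m ⊆ seen W S₀ S n :=
  Set.subset_union_right.trans (seen_mono h)

theorem exists_mem_stepCluster_of_mem_seen {ξ : Curve} {n : ℕ} (h : ξ ∈ seen W S₀ S n) :
    ∃ m < n, ξ ∈ stepCluster W S₀ S m := by
  induction n with
  | zero => exact absurd h (Set.notMem_empty _)
  | succ n ih =>
    rcases h with h | h
    · obtain ⟨m, hm, h⟩ := ih h
      exact ⟨m, hm.trans n.lt_succ_self, h⟩
    · exact ⟨n, n.lt_succ_self, h⟩

theorem stepCluster_subset_left (n : ℕ) : stepCluster W S₀ S n ⊆ left W S₀ S n :=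
  (grow_subset _ _ _).trans (Set.union_subset
    ((pts_const_top_subset _).trans Set.inter_subset_right)
    (Set.inter_subset_right.trans Set.inter_subset_left))

theorem clusterAt_eq_empty {γ : Curve} (h : ¬ 0 < diam γ) (W R : Set Curve) :
    clusterAt γ W R = ∅ := by
  refine Set.eq_empty_of_subset_empty ((grow_subset _ _ _).trans (Set.union_subset ?_ ?_))
  · rw [pts_const_eq_empty h]
  · rintro ξ ⟨-, -, hξ⟩
    exact h ((diam_nonneg ξ).trans_lt hξ)

theorem clusterAt_eq_clusterCurves {γ : Curve} (h : 0 < diam γ) (W R : Set Curve) :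
    clusterAt γ W R = clusterCurves γ (R ∩ (W ∩ below (diam γ)) ∪ {γ}) := by
  rw [clusterCurves_eq_grow, clusterAt, pts_const h]

theorem mem_clusterAt_self {γ : Curve} (h : 0 < diam γ) (W R : Set Curve) :
    γ ∈ clusterAt γ W R := Or.inl (by rw [pts_const h]; rfl)

theorem left_eq_empty {m n : ℕ} (h : ¬ 0 < diam (top (S₀ ∩ left W S₀ S m))) (hmn : m < n) :
    left W S₀ S n = ∅ :=
  Set.eq_empty_of_forall_notMem fun ξ hξ =>
    h ((diam_nonneg ξ).trans_lt ((mem_left_iff.1 hξ).2.2 m hmn))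

theorem stepCluster_eq_empty {m n : ℕ} (h : ¬ 0 < diam (top (S₀ ∩ left W S₀ S m)))
    (hmn : m ≤ n) : stepCluster W S₀ S n = ∅ := by
  rcases hmn.eq_or_lt with rfl | hmn
  · exact clusterAt_eq_empty h _ _
  · exact Set.eq_empty_of_subset_empty
      ((stepCluster_subset_left n).trans_eq (left_eq_empty h hmn))

/-- The available curves become arbitrarily small. -/
theorem Good.exists_left_inter_above (hS : Good S₀) {r : ℝ} (hr : 0 < r) :
    ∃ N, ∀ n ≥ N, ∀ ξ ∈ left W S₀ S n, ξ ∉ above r := by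
  by_contra! hcon
  -- If large curves remained available, the successive largest curves would be infinitely many
  -- curves of `S₀` above `r`, with strictly decreasing diameters.
  have hbig : ∀ m, r < diam (top (S₀ ∩ left W S₀ S m)) := by
    intro m
    obtain ⟨n, hn, ξ, hξ, hξr⟩ := hcon (m + 1)
    exact lt_trans hξr ((mem_left_iff.1 hξ).2.2 m hn)
  have hmem : ∀ m, top (S₀ ∩ left W S₀ S m) ∈ S₀ ∩ left W S₀ S m := fun m =>
    (isTop_top (hr.trans (hbig m))).isLargest.1
  have hdec : StrictAnti fun m => diam (top (S₀ ∩ left W S₀ S m)) :=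
    fun m n hmn => (mem_left_iff.1 (hmem n).2).2.2 m hmn
  refine Set.infinite_of_injective_forall_mem (s := S₀ ∩ above r)
    (f := fun m => top (S₀ ∩ left W S₀ S m)) (fun m n h => ?_)
    (fun m => ⟨(hmem m).1, hbig m⟩) (hS.finite r hr)
  exact hdec.injective (congrArg diam h)

/-- The diameter bounds in `left` are automatic for curves of `S₀`: one that avoids all clusters
found so far was a candidate at each earlier step and was not chosen, so it is smaller than the
chosen curve. -/
theorem Good.setOf_avoidsLinks (hS : Good S₀) (n : ℕ) :
    {ξ ∈ S₀ | AvoidsLinks ξ (seen Set.univ S₀ S n)} = S₀ ∩ left Set.univ S₀ S n := by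
  ext ξ
  constructor
  · rintro ⟨hξ, hav⟩
    refine ⟨hξ, mem_left_iff.2 ⟨Set.mem_univ _, hav, fun m => ?_⟩⟩
    induction m using Nat.strong_induction_on with
    | _ m ih =>
      intro hmn
      have hm : ξ ∈ S₀ ∩ left Set.univ S₀ S m := ⟨hξ, mem_left_iff.2 ⟨Set.mem_univ _,
        hav.mono (seen_mono hmn.le), fun j hj => ih j hj (hj.trans hmn)⟩⟩
      obtain ⟨γ, hγ⟩ := (hS.mono Set.inter_subset_left).exists_isTop ⟨ξ, hm⟩
      have hγ' := top_eq_of_isTop hγ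
      rw [hγ']
      refine hγ.isLargest.2 ξ hm ?_
      refine (hav γ (stepCluster_subset_seen hmn ?_)).1
      rw [stepCluster, hγ']
      exact mem_clusterAt_self hγ.diam_pos _ _
  · rintro ⟨hξ, hl⟩
    exact ⟨hξ, (mem_left_iff.1 hl).2.1⟩

theorem Good.exploreNext_eq (hS : Good S₀) (n : ℕ) :
    exploreNext AvoidsLinks S₀ (S n) (seen Set.univ S₀ S n) = stepCluster Set.univ S₀ S n := by
  have hS' : Good (S₀ ∩ left Set.univ S₀ S n) := hS.mono Set.inter_subset_left
  rw [exploreNext, hS.setOf_avoidsLinks]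
  by_cases hγ : ∃ γ, IsTop (S₀ ∩ left Set.univ S₀ S n) γ
  · obtain ⟨γ, hγ⟩ := hγ
    -- The chosen curves decrease in diameter, so being smaller than the current one implies all the
    -- earlier bounds.
    have e : {ξ ∈ S n | diam ξ < diam γ ∧ AvoidsLinks ξ (seen Set.univ S₀ S n)} =
        S n ∩ (left Set.univ S₀ S n ∩ below (diam γ)) := by
      ext ξ
      constructor
      · rintro ⟨h1, h2, h3⟩
        refine ⟨h1, mem_left_iff.2 ⟨Set.mem_univ _, h3, fun m hm => ?_⟩, h2⟩
        exact h2.trans ((mem_left_iff.1 hγ.isLargest.1.2).2.2 m hm)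
      · rintro ⟨h1, h2, h3⟩
        exact ⟨h1, h3, (mem_left_iff.1 h2).2.1⟩
    rw [stepCluster, top_eq_of_isTop hγ, clusterAt_eq_clusterCurves hγ.diam_pos, ← e]
    ext η
    constructor
    · rintro ⟨γ', hγ', h⟩
      rwa [hγ'.unique hγ.isLargest] at h
    · exact fun h => ⟨γ, hγ.isLargest, h⟩
  · rw [stepCluster, top_eq_dummy hγ, clusterAt_eq_empty (by simp [diam_dummy])]
    refine Set.eq_empty_of_forall_notMem ?_
    rintro η ⟨γ, h, -⟩
    exact hγ ⟨γ, hS'.isTop h⟩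

theorem Good.exploreBefore_eq {S : ℕ → Set Curve} (hS : Good (S 0)) (n : ℕ) :
    exploreBefore AvoidsLinks S n = seen Set.univ (S 0) (fun k => S (k + 1)) n := by
  induction n with
  | zero => rfl
  | succ n ih => rw [exploreBefore, ih, seen, ← hS.exploreNext_eq]

theorem Good.exploreCluster_eq {S : ℕ → Set Curve} (hS : Good (S 0)) (n : ℕ) :
    exploreCluster AvoidsLinks S n =
      trace (stepCluster Set.univ (S 0) (fun k => S (k + 1)) n) := by
  rw [exploreCluster, hS.exploreBefore_eq, ← hS.exploreNext_eq]

/-- All the curves of the explored clusters. -/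
def allSeen (W S₀ : Set Curve) (S : ℕ → Set Curve) : Set Curve := ⋃ n, seen W S₀ S n

theorem mem_allSeen {ξ : Curve} : ξ ∈ allSeen W S₀ S ↔ ∃ n, ξ ∈ stepCluster W S₀ S n := by
  rw [allSeen, Set.mem_iUnion]
  constructor
  · rintro ⟨n, hn⟩
    obtain ⟨m, -, h⟩ := exists_mem_stepCluster_of_mem_seen hn
    exact ⟨m, h⟩
  · rintro ⟨n, hn⟩
    exact ⟨n + 1, Or.inr hn⟩

/-- Each cluster is drawn from a region that avoids the earlier ones, so clusters of different steps
are unlinked; everything found later is smaller than the current largest curve. Hence taking the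
union loses neither the clusters nor their order. -/
theorem soupNext_allSeen (n : ℕ) :
    soupNext (allSeen W S₀ S) (seen W S₀ S n) = stepCluster W S₀ S n := by
  by_cases h0 : 0 < diam (top (S₀ ∩ left W S₀ S n))
  · set γ := top (S₀ ∩ left W S₀ S n) with hγ
    have hγL : γ ∈ S₀ ∩ left W S₀ S n := (isTop_top h0).isLargest.1
    have hγC : γ ∈ stepCluster W S₀ S n := mem_clusterAt_self h0 _ _
    have hlate : ∀ m ≥ n, ∀ ξ ∈ stepCluster W S₀ S m, ξ ∉ seen W S₀ S n ∧
        (ξ ≠ γ → diam ξ < diam γ) := by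
      intro m hm ξ hξ
      have hL := (mem_left_iff.1 (left_antitone W S₀ S hm (stepCluster_subset_left m hξ))).2
      refine ⟨fun hs => (hL.1 ξ hs).1 rfl, fun hne => ?_⟩
      rcases hm.eq_or_lt with rfl | hm
      · rcases grow_subset _ _ _ hξ with h | h
        · rw [pts_const h0] at h
          exact absurd h hne
        · exact h.2.2
      · exact (mem_left_iff.1 (stepCluster_subset_left m hξ)).2.2 n hm
    have hlate' : ∀ ξ ∈ allSeen W S₀ S, ξ ∉ seen W S₀ S n →
        ∃ m ≥ n, ξ ∈ stepCluster W S₀ S m := by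
      intro ξ hξ hns
      obtain ⟨m, hm⟩ := mem_allSeen.1 hξ
      refine ⟨m, ?_, hm⟩
      by_contra! hlt
      exact hns (stepCluster_subset_seen hlt hm)
    have hlarge : IsLargest (allSeen W S₀ S \ seen W S₀ S n) γ := by
      refine ⟨⟨mem_allSeen.2 ⟨n, hγC⟩, (hlate n le_rfl γ hγC).1⟩, fun η hη hne => ?_⟩
      obtain ⟨m, hm, h⟩ := hlate' η hη.1 hη.2
      exact (hlate m hm η h).2 hne
    -- A chain in the union cannot pass from one step's cluster to another: whichever of two linked
    -- curves was found later would have to avoid the earlier one.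
    have hcl : clusterCurves γ (allSeen W S₀ S) = stepCluster W S₀ S n := by
      refine Set.Subset.antisymm ?_ ?_
      · rintro η ⟨-, h⟩
        induction h with
        | refl => exact hγC
        | @tail a b _ hab ih =>
          obtain ⟨-, hb, hl⟩ := hab
          obtain ⟨m, hm⟩ := mem_allSeen.1 hb
          rcases lt_trichotomy m n with hlt | rfl | hgt
          · have := (mem_left_iff.1 (stepCluster_subset_left n ih)).2.1 b
              (stepCluster_subset_seen hlt hm)
            exact absurd hl this.2
          · exact hm
          · have := (mem_left_iff.1 (stepCluster_subset_left m hm)).2.1 a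
              (stepCluster_subset_seen hgt ih)
            exact absurd hl.symm this.2
      · have hsub : stepCluster W S₀ S n ⊆ allSeen W S₀ S := fun ξ hξ => mem_allSeen.2 ⟨n, hξ⟩
        intro η hη
        refine ⟨hsub hη, ?_⟩
        rw [stepCluster, clusterAt_eq_clusterCurves h0] at hη
        have hγr : γ ∈ clusterCurves γ (S n ∩ (left W S₀ S n ∩ below (diam γ)) ∪ {γ}) :=
          ⟨Or.inr rfl, .refl⟩
        have key : ∀ η, Relation.ReflTransGen (fun a b =>
            a ∈ S n ∩ (left W S₀ S n ∩ below (diam γ)) ∪ {γ} ∧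
            b ∈ S n ∩ (left W S₀ S n ∩ below (diam γ)) ∪ {γ} ∧ Linked a b) γ η →
            η ∈ stepCluster W S₀ S n ∧ Relation.ReflTransGen (fun a b =>
              a ∈ allSeen W S₀ S ∧ b ∈ allSeen W S₀ S ∧ Linked a b) γ η := by
          intro η h
          induction h with
          | refl => exact ⟨hγC, .refl⟩
          | @tail a b hγa hab ih =>
            have hbC : b ∈ stepCluster W S₀ S n := by
              rw [stepCluster, clusterAt_eq_clusterCurves h0]
              exact ⟨hab.2.1, hγa.tail hab⟩
            exact ⟨hbC, ih.2.tail ⟨hsub ih.1, hsub hbC, hab.2.2⟩⟩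
        exact (key η hη.2).2
    rw [← hcl]
    ext η
    constructor
    · rintro ⟨γ', hγ', h⟩
      rwa [hγ'.unique hlarge] at h
    · exact fun h => ⟨γ, hlarge, h⟩
  · rw [stepCluster_eq_empty h0 le_rfl]
    refine Set.eq_empty_of_forall_notMem ?_
    rintro η ⟨γ, ⟨⟨hγ, hγn⟩, -⟩, -⟩
    obtain ⟨m, hm⟩ := mem_allSeen.1 hγ
    rcases lt_or_ge m n with h | h
    · exact hγn (stepCluster_subset_seen h hm)
    · rw [stepCluster_eq_empty h0 h] at hm
      exact hm

theorem soupBefore_allSeen (n : ℕ) : soupBefore (allSeen W S₀ S) n = seen W S₀ S n := by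
  induction n with
  | zero => rfl
  | succ n ih => rw [soupBefore, ih, soupNext_allSeen, seen]

theorem soupCluster_allSeen (n : ℕ) :
    soupCluster (allSeen W S₀ S) n = trace (stepCluster W S₀ S n) := by
  rw [soupCluster, soupBefore_allSeen, soupNext_allSeen]

/-- With the same set at every step, a curve that was never found would remain available forever,
although available curves become arbitrarily small. The clusters of a soup thus come from the same
construction, and so inherit its measurability. -/
theorem Good.allSeen_self (hS : Good S₀) : allSeen Set.univ S₀ (fun _ => S₀) = S₀ := by
  refine Set.Subset.antisymm (fun ξ hξ => ?_) fun ξ hξ => ?_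
  · obtain ⟨n, hn⟩ := mem_allSeen.1 hξ
    simpa using stepCluster_subset _ _ _ n hn
  · by_contra hns
    have hleft : ∀ n, ξ ∈ left Set.univ S₀ (fun _ => S₀) n := by
      intro n
      induction n with
      | zero => exact Set.mem_univ _
      | succ n ih =>
        obtain ⟨γ, hγ⟩ := (hS.mono Set.inter_subset_left).exists_isTop
          (S := S₀ ∩ left Set.univ S₀ (fun _ => S₀) n) ⟨ξ, hξ, ih⟩
        have hγ' := top_eq_of_isTop hγ
        have hnC : ξ ∉ stepCluster Set.univ S₀ (fun _ => S₀) n := fun h =>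
          hns (mem_allSeen.2 ⟨n, h⟩)
        have hne : ξ ≠ γ := by
          rintro rfl
          refine hnC ?_
          rw [stepCluster, hγ']
          exact mem_clusterAt_self hγ.diam_pos _ _
        have hlt : diam ξ < diam γ := hγ.isLargest.2 ξ ⟨hξ, ih⟩ hne
        refine ⟨⟨ih, show diam ξ < _ by rwa [hγ']⟩, ?_⟩
        rintro ⟨η, hη, rfl | hl⟩
        · exact hnC hη
        · exact hnC (mem_grow_of_linked hη ⟨hξ, ih, show diam ξ < _ by rwa [hγ']⟩ hl)
    obtain ⟨N, hN⟩ := hS.exists_left_inter_above (W := Set.univ) (S := fun _ => S₀)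
      (half_pos (hS.pos ξ hξ))
    exact hN N le_rfl ξ (hleft N) (half_lt_self (hS.pos ξ hξ))

theorem Good.soupCluster_eq (hS : Good S₀) (n : ℕ) :
    soupCluster S₀ n = trace (stepCluster Set.univ S₀ (fun _ => S₀) n) := by
  rw [← soupCluster_allSeen, hS.allSeen_self]

end Deterministic

/-! ### The law of the set of all explored curves -/

theorem tendsto_void_above {S : Set Curve} (hS : ∀ γ ∈ S, 0 < diam γ) (A : Set Curve) :
    ∀ᶠ k : ℕ in Filter.atTop, (Void S (A ∩ above (1 / ((k : ℝ) + 1))) ↔ Void S A) := by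
  have hmono : Monotone fun k : ℕ => S ∩ above (1 / ((k : ℝ) + 1)) := fun k l hkl =>
    Set.inter_subset_inter_right _ fun γ (hγ : _ < diam γ) =>
      (Nat.one_div_le_one_div hkl).trans_lt hγ
  have hunion : ⋃ k : ℕ, S ∩ above (1 / ((k : ℝ) + 1)) = S := by
    refine Set.Subset.antisymm (Set.iUnion_subset fun _ => Set.inter_subset_left) fun γ hγ => ?_
    obtain ⟨k, hk⟩ := exists_nat_one_div_lt (hS γ hγ)
    exact Set.mem_iUnion.2 ⟨k, hγ, hk⟩
  have h := void_iUnion_iff hmono A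
  rw [hunion] at h
  filter_upwards [h] with k hk
  rw [← hk, void_inter_left, Set.inter_comm]

theorem measurable_allSeen {T : Type*} [MeasurableSpace T] {x₀ : T → ℚ → Curve}
    {x : T → ℕ → ℚ → Curve} (hx₀ : Measurable x₀) (hx : Measurable x) :
    Measurable fun t => CurveSet.mk (allSeen Set.univ (pts (x₀ t)) fun k => pts (x t k)) := by
  refine measurable_curveSet_iff.2 fun A hA => ?_
  have : {t | Void (allSeen Set.univ (pts (x₀ t)) fun k => pts (x t k)) A} =
      ⋂ n, {t | Void (seen Set.univ (pts (x₀ t)) (fun k => pts (x t k)) n) A} := by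
    ext t
    simp only [allSeen, Void, Set.mem_iUnion, Set.mem_ofPred_eq, Set.mem_iInter]
    exact ⟨fun h n ξ hξ => h ξ ⟨n, hξ⟩, fun h ξ ⟨n, hξ⟩ => h n ξ hξ⟩
  simp only
  rw [this]
  exact MeasurableSet.iInter fun n =>
    measurableSet_void_seen (.const MeasurableSet.univ) hx₀ hx n hA

section CompletelyRandom

variable {q : Measure (ℚ → Curve)}

/-- In the limit of `lintegral_seen` the resampled part disappears, since eventually no available
curve has diameter above `r`. -/
theorem IsCompletelyRandom.lintegral_allSeen (hq : IsCompletelyRandom q) {A : Set Curve}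
    (hA : MeasurableSet A) {r : ℝ} (hr : 0 < r) (hAr : A ⊆ above r) :
    ∫⁻ p, ind (Void (allSeen Set.univ (pts p.1) fun k => pts (p.2 k)) A)
      ∂(q.prod (Measure.infinitePi fun _ : ℕ => q)) = ∫⁻ x, ind (Void (pts x) A) ∂q := by
  have := hq.prob
  set m := Measure.infinitePi fun _ : ℕ => q with hm
  have hF : ∀ n, Measurable fun p : ((ℚ → Curve) × (ℕ → ℚ → Curve)) × (ℚ → Curve) =>
      ind (Void (seen Set.univ (pts p.1.1) (fun k => pts (p.1.2 k)) n) A ∧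
        Void (pts p.2) (A ∩ left Set.univ (pts p.1.1) (fun k => pts (p.1.2 k)) n)) := by
    intro n
    have hU : MeasurableFamily fun _ : ((ℚ → Curve) × (ℕ → ℚ → Curve)) × (ℚ → Curve) =>
        (Set.univ : Set Curve) := .const MeasurableSet.univ
    exact measurable_ind (MeasurableSet.inter
      (measurableSet_void_seen hU (by fun_prop) (by fun_prop) n hA)
      (measurableSet_void_pts ((MeasurableFamily.const hA).inter
        (MeasurableFamily.left hU (by fun_prop) (by fun_prop) n)) measurable_snd))
  have hgood : ∀ᵐ p ∂(q.prod m), Good (pts p.1) :=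
    Measure.quasiMeasurePreserving_fst.ae hq.good
  have hlim : ∀ p : (ℚ → Curve) × (ℕ → ℚ → Curve), Good (pts p.1) → ∀ z : ℚ → Curve,
      Filter.Tendsto (fun n => ind (Void (seen Set.univ (pts p.1) (fun k => pts (p.2 k)) n) A ∧
        Void (pts z) (A ∩ left Set.univ (pts p.1) (fun k => pts (p.2 k)) n))) Filter.atTop
        (nhds (ind (Void (allSeen Set.univ (pts p.1) fun k => pts (p.2 k)) A))) := by
    intro p hp z
    obtain ⟨N, hN⟩ := hp.exists_left_inter_above (W := Set.univ) (S := fun k => pts (p.2 k)) hr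
    refine tendsto_ind ?_
    filter_upwards [void_iUnion_iff (seen_mono (W := Set.univ) (S₀ := pts p.1)
      (S := fun k => pts (p.2 k))) A, Filter.eventually_ge_atTop N] with n h1 h2
    rw [h1]
    exact ⟨fun h => h.1, fun h => ⟨h, fun ξ _ hξ => hN n h2 ξ hξ.2 (hAr hξ.1)⟩⟩
  have t := tendsto_lintegral_of_dominated_convergence (μ := q.prod m) (fun _ => 1)
    (fun n => (hF n).lintegral_prod_right' (ν := q))
    (fun n => Filter.Eventually.of_forall fun x =>
      (lintegral_mono fun y => ind_le_one _).trans (by simp)) (by simp)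
    (hgood.mono fun p hp =>
      tendsto_lintegral_of_dominated_convergence (μ := q) (fun _ => 1)
        (fun n => (hF n).comp (measurable_prodMk_left (x := p)))
        (fun n => Filter.Eventually.of_forall fun y => ind_le_one _) (by simp)
        (Filter.Eventually.of_forall fun z => hlim p hp z))
  have e : ∀ n, ∫⁻ p, ∫⁻ z, ind (Void (seen Set.univ (pts p.1) (fun k => pts (p.2 k)) n) A ∧
        Void (pts z) (A ∩ left Set.univ (pts p.1) (fun k => pts (p.2 k)) n)) ∂q ∂(q.prod m) =
        ∫⁻ x, ind (Void (pts x) A) ∂q := by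
    intro n
    rw [lintegral_void_pts hA, lintegral_prod _ ((hF n).lintegral_prod_right').aemeasurable]
    have h := hq.lintegral_seen hA MeasurableSet.univ hr hAr n
    rw [Set.inter_univ] at h
    exact h
  have h := tendsto_nhds_unique t (tendsto_const_nhds.congr fun n => (e n).symm)
  simpa only [lintegral_const, measure_univ, mul_one] using h

/-- The set of all curves of the explored clusters has the law of the initial set. -/
theorem IsCompletelyRandom.map_allSeen (hq : IsCompletelyRandom q) :
    (q.prod (Measure.infinitePi fun _ : ℕ => q)).map
      (fun p => CurveSet.mk (allSeen Set.univ (pts p.1) fun k => pts (p.2 k))) =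
      q.map fun x => CurveSet.mk (pts x) := by
  have := hq.prob
  have hm1 := measurable_allSeen (T := (ℚ → Curve) × (ℕ → ℚ → Curve)) measurable_fst measurable_snd
  have := Measure.isProbabilityMeasure_map (μ := q.prod (Measure.infinitePi fun _ : ℕ => q))
    hm1.aemeasurable
  have := Measure.isProbabilityMeasure_map (μ := q) measurable_pts.aemeasurable
  refine CurveSet.ext_measure fun A hA => ?_
  rw [Measure.map_apply hm1 (measurableSet_void hA),
    Measure.map_apply measurable_pts (measurableSet_void hA)]
  refine (lintegral_ind (hm1 (measurableSet_void hA))).symm.trans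
    (Eq.trans ?_ (lintegral_ind (measurable_pts (measurableSet_void hA))))
  -- Cutting off diameters at most `1 / (k + 1)` reduces a general Borel set to sets bounded away
  -- from diameter zero.
  have hAk : ∀ k : ℕ, MeasurableSet (A ∩ above (1 / ((k : ℝ) + 1))) := fun k =>
    hA.inter (measurableSet_above _)
  have t1 := tendsto_lintegral_of_dominated_convergence
    (μ := q.prod (Measure.infinitePi fun _ : ℕ => q)) (fun _ => 1)
    (fun k => measurable_ind (hm1 (measurableSet_void (hAk k))))
    (fun k => Filter.Eventually.of_forall fun p => ind_le_one _) (by simp)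
    (Filter.Eventually.of_forall fun p => tendsto_ind (tendsto_void_above (fun γ hγ => by
      obtain ⟨n, hn⟩ := mem_allSeen.1 hγ
      rcases stepCluster_subset _ _ _ n hn with h | h
      · exact h.1
      · exact h.1) A))
  have t2 := tendsto_lintegral_of_dominated_convergence (μ := q) (fun _ => 1)
    (fun k => measurable_ind (measurable_pts (measurableSet_void (hAk k))))
    (fun k => Filter.Eventually.of_forall fun p => ind_le_one _) (by simp)
    (Filter.Eventually.of_forall fun x => tendsto_ind (tendsto_void_above (fun γ hγ => hγ.1) A))
  refine tendsto_nhds_unique t1 (t2.congr fun k => ?_)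
  exact (hq.lintegral_allSeen (hAk k) (r := 1 / ((k : ℝ) + 1)) (by positivity)
    Set.inter_subset_right).symm

end CompletelyRandom

/-! ### The sequence of clusters as a measurable function of the enumeration -/

/-- The union hits `F` exactly when the set of curves is not void on the closed set of curves
hitting `F`. -/
theorem measurable_planeSet_trace {T : Type*} [MeasurableSpace T] {V : T → Set Curve}
    (h : ∀ A, MeasurableSet A → MeasurableSet {t | Void (V t) A}) :
    Measurable fun t => PlaneSet.mk (trace (V t)) := by
  refine measurable_generateFrom ?_
  rintro _ ⟨F, hF, rfl⟩
  convert (h _ (measurableSet_hits hF.isClosed)).compl using 1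
  ext t
  simp only [trace, Void, Set.mem_preimage, Set.mem_ofPred_eq, Set.mem_compl_iff, not_forall,
    not_not]
  constructor
  · rintro ⟨z, hz, hzF⟩
    obtain ⟨γ, hγ, hzγ⟩ := Set.mem_iUnion₂.1 hz
    exact ⟨γ, hγ, z, hzγ, hzF⟩
  · rintro ⟨γ, hγ, z, hzγ, hzF⟩
    exact ⟨z, Set.mem_iUnion₂.2 ⟨γ, hγ, hzγ⟩, hzF⟩

/-- The traces of the clusters of the set that is enumerated by `x`. -/
def clusterSeq (x : ℚ → Curve) (n : ℕ) : PlaneSet :=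
  ⟨trace (stepCluster Set.univ (pts x) (fun _ => pts x) n)⟩

theorem measurable_clusterSeq : Measurable clusterSeq := by
  refine measurable_pi_lambda _ fun n => measurable_planeSet_trace fun A hA => ?_
  have hx : Measurable fun (x : ℚ → Curve) (_ : ℕ) => x :=
    measurable_pi_lambda _ fun _ => measurable_id
  refine (MeasurableFamily.stepCluster (.const MeasurableSet.univ) measurable_id
    hx n).measurableSet_void measurable_id (fun x => ?_) hA
  simpa using stepCluster_subset Set.univ (pts x) (fun _ => pts x) n

theorem Good.clusterSeq_enum {S : Set Curve} (hS : Good S) (n : ℕ) :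
    clusterSeq (enum S) n = ⟨soupCluster S n⟩ := by
  rw [clusterSeq, pts_enum hS, hS.soupCluster_eq]

/-! ### The intensity of a soup -/

/-- The square with centre `z` and side `2 s`. -/
def square (z : ℂ) (s : ℝ) : Set ℂ := {w | |w.re - z.re| ≤ s ∧ |w.im - z.im| ≤ s}

theorem isClosed_square (z : ℂ) (s : ℝ) : IsClosed (square z s) :=
  (isClosed_le (f := fun w : ℂ => |w.re - z.re|) (g := fun _ => s) (by fun_prop)
    continuous_const).inter
    (isClosed_le (f := fun w : ℂ => |w.im - z.im|) (g := fun _ => s) (by fun_prop)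
      continuous_const)

theorem square_zero_one : square 0 1 = Set.Icc (-1 : ℝ) 1 ×ℂ Set.Icc (-1 : ℝ) 1 := by
  ext w
  simp [square, Complex.mem_reProdIm, abs_le]

theorem coe_translate (z : ℂ) (γ : Curve) :
    (translate z γ : Set ℂ) = (fun w => z + w) '' (γ : Set ℂ) := rfl

theorem coe_dilate (ρ : ℝ) (γ : Curve) :
    (dilate ρ γ : Set ℂ) = (fun w => (ρ : ℂ) * w) '' (γ : Set ℂ) := rfl

theorem diam_translate (z : ℂ) (γ : Curve) : diam (translate z γ) = diam γ := by
  rw [diam, coe_translate]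
  exact (isometry_add_left z).diam_image _

theorem diam_dilate {ρ : ℝ} (hρ : 0 < ρ) (γ : Curve) : diam (dilate ρ γ) = ρ * diam γ := by
  have h := diam_smul₀ (ρ : ℂ) (γ : Set ℂ)
  rw [Complex.norm_real, Real.norm_eq_abs, abs_of_pos hρ] at h
  rw [diam, coe_dilate]
  exact h

theorem measurable_translate (z : ℂ) : Measurable (translate z) :=
  (Continuous.nonemptyCompacts_map _).measurable

theorem measurable_dilate (ρ : ℝ) : Measurable (dilate ρ) :=
  (Continuous.nonemptyCompacts_map _).measurable

/-- A bounded curve of diameter `d` is contained in a square of side `d`. -/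
theorem exists_square (γ : Curve) : ∃ z : ℂ, (γ : Set ℂ) ⊆ square z (diam γ / 2) := by
  obtain ⟨a, ha, ha'⟩ := γ.isCompact.exists_isMinOn γ.nonempty Complex.continuous_re.continuousOn
  obtain ⟨b, hb, hb'⟩ := γ.isCompact.exists_isMaxOn γ.nonempty Complex.continuous_re.continuousOn
  obtain ⟨c, hc, hc'⟩ := γ.isCompact.exists_isMinOn γ.nonempty Complex.continuous_im.continuousOn
  obtain ⟨d, hd, hd'⟩ := γ.isCompact.exists_isMaxOn γ.nonempty Complex.continuous_im.continuousOn
  have h1 : b.re - a.re ≤ diam γ := by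
    have h := Metric.dist_le_diam_of_mem (isBounded_curve γ) hb ha
    rw [dist_eq_norm] at h
    exact (le_abs_self _).trans ((Complex.abs_re_le_norm (b - a)).trans h)
  have h2 : d.im - c.im ≤ diam γ := by
    have h := Metric.dist_le_diam_of_mem (isBounded_curve γ) hd hc
    rw [dist_eq_norm] at h
    exact (le_abs_self _).trans ((Complex.abs_im_le_norm (d - c)).trans h)
  refine ⟨⟨(a.re + b.re) / 2, (c.im + d.im) / 2⟩, fun w hw => ?_⟩
  have e1 : a.re ≤ w.re := ha' hw
  have e2 : w.re ≤ b.re := hb' hw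
  have e3 : c.im ≤ w.im := hc' hw
  have e4 : w.im ≤ d.im := hd' hw
  constructor <;> rw [abs_le] <;> constructor <;> simp only <;> linarith

section Intensity

variable {μ : Measure Curve}

/-- Translation by `-z` followed by dilation by `1 / s` carries this set to the one in the local
finiteness hypothesis. -/
theorem IsInvariantCurveMeasure.measure_square_lt_top (hμ : IsInvariantCurveMeasure μ) (z : ℂ)
    {s : ℝ} (hs : 0 < s) : μ {γ | s < diam γ ∧ (γ : Set ℂ) ⊆ square z s} < ∞ := by
  have hB : MeasurableSet {γ : Curve | 1 < diam γ ∧ (γ : Set ℂ) ⊆ square 0 1} :=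
    (measurableSet_above 1).inter (measurableSet_subset_closed (isClosed_square 0 1))
  have h0 : μ {γ | 1 < diam γ ∧ (γ : Set ℂ) ⊆ square 0 1} < ∞ := by
    rw [square_zero_one]
    exact hμ.locally_finite
  refine lt_of_le_of_lt (le_of_eq ?_) h0
  conv_rhs => rw [← hμ.scale_invariant s⁻¹ (inv_pos.2 hs),
    Measure.map_apply (measurable_dilate _) hB, ← hμ.translation_invariant (-z),
    Measure.map_apply (measurable_translate _) (measurable_dilate _ hB)]
  congr 1
  ext γ
  simp only [Set.mem_ofPred_eq, Set.mem_preimage, diam_dilate (inv_pos.2 hs), diam_translate,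
    coe_dilate, coe_translate, Set.image_subset_iff]
  refine and_congr ?_ (forall₂_congr fun w hw => ?_)
  · rw [inv_mul_eq_div, lt_div_iff₀ hs, one_mul]
  · have hw' : ((s⁻¹ : ℝ) : ℂ) * (-z + w) = (w - z) / (s : ℂ) := by
      rw [Complex.ofReal_inv, div_eq_inv_mul, neg_add_eq_sub]
    simp only [square, Set.mem_preimage, Set.mem_ofPred_eq, hw', Complex.div_ofReal_re,
      Complex.div_ofReal_im, Complex.zero_re, Complex.zero_im, sub_zero, Complex.sub_re,
      Complex.sub_im, abs_div, abs_of_pos hs, div_le_one hs]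

theorem IsInvariantCurveMeasure.measure_above_lt_top (hμ : IsInvariantCurveMeasure μ) {r R : ℝ}
    (hr : 0 < r) : μ {γ | r < diam γ ∧ (γ : Set ℂ) ⊆ Metric.closedBall 0 R} < ∞ := by
  -- Round the centre of an enclosing square to the mesh `h`, and choose `k` with `h * k < diam γ ≤
  -- h * k + h`. Since `diam γ > 8 * h`, the half-side `h * k` is at least `diam γ / 2 + h`, which
  -- absorbs the rounding. Finitely many such squares suffice.
  set h := r / 8 with hh
  have hh0 : 0 < h := by positivity
  obtain ⟨N, hN⟩ := exists_nat_ge ((2 * |R| + r) / h + 1)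
  have hN' : 2 * |R| + r ≤ (N - 1) * h := by
    rw [← div_le_iff₀ hh0]; linarith
  set I : Set (ℤ × ℤ × ℤ) := Set.Icc (-N : ℤ) N ×ˢ Set.Icc (-N : ℤ) N ×ˢ Set.Icc (1 : ℤ) N with hI
  refine lt_of_le_of_lt (measure_mono (t := ⋃ p ∈ I, {γ : Curve | h * p.2.2 < diam γ ∧
      (γ : Set ℂ) ⊆ square ⟨h * p.1, h * p.2.1⟩ (h * p.2.2)}) ?_)
    (measure_biUnion_lt_top ((Set.finite_Icc _ _).prod ((Set.finite_Icc _ _).prod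
      (Set.finite_Icc _ _))) fun p hp => hμ.measure_square_lt_top _ ?_)
  · rintro γ ⟨hγr, hγR⟩
    obtain ⟨z, hz⟩ := exists_square γ
    have hd : diam γ ≤ 2 * |R| := by
      refine Metric.diam_le_of_forall_dist_le (by positivity) fun x hx y hy => ?_
      have h1 := hγR hx
      have h2 := hγR hy
      rw [Metric.mem_closedBall] at h1 h2
      have h3 := dist_triangle_right x y 0
      linarith [le_abs_self R]
    obtain ⟨w, hw⟩ := γ.nonempty
    have hwz := hz hw
    have hwR := hγR hw
    rw [mem_closedBall_zero_iff] at hwR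
    have hwre := (Complex.abs_re_le_norm w).trans (hwR.trans (le_abs_self R))
    have hwim := (Complex.abs_im_le_norm w).trans (hwR.trans (le_abs_self R))
    have hwz1 := hwz.1
    have hwz2 := hwz.2
    rw [abs_le] at hwre hwim hwz1 hwz2
    set i := ⌊z.re / h⌋
    set j := ⌊z.im / h⌋
    set k := ⌈diam γ / h⌉ - 1 with hk
    have hi1 : h * i ≤ z.re := by
      have := Int.floor_le (z.re / h)
      rw [le_div_iff₀ hh0] at this
      linarith
    have hi2 : z.re < h * i + h := by
      have := Int.lt_floor_add_one (z.re / h)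
      rw [div_lt_iff₀ hh0] at this
      linarith
    have hj1 : h * j ≤ z.im := by
      have := Int.floor_le (z.im / h)
      rw [le_div_iff₀ hh0] at this
      linarith
    have hj2 : z.im < h * j + h := by
      have := Int.lt_floor_add_one (z.im / h)
      rw [div_lt_iff₀ hh0] at this
      linarith
    have hk' : (k : ℝ) = ⌈diam γ / h⌉ - 1 := by rw [hk]; push_cast; ring
    have hk1 : h * k < diam γ := by
      have := Int.ceil_lt_add_one (diam γ / h)
      rw [← sub_lt_iff_lt_add, ← hk', lt_div_iff₀ hh0] at this
      linarith
    have hk2 : diam γ - h ≤ h * k := by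
      have := Int.le_ceil (diam γ / h)
      rw [div_le_iff₀ hh0] at this
      rw [hk']
      linarith
    have hr8 : r = 8 * h := by rw [hh]; ring
    have cast_le : ∀ a b : ℤ, h * a ≤ h * b → a ≤ b := fun a b hab => by
      exact_mod_cast le_of_mul_le_mul_left hab hh0
    have hNcast : ((N : ℤ) : ℝ) = N := by push_cast; rfl
    refine Set.mem_biUnion (x := (i, j, k)) ⟨⟨?_, ?_⟩, ⟨?_, ?_⟩, ?_, ?_⟩
      ⟨hk1, fun x hx => ⟨?_, ?_⟩⟩
    · apply cast_le; push_cast; nlinarith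
    · apply cast_le; push_cast; nlinarith
    · apply cast_le; push_cast; nlinarith
    · apply cast_le; push_cast; nlinarith
    · apply cast_le; push_cast; nlinarith
    · apply cast_le; push_cast; nlinarith
    · have := abs_le.1 (hz hx).1
      rw [abs_le]
      constructor <;> simp only <;> linarith
    · have := abs_le.1 (hz hx).2
      rw [abs_le]
      constructor <;> simp only <;> linarith
  · have : (1 : ℝ) ≤ p.2.2 := by exact_mod_cast hp.2.2.1
    positivity

/-- A finite measure has countably many atoms of the diameter, so some `u` in `(t / 2, t)` is not
one. Dilation by `u / t ≤ 1` preserves the ball and transfers nullity from `u` to `t`. -/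
theorem IsInvariantCurveMeasure.measure_diam_eq (hμ : IsInvariantCurveMeasure μ) {t R : ℝ}
    (ht : 0 < t) : μ {γ | diam γ = t ∧ (γ : Set ℂ) ⊆ Metric.closedBall 0 R} = 0 := by
  have hBm : MeasurableSet {γ : Curve | t / 2 < diam γ ∧ (γ : Set ℂ) ⊆ Metric.closedBall 0 R} :=
    (measurableSet_above _).inter (measurableSet_subset_closed Metric.isClosed_closedBall)
  have hum : ∀ u : ℝ, MeasurableSet {γ : Curve | diam γ = u} := fun u =>
    measurable_diam (MeasurableSet.singleton u)
  set m := μ.restrict {γ | t / 2 < diam γ ∧ (γ : Set ℂ) ⊆ Metric.closedBall 0 R} with hm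
  have : IsFiniteMeasure m :=
    isFiniteMeasure_restrict.2 (hμ.measure_above_lt_top (half_pos ht)).ne
  have hc := Measure.countable_meas_level_set_pos (μ := m) measurable_diam
  obtain ⟨u, hu, hu'⟩ := (hc.dense_compl ℝ).exists_mem_open isOpen_Ioo
    (Set.nonempty_Ioo.2 (half_lt_self ht))
  have hmu : m {γ | diam γ = u} = 0 := by simpa using hu
  rw [hm, Measure.restrict_apply (hum u)] at hmu
  have hρ : 0 < u / t := div_pos ((half_pos ht).trans hu'.1) ht
  have hρ1 : u / t ≤ 1 := (div_le_one ht).2 hu'.2.le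
  rw [← hμ.scale_invariant (u / t) hρ, Measure.map_apply (measurable_dilate _)
    ((hum u).inter hBm)] at hmu
  refine measure_mono_null ?_ hmu
  rintro γ ⟨h1, h2⟩
  have hd : diam (dilate (u / t) γ) = u := by
    rw [diam_dilate hρ, h1, div_mul_cancel₀ _ ht.ne']
  refine ⟨hd, ?_, ?_⟩
  · rw [hd]; exact hu'.1
  · rw [coe_dilate]
    rintro _ ⟨w, hw, rfl⟩
    have := h2 hw
    rw [mem_closedBall_zero_iff] at this ⊢
    rw [norm_mul, Complex.norm_real, Real.norm_eq_abs, abs_of_pos hρ]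
    exact (mul_le_of_le_one_left (norm_nonneg w) hρ1).trans this

theorem IsSimpleLoop.diam_pos {γ : Curve} (h : IsSimpleLoop γ) : 0 < diam γ := by
  obtain ⟨f, -, hinj, hr⟩ := h
  have h1 : f 1 ∈ (γ : Set ℂ) := hr ▸ ⟨1, rfl⟩
  have h2 : f (-1) ∈ (γ : Set ℂ) := hr ▸ ⟨-1, rfl⟩
  refine lt_of_lt_of_le (dist_pos.2 fun he => ?_)
    (Metric.dist_le_diam_of_mem (isBounded_curve γ) h1 h2)
  have := congrArg (fun z : Circle => (z : ℂ).re) (hinj he)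
  norm_num at this

/-- The properties of the intensity that are used in the study of soups. -/
structure IsDiffuse (ν : Measure Curve) : Prop where
  above_lt_top : ∀ r : ℝ, 0 < r → ν (above r) < ∞
  diam_eq : ∀ t : ℝ, ν {γ | diam γ = t} = 0

theorem IsInvariantCurveMeasure.isDiffuse (hμ : IsInvariantCurveMeasure μ)
    (hsimple : ∀ᵐ γ ∂μ, IsSimpleLoop γ) {D : Set ℂ} (hD : Bornology.IsBounded D) (c : ℝ≥0) :
    IsDiffuse (c • restrictTo μ D) := by
  obtain ⟨R, hR⟩ := hD.subset_closedBall 0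
  constructor
  · intro r hr
    rw [Measure.smul_apply, restrictTo, Measure.restrict_apply (measurableSet_above r)]
    refine ENNReal.mul_lt_top ENNReal.coe_lt_top (lt_of_le_of_lt (measure_mono ?_)
      (hμ.measure_above_lt_top (R := R) hr))
    exact fun γ hγ => ⟨hγ.1, hγ.2.trans hR⟩
  · intro t
    have htm : MeasurableSet {γ : Curve | diam γ = t} :=
      measurable_diam (MeasurableSet.singleton t)
    rw [Measure.smul_apply, restrictTo, Measure.restrict_apply htm]
    have : μ ({γ | diam γ = t} ∩ {γ | (γ : Set ℂ) ⊆ D}) = 0 := by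
      rcases lt_or_ge 0 t with ht | ht
      · refine measure_mono_null (fun γ hγ => ?_) (hμ.measure_diam_eq (R := R) ht)
        exact ⟨hγ.1, hγ.2.trans hR⟩
      · refine measure_mono_null (fun γ hγ => ?_) (ae_iff.1 hsimple)
        exact fun h => absurd h.diam_pos (not_lt.2 ((show diam γ = t from hγ.1).le.trans ht))
    exact (congrArg _ this).trans (smul_zero c)

end Intensity

/-! ### Soups as completely random sets of curves -/

theorem void_curves_iff (S : Config) (A : Set Curve) : Void S.curves A ↔ S.count A = 0 := by
  rw [Config.count, Set.encard_eq_zero, Set.eq_empty_iff_forall_notMem]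
  exact ⟨fun h ξ hξ => h ξ hξ.1 hξ.2, fun h ξ h1 h2 => h ξ ⟨h1, h2⟩⟩

theorem measurable_count {A : Set Curve} (hA : MeasurableSet A) : Measurable (Config.count A) :=
  Measurable.of_comap_le
    (le_iSup (fun A : {A : Set Curve // MeasurableSet A} =>
      MeasurableSpace.comap (Config.count A.1) ⊤) ⟨A, hA⟩)

theorem measurable_curves : Measurable fun S : Config => CurveSet.mk S.curves := by
  refine measurable_curveSet_iff.2 fun A hA => ?_
  simp only [void_curves_iff]
  exact measurable_count hA (MeasurableSet.singleton 0)

section Soup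

variable {Ω Ω' : Type*} [MeasurableSpace Ω] [MeasurableSpace Ω'] {P : Measure Ω} {P' : Measure Ω'}
  {Γ : Ω → Config} {Λ : Ω' → Config} {ν : Measure Curve}

theorem IsSoup.measurable_curves (h : IsSoup Γ ν P) :
    Measurable fun ω => CurveSet.mk (Γ ω).curves :=
  RandomSoup.measurable_curves.comp h.measurable

theorem IsSoup.measure_void (h : IsSoup Γ ν P) {A : Set Curve} (hA : MeasurableSet A)
    (hν : ν A ≠ ∞) :
    P {ω | Void (Γ ω).curves A} = ENNReal.ofReal (Real.exp (-(ν A).toNNReal)) := by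
  have hm : Measurable fun ω => (Γ ω).count A := (measurable_count hA).comp h.measurable
  have h1 : P {ω | Void (Γ ω).curves A} = P.map (fun ω => (Γ ω).count A) {0} := by
    rw [Measure.map_apply hm (MeasurableSet.singleton 0)]
    simp only [void_curves_iff]
    rfl
  have h2 : (fun k : ℕ => (k : ℕ∞)) ⁻¹' {0} = {0} := by
    ext k
    simp
  rw [h1, h.poisson A hA hν, Measure.map_apply measurable_from_top (MeasurableSet.singleton 0), h2,
    poissonMeasure_singleton]
  simp

theorem IsSoup.measure_void_of_eq_top (h : IsSoup Γ ν P) {A : Set Curve} (hA : MeasurableSet A)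
    (hν : ν A = ∞) : P {ω | Void (Γ ω).curves A} = 0 := by
  refine measure_mono_null (fun ω hω => ?_) (ae_iff.1 (h.infinite A hA hν))
  rw [Set.mem_ofPred_eq, (void_curves_iff _ _).1 hω]
  exact ENat.top_ne_zero.symm

theorem IsSoup.measure_void_eq (h : IsSoup Γ ν P) (h' : IsSoup Λ ν P') {A : Set Curve}
    (hA : MeasurableSet A) :
    P {ω | Void (Γ ω).curves A} = P' {ω | Void (Λ ω).curves A} := by
  by_cases hν : ν A = ∞
  · rw [h.measure_void_of_eq_top hA hν, h'.measure_void_of_eq_top hA hν]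
  · rw [h.measure_void hA hν, h'.measure_void hA hν]

theorem IsSoup.map_curves_eq [IsProbabilityMeasure P] [IsProbabilityMeasure P']
    (h : IsSoup Γ ν P) (h' : IsSoup Λ ν P') :
    P.map (fun ω => CurveSet.mk (Γ ω).curves) = P'.map fun ω => CurveSet.mk (Λ ω).curves := by
  have := Measure.isProbabilityMeasure_map (μ := P) h.measurable_curves.aemeasurable
  have := Measure.isProbabilityMeasure_map (μ := P') h'.measurable_curves.aemeasurable
  refine CurveSet.ext_measure fun A hA => ?_
  rw [Measure.map_apply h.measurable_curves (measurableSet_void hA),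
    Measure.map_apply h'.measurable_curves (measurableSet_void hA)]
  exact h.measure_void_eq h' hA

theorem IsSoup.measurableSet_void (h : IsSoup Γ ν P) {A : Set Curve} (hA : MeasurableSet A) :
    MeasurableSet {ω | Void (Γ ω).curves A} :=
  h.measurable_curves (RandomSoup.measurableSet_void hA)

theorem IsSoup.ae_void [IsProbabilityMeasure P] (h : IsSoup Γ ν P) {A : Set Curve}
    (hA : MeasurableSet A) (hν : ν A = 0) :
    ∀ᵐ ω ∂P, Void (Γ ω).curves A := by
  rw [ae_iff, ← Set.compl_ofPred, prob_compl_eq_zero_iff (h.measurableSet_void hA),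
    h.measure_void hA (by simp [hν])]
  simp [hν]

theorem IsSoup.ae_finite (h : IsSoup Γ ν P) {A : Set Curve} (hA : MeasurableSet A)
    (hν : ν A ≠ ∞) : ∀ᵐ ω ∂P, ((Γ ω).curves ∩ A).Finite := by
  have hm : Measurable fun ω => (Γ ω).count A := (measurable_count hA).comp h.measurable
  have h1 : P {ω | (Γ ω).count A = ⊤} = 0 := by
    have h2 : (fun k : ℕ => (k : ℕ∞)) ⁻¹' {⊤} = ∅ := by
      ext k
      simp
    rw [← measure_empty (μ := poissonMeasure (ν A).toNNReal), ← h2,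
      ← Measure.map_apply measurable_from_top (MeasurableSet.singleton ⊤), ← h.poisson A hA hν,
      Measure.map_apply hm (MeasurableSet.singleton ⊤)]
    rfl
  filter_upwards [measure_eq_zero_iff_ae_notMem.1 h1] with ω hω
  exact Set.encard_ne_top_iff.1 hω

theorem IsSoup.void_mul (h : IsSoup Γ ν P) {A B : Set Curve} (hA : MeasurableSet A)
    (hB : MeasurableSet B) (hAB : Disjoint A B) :
    P {ω | Void (Γ ω).curves (A ∪ B)} =
      P {ω | Void (Γ ω).curves A} * P {ω | Void (Γ ω).curves B} := by
  have hi := (h.independent 2 ![A, B] (fun i => by fin_cases i <;> assumption) (fun i j hij => by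
    fin_cases i <;> fin_cases j <;>
      first | exact absurd rfl hij | exact hAB | exact hAB.symm)).indepFun (i := 0) (j := 1) (by decide)
  have := hi.measure_inter_preimage_eq_mul {0} {0} (MeasurableSet.singleton 0)
    (MeasurableSet.singleton 0)
  simp only [void_union_right, void_curves_iff]
  exact this

theorem IsSoup.measurable_enum (h : IsSoup Γ ν P) : Measurable fun ω => enum (Γ ω).curves :=
  RandomSoup.measurable_enum.comp h.measurable_curves

variable [IsProbabilityMeasure P]

/-- The parts in `U` and `Uᶜ` are independent. Given the first, its finitely many diameters above
`r` are null for the intensity, so the second almost surely misses them and a fine grid separates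
the two. The grid expresses this through void events. -/
theorem IsSoup.ae_not_same_cell (h : IsSoup Γ ν P) (hν : IsDiffuse ν) {U : Set Curve}
    (hU : MeasurableSet U) {r : ℝ} (hr : 0 < r) :
    ∀ᵐ ω ∂P, ∃ m : ℕ, ∀ k : ℕ, Void ((Γ ω).curves ∩ U) (above r ∩ gridCell m k) ∨
      Void ((Γ ω).curves ∩ Uᶜ) (above r ∩ gridCell m k) := by
  have hX := h.measurable_curves
  have h1 : Measurable fun ω => CurveSet.mk ((Γ ω).curves ∩ U) := (measurable_inter hU).comp hX
  have h2 : Measurable fun ω => CurveSet.mk ((Γ ω).curves ∩ Uᶜ) :=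
    (measurable_inter hU.compl).comp hX
  have := Measure.isProbabilityMeasure_map (μ := P) h1.aemeasurable
  have := Measure.isProbabilityMeasure_map (μ := P) h2.aemeasurable
  set B : Set (CurveSet × CurveSet) := {p | ∃ m : ℕ, ∀ k : ℕ,
    Void p.1.curves (above r ∩ gridCell m k) ∨ Void p.2.curves (above r ∩ gridCell m k)} with hB
  have hBm : MeasurableSet B := by
    simp only [hB, Set.ofPred_exists, Set.ofPred_forall]
    refine MeasurableSet.iUnion fun m => MeasurableSet.iInter fun k => ?_
    have hm := (measurableSet_above r).inter (measurableSet_gridCell m k)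
    exact (measurable_fst (RandomSoup.measurableSet_void hm)).union
      (measurable_snd (RandomSoup.measurableSet_void hm))
  have key : ∀ᵐ p ∂(P.map fun ω => CurveSet.mk ((Γ ω).curves ∩ U)).prod
      (P.map fun ω => CurveSet.mk ((Γ ω).curves ∩ Uᶜ)), p ∈ B := by
    rw [Measure.map_prod_map _ _ h1 h2,
      ae_map_iff (p := fun p => p ∈ B) (h1.prodMap h2).aemeasurable hBm,
      Measure.ae_prod_iff_ae_ae ((h1.prodMap h2) hBm)]
    filter_upwards [h.ae_finite (measurableSet_above r) (hν.above_lt_top r hr).ne] with ω hω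
    have hN : MeasurableSet {ξ : Curve | diam ξ ∈ diam '' ((Γ ω).curves ∩ above r)} :=
      measurable_diam (hω.image diam).measurableSet
    have hN0 : ν {ξ : Curve | diam ξ ∈ diam '' ((Γ ω).curves ∩ above r)} = 0 := by
      have : {ξ : Curve | diam ξ ∈ diam '' ((Γ ω).curves ∩ above r)} =
          ⋃ t ∈ diam '' ((Γ ω).curves ∩ above r), {ξ | diam ξ = t} := by
        ext ξ
        simp only [Set.mem_ofPred_eq, Set.mem_iUnion, exists_prop, exists_eq_right']
      rw [this, measure_biUnion_null_iff (hω.image diam).countable]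
      exact fun t _ => hν.diam_eq t
    filter_upwards [h.ae_finite (measurableSet_above r) (hν.above_lt_top r hr).ne,
      h.ae_void hN hN0] with ω' hω' hv
    obtain ⟨m, hm⟩ := exists_gridCell_separating hω hω'
    refine ⟨m, fun k => ?_⟩
    by_contra! hk
    simp only [Prod.map, Void, not_forall, not_not] at hk
    obtain ⟨⟨ξ, hξ, hξr, hξk⟩, η, hη, hηr, hηk⟩ := hk
    refine hm m le_rfl ξ ⟨hξ.1, hξr⟩ η ⟨hη.1, hηr⟩ (fun he => ?_) (hξk.trans hηk.symm)
    exact hv η hη.1 ⟨ξ, ⟨hξ.1, hξr⟩, he⟩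
  rw [← map_inter_compl_of_void_mul hX (fun A B hA hB => h.void_mul hA hB) hU] at key
  exact ae_of_ae_map (h1.prodMk h2).aemeasurable key

/-- Two distinct curves of equal diameter would be separated by a basic open set and yet share a
cell of every grid. -/
theorem IsSoup.ae_good (h : IsSoup Γ ν P) (hν : IsDiffuse ν) : ∀ᵐ ω ∂P, Good (Γ ω).curves := by
  have h0 : ∀ᵐ ω ∂P, Void (Γ ω).curves {γ | diam γ = 0} :=
    h.ae_void (measurable_diam (MeasurableSet.singleton 0)) (hν.diam_eq 0)
  have h1 : ∀ᵐ ω ∂P, ∀ n : ℕ, ((Γ ω).curves ∩ above (1 / ((n : ℝ) + 1))).Finite :=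
    ae_all_iff.2 fun n => h.ae_finite (measurableSet_above _)
      (hν.above_lt_top _ (by positivity)).ne
  have h2 : ∀ᵐ ω ∂P, ∀ U ∈ countableBasis Curve, ∀ n : ℕ, ∃ m : ℕ, ∀ k : ℕ,
      Void ((Γ ω).curves ∩ U) (above (1 / ((n : ℝ) + 1)) ∩ gridCell m k) ∨
      Void ((Γ ω).curves ∩ Uᶜ) (above (1 / ((n : ℝ) + 1)) ∩ gridCell m k) :=
    (ae_ball_iff (countable_countableBasis Curve)).2 fun U hU => ae_all_iff.2 fun n =>
      h.ae_not_same_cell hν (isOpen_of_mem_countableBasis hU).measurableSet (by positivity)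
  filter_upwards [h0, h1, h2] with ω h0 h1 h2
  have hpos : ∀ γ ∈ (Γ ω).curves, 0 < diam γ := fun γ hγ =>
    (diam_nonneg γ).lt_of_ne fun he => h0 γ hγ he.symm
  refine ⟨hpos, fun r hr => ?_, fun γ hγ η hη he => ?_⟩
  · obtain ⟨n, hn⟩ := exists_nat_one_div_lt hr
    exact (h1 n).subset fun ξ hξ => ⟨hξ.1, hn.trans hξ.2⟩
  · by_contra hne
    obtain ⟨U, hU, hγU, hUη⟩ := (isBasis_countableBasis Curve).exists_subset_of_mem_open
      (show γ ∈ ({η}ᶜ : Set Curve) from hne) isOpen_compl_singleton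
    obtain ⟨n, hn⟩ := exists_nat_one_div_lt (hpos γ hγ)
    obtain ⟨m, hm⟩ := h2 U hU n
    rcases hm ⌊(m : ℝ) * diam γ⌋₊ with h3 | h3
    · exact h3 γ ⟨hγ, hγU⟩ ⟨hn, rfl⟩
    · refine h3 η ⟨hη, fun hηU => hUη hηU rfl⟩ ⟨?_, ?_⟩
      · show _ < diam η
        rwa [← he]
      · show ⌊(m : ℝ) * diam η⌋₊ = _
        rw [he]

theorem IsSoup.ae_pts_enum (h : IsSoup Γ ν P) (hν : IsDiffuse ν) :
    ∀ᵐ ω ∂P, pts (enum (Γ ω).curves) = (Γ ω).curves := by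
  filter_upwards [h.ae_good hν] with ω hω using pts_enum hω

theorem IsSoup.map_enum_eq [IsProbabilityMeasure P'] (h : IsSoup Γ ν P) (h' : IsSoup Λ ν P') :
    P.map (fun ω => enum (Γ ω).curves) = P'.map fun ω => enum (Λ ω).curves := by
  have := congrArg (Measure.map fun S : CurveSet => enum S.curves) (h.map_curves_eq h')
  rwa [Measure.map_map RandomSoup.measurable_enum h.measurable_curves,
    Measure.map_map RandomSoup.measurable_enum h'.measurable_curves] at this

theorem IsSoup.isCompletelyRandom (h : IsSoup Γ ν P) (hν : IsDiffuse ν) :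
    IsCompletelyRandom (P.map fun ω => enum (Γ ω).curves) := by
  have hv : ∀ A, MeasurableSet A → (P.map fun ω => enum (Γ ω).curves) {x | Void (pts x) A} =
      P {ω | Void (Γ ω).curves A} := fun A hA => by
    have hm : MeasurableSet {x | Void (pts x) A} :=
      measurable_pts (RandomSoup.measurableSet_void hA)
    rw [Measure.map_apply h.measurable_enum hm]
    refine measure_congr ?_
    filter_upwards [h.ae_pts_enum hν] with ω hω
    exact congrArg (fun S => Void S A) hω
  refine ⟨Measure.isProbabilityMeasure_map h.measurable_enum.aemeasurable, ?_, ?_⟩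
  · have hm : MeasurableSet {x | Good (pts x)} := measurable_pts measurableSet_good
    rw [ae_map_iff h.measurable_enum.aemeasurable hm]
    filter_upwards [h.ae_good hν, h.ae_pts_enum hν] with ω hω hω'
    rwa [hω']
  · intro A B hA hB hAB
    rw [hv _ (hA.union hB), hv _ hA, hv _ hB, h.void_mul hA hB hAB]

end Soup

/-! ### Loops that intersect without being linked -/

/-- Two distinct curves that intersect but are not linked. -/
def Touching (γ η : Curve) : Prop := γ ≠ η ∧ Meets γ η ∧ ¬ (inside γ ∩ inside η).Nonempty

theorem measurableSet_touching : MeasurableSet {p : Curve × Curve | Touching p.1 p.2} :=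
  (measurableSet_eq_fun measurable_fst measurable_snd).compl.inter
    (measurableSet_meets.inter measurableSet_inside_inter.compl)

theorem avoidsTrace_iff {ξ : Curve} {E : Set Curve} (h : ∀ η ∈ E, ¬ Touching ξ η) :
    AvoidsTrace ξ E ↔ AvoidsLinks ξ E := by
  have h1 : AvoidsTrace ξ E ↔ ∀ η ∈ E, ¬ Meets ξ η := by
    simp only [AvoidsTrace, trace, Set.disjoint_iUnion_right, Meets,
      ← Set.disjoint_iff_inter_eq_empty, Set.not_nonempty_iff_eq_empty]
  rw [h1]
  refine forall₂_congr fun η hη => ⟨fun hm => ⟨?_, fun hl => hm hl.1⟩, fun ⟨hne, hl⟩ hm => ?_⟩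
  · rintro rfl
    exact hm (by simpa [Meets] using ξ.nonempty)
  · exact h η hη ⟨hne, hm, fun hi => hl ⟨hm, hi⟩⟩

theorem exploreNext_subset (avoids : Curve → Set Curve → Prop) (S₀ S E : Set Curve) :
    exploreNext avoids S₀ S E ⊆ S₀ ∪ S := by
  rintro η ⟨γ, hγ, hη, -⟩
  rcases hη with hη | rfl
  · exact Or.inr hη.1
  · exact Or.inl hγ.1.1

theorem exploreBefore_subset (avoids : Curve → Set Curve → Prop) (S : ℕ → Set Curve) (n : ℕ) :
    exploreBefore avoids S n ⊆ ⋃ i, S i := by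
  induction n with
  | zero => exact Set.empty_subset _
  | succ n ih =>
    exact Set.union_subset ih ((exploreNext_subset _ _ _ _).trans
      (Set.union_subset (Set.subset_iUnion S 0) (Set.subset_iUnion S (n + 1))))

theorem exploreNext_congr {S₀ S E : Set Curve} (h : ∀ ξ ∈ S₀ ∪ S, ∀ η ∈ E, ¬ Touching ξ η) :
    exploreNext AvoidsTrace S₀ S E = exploreNext AvoidsLinks S₀ S E := by
  have h₀ : {ξ ∈ S₀ | AvoidsTrace ξ E} = {ξ ∈ S₀ | AvoidsLinks ξ E} :=
    Set.ext fun ξ => and_congr_right fun hξ => avoidsTrace_iff (h ξ (Or.inl hξ))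
  have h₁ : ∀ γ, {ξ ∈ S | diam ξ < diam γ ∧ AvoidsTrace ξ E} =
      {ξ ∈ S | diam ξ < diam γ ∧ AvoidsLinks ξ E} := fun γ =>
    Set.ext fun ξ => and_congr_right fun hξ => and_congr_right fun _ =>
      avoidsTrace_iff (h ξ (Or.inr hξ))
  simp only [exploreNext, h₀, h₁]

theorem exploreCluster_congr {S : ℕ → Set Curve}
    (h : ∀ i j, ∀ ξ ∈ S i, ∀ η ∈ S j, ¬ Touching ξ η) (n : ℕ) :
    exploreCluster AvoidsTrace S n = exploreCluster AvoidsLinks S n := by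
  have hE : ∀ n, ∀ ξ ∈ S 0 ∪ S (n + 1), ∀ η ∈ exploreBefore AvoidsLinks S n, ¬ Touching ξ η := by
    intro n ξ hξ η hη
    obtain ⟨j, hj⟩ := Set.mem_iUnion.1 (exploreBefore_subset _ _ _ hη)
    rcases hξ with hξ | hξ
    · exact h _ j ξ hξ η hj
    · exact h _ j ξ hξ η hj
  have hB : ∀ n, exploreBefore AvoidsTrace S n = exploreBefore AvoidsLinks S n := by
    intro n
    induction n with
    | zero => rfl
    | succ n ih => rw [exploreBefore, exploreBefore, ih, exploreNext_congr (hE n)]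
  rw [exploreCluster, exploreCluster, hB, exploreNext_congr (hE n)]

theorem measurableSet_exists_touching {V W : Set Curve} (hV : MeasurableSet V)
    (hW : MeasurableSet W) : MeasurableSet {p : (ℚ → Curve) × (ℚ → Curve) |
      ∃ ξ ∈ pts p.1 ∩ V, ∃ η ∈ pts p.2 ∩ W, Touching ξ η} := by
  have : {p : (ℚ → Curve) × (ℚ → Curve) | ∃ ξ ∈ pts p.1 ∩ V, ∃ η ∈ pts p.2 ∩ W, Touching ξ η} =
      ⋃ i : ℚ, ⋃ j : ℚ, {p | p.1 i ∈ above 0 ∩ V} ∩ ({p | p.2 j ∈ above 0 ∩ W} ∩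
        {p | Touching (p.1 i) (p.2 j)}) := by
    ext p
    simp only [Set.mem_iUnion, Set.mem_ofPred_eq]
    constructor
    · rintro ⟨ξ, ⟨⟨h1, i, rfl⟩, h2⟩, η, ⟨⟨h3, j, rfl⟩, h4⟩, h5⟩
      exact ⟨i, j, ⟨h1, h2⟩, ⟨h3, h4⟩, h5⟩
    · rintro ⟨i, j, ⟨h1, h2⟩, ⟨h3, h4⟩, h5⟩
      exact ⟨_, ⟨⟨h1, i, rfl⟩, h2⟩, _, ⟨⟨h3, j, rfl⟩, h4⟩, h5⟩
  rw [this]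
  refine MeasurableSet.iUnion fun i => MeasurableSet.iUnion fun j => ?_
  have hi : Measurable fun p : (ℚ → Curve) × (ℚ → Curve) => p.1 i :=
    (measurable_pi_apply i).comp measurable_fst
  have hj : Measurable fun p : (ℚ → Curve) × (ℚ → Curve) => p.2 j :=
    (measurable_pi_apply j).comp measurable_snd
  exact (hi ((measurableSet_above 0).inter hV)).inter ((hj ((measurableSet_above 0).inter hW)).inter
    ((hi.prodMk hj) measurableSet_touching))

theorem measurableSet_not_touching : MeasurableSet {p : (ℚ → Curve) × (ℚ → Curve) |
    ∀ ξ ∈ pts p.1, ∀ η ∈ pts p.2, ¬ Touching ξ η} := by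
  convert (measurableSet_exists_touching MeasurableSet.univ MeasurableSet.univ).compl using 1
  ext p
  simp

/-- For fixed `U`, the pair of parts of one set in `U` and `Uᶜ` has the law of the same parts of two
independent copies. A touching pair consists of distinct curves, hence is separated by some `U` of a
countable basis. -/
theorem IsCompletelyRandom.ae_not_touching {q : Measure (ℚ → Curve)} (hq : IsCompletelyRandom q)
    (h : ∀ᵐ x ∂q, ∀ ξ ∈ pts x, ∀ η ∈ pts x, ¬ Touching ξ η) :
    ∀ᵐ p ∂q.prod q, ∀ ξ ∈ pts p.1, ∀ η ∈ pts p.2, ¬ Touching ξ η := by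
  have := hq.prob
  have key : ∀ U : Set Curve, MeasurableSet U → ∀ᵐ p ∂q.prod q,
      ¬ ∃ ξ ∈ pts p.1 ∩ U, ∃ η ∈ pts p.2 ∩ Uᶜ, Touching ξ η := by
    intro U hU
    have hm := measurableSet_exists_touching hU hU.compl
    have hs := hq.lintegral_split hU (fun F G => ind (∃ ξ ∈ F, ∃ η ∈ G, Touching ξ η))
      (measurable_ind (by
        simpa using measurableSet_exists_touching MeasurableSet.univ MeasurableSet.univ))
    rw [ae_iff]
    simp only [not_not]
    rw [← lintegral_ind hm, lintegral_prod _ (measurable_ind hm).aemeasurable, ← hs]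
    refine (lintegral_congr_ae ?_).trans lintegral_zero
    filter_upwards [h] with x hx
    exact ind_false fun ⟨ξ, hξ, η, hη, ht⟩ => hx ξ hξ.1 η hη.1 ht
  have key' := (ae_ball_iff (countable_countableBasis Curve)).2 fun U hU =>
    key U (isOpen_of_mem_countableBasis hU).measurableSet
  filter_upwards [key'] with p hp ξ hξ η hη ht
  obtain ⟨U, hU, hξU, hUη⟩ := (isBasis_countableBasis Curve).exists_subset_of_mem_open
    (show ξ ∈ ({η}ᶜ : Set Curve) from ht.1) isOpen_compl_singleton
  exact hp U hU ⟨ξ, ⟨hξ, hξU⟩, η, ⟨hη, fun hηU => hUη hηU rfl⟩, ht⟩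

/-! ### Equality in law of the two sequences of clusters -/

section Main

variable {Ω Ω' : Type*} [MeasurableSpace Ω] [MeasurableSpace Ω'] {P : Measure Ω} {P' : Measure Ω'}
  {Γ : ℕ → Ω → Config} {Λ : Ω' → Config} {ν : Measure Curve}

theorem iIndepFun_enum (hΓ : iIndepFun Γ P) : iIndepFun (fun n ω => enum (Γ n ω).curves) P :=
  hΓ.comp (fun _ S => enum S.curves) fun _ => measurable_enum.comp measurable_curves

variable [IsProbabilityMeasure P] [IsProbabilityMeasure P']

theorem map_enum_eq_prod (hS : ∀ n, IsSoup (Γ n) ν P) (hΓ : iIndepFun Γ P) (hΛ : IsSoup Λ ν P') :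
    P.map (fun ω => (enum (Γ 0 ω).curves, fun n => enum (Γ (n + 1) ω).curves)) =
      (P'.map fun ω => enum (Λ ω).curves).prod
        (Measure.infinitePi fun _ : ℕ => P'.map fun ω => enum (Λ ω).curves) := by
  have := Measure.isProbabilityMeasure_map (μ := P') hΛ.measurable_enum.aemeasurable
  set q := P'.map fun ω => enum (Λ ω).curves with hq
  have hX : P.map (fun ω n => enum (Γ n ω).curves) = Measure.infinitePi fun _ : ℕ => q := by
    rw [(iIndepFun_enum hΓ).map_fun_eq_infinitePi_map fun n => (hS n).measurable_enum]
    congr 1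
    exact funext fun n => (hS n).map_enum_eq hΛ
  have hs : Measurable fun x : ℕ → ℚ → Curve => (x 0, fun n => x (n + 1)) :=
    (measurable_pi_apply 0).prodMk (measurable_pi_lambda _ fun n => measurable_pi_apply (n + 1))
  have hc : Measurable fun (p : (ℚ → Curve) × (ℕ → ℚ → Curve)) (i : ℕ) =>
      Nat.casesOn (motive := fun _ => ℚ → Curve) i p.1 p.2 := by
    refine measurable_pi_lambda _ fun i => ?_
    cases i with
    | zero => exact measurable_fst
    | succ i => exact (measurable_pi_apply i).comp measurable_snd
  have h1 := congrArg (Measure.map fun x : ℕ → ℚ → Curve => (x 0, fun n => x (n + 1)))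
    (hX.trans (map_cons_infinitePi q).symm)
  rw [Measure.map_map hs (measurable_pi_lambda _ fun n => (hS n).measurable_enum),
    Measure.map_map hs hc] at h1
  exact h1.trans Measure.map_id

/-- Both sequences are almost surely `clusterSeq ∘ enum`, evaluated at the set of all explored
curves and at the soup; these two sets have the same law. -/
theorem IsSoup.sameLaw_exploreCluster (hν : IsDiffuse ν) (hS : ∀ n, IsSoup (Γ n) ν P)
    (hΓ : iIndepFun Γ P) (hΛ : IsSoup Λ ν P') :
    SameLaw (fun ω => exploreCluster AvoidsLinks fun n => (Γ n ω).curves)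
      (fun ω' => soupCluster (Λ ω').curves) P P' := by
  set q := P'.map fun ω => enum (Λ ω).curves with hq
  have hqr : IsCompletelyRandom q := hΛ.isCompletelyRandom hν
  set Y : Ω → Set Curve := fun ω => allSeen Set.univ (pts (enum (Γ 0 ω).curves))
    fun n => pts (enum (Γ (n + 1) ω).curves) with hY
  have hX : Measurable fun ω => (enum (Γ 0 ω).curves, fun n => enum (Γ (n + 1) ω).curves) :=
    (hS 0).measurable_enum.prodMk (measurable_pi_lambda _ fun n => (hS (n + 1)).measurable_enum)
  have hm := measurable_allSeen (T := (ℚ → Curve) × (ℕ → ℚ → Curve)) measurable_fst measurable_snd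
  have hYm : Measurable fun ω => CurveSet.mk (Y ω) := hm.comp hX
  have hYlaw : P.map (fun ω => CurveSet.mk (Y ω)) = P'.map fun ω => CurveSet.mk (Λ ω).curves := by
    have h1 := congrArg (Measure.map fun p : (ℚ → Curve) × (ℕ → ℚ → Curve) =>
      CurveSet.mk (allSeen Set.univ (pts p.1) fun k => pts (p.2 k))) (map_enum_eq_prod hS hΓ hΛ)
    rw [Measure.map_map hm hX, hqr.map_allSeen, hq,
      Measure.map_map measurable_pts hΛ.measurable_enum] at h1
    refine h1.trans (Measure.map_congr ?_)
    filter_upwards [hΛ.ae_pts_enum hν] with ω hω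
    exact congrArg CurveSet.mk hω
  -- Being good is a measurable property of sets of curves, so it transfers along the equality of
  -- laws.
  have hYgood : ∀ᵐ ω ∂P, Good (Y ω) := by
    have h1 : ∀ᵐ S ∂P'.map fun ω => CurveSet.mk (Λ ω).curves, Good S.curves :=
      (ae_map_iff hΛ.measurable_curves.aemeasurable measurableSet_good).2 (hΛ.ae_good hν)
    rw [← hYlaw] at h1
    exact ae_of_ae_map hYm.aemeasurable h1
  have hg : Measurable fun S : CurveSet => clusterSeq (enum S.curves) :=
    measurable_clusterSeq.comp RandomSoup.measurable_enum
  have hK : (fun ω => clusterSeq (enum (Y ω))) =ᵐ[P]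
      fun ω n => PlaneSet.mk (exploreCluster AvoidsLinks (fun n => (Γ n ω).curves) n) := by
    filter_upwards [hYgood, (hS 0).ae_good hν, ae_all_iff.2 fun n => (hS n).ae_pts_enum hν]
      with ω h1 h2 h3
    funext n
    rw [h1.clusterSeq_enum, Good.exploreCluster_eq h2, hY]
    simp only [h3]
    rw [soupCluster_allSeen]
  have hK' : (fun ω => clusterSeq (enum (Λ ω).curves)) =ᵐ[P']
      fun ω n => PlaneSet.mk (soupCluster (Λ ω).curves n) := by
    filter_upwards [hΛ.ae_good hν] with ω h1
    funext n
    rw [h1.clusterSeq_enum]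
  have hid : IdentDistrib (fun ω => clusterSeq (enum (Y ω)))
      (fun ω => clusterSeq (enum (Λ ω).curves)) P P' :=
    (IdentDistrib.mk hYm.aemeasurable hΛ.measurable_curves.aemeasurable hYlaw).comp hg
  exact ((IdentDistrib.of_ae_eq (hg.comp hYm).aemeasurable hK).symm.trans hid).trans
    (IdentDistrib.of_ae_eq (hg.comp hΛ.measurable_curves).aemeasurable hK')

theorem IsSoup.ae_exploreCluster_congr (hν : IsDiffuse ν) (hS : ∀ n, IsSoup (Γ n) ν P)
    (hΓ : iIndepFun Γ P) (hΛ : IsSoup Λ ν P')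
    (h : ∀ᵐ ω' ∂P', ∀ ξ ∈ (Λ ω').curves, ∀ η ∈ (Λ ω').curves, ¬ Touching ξ η) :
    ∀ᵐ ω ∂P, ∀ n, exploreCluster AvoidsTrace (fun n => (Γ n ω).curves) n =
      exploreCluster AvoidsLinks (fun n => (Γ n ω).curves) n := by
  set q := P'.map fun ω => enum (Λ ω).curves with hq
  have hqr : IsCompletelyRandom q := hΛ.isCompletelyRandom hν
  have hd : MeasurableSet {x : ℚ → Curve | ∀ ξ ∈ pts x, ∀ η ∈ pts x, ¬ Touching ξ η} :=
    (measurable_id.prodMk measurable_id) measurableSet_not_touching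
  have h1 : ∀ᵐ x ∂q, ∀ ξ ∈ pts x, ∀ η ∈ pts x, ¬ Touching ξ η := by
    rw [ae_map_iff hΛ.measurable_enum.aemeasurable hd]
    filter_upwards [h, hΛ.ae_pts_enum hν] with ω hω hω'
    rwa [hω']
  have h2 := hqr.ae_not_touching h1
  have h3 : ∀ i j, ∀ᵐ ω ∂P, ∀ ξ ∈ pts (enum (Γ i ω).curves), ∀ η ∈ pts (enum (Γ j ω).curves),
      ¬ Touching ξ η := by
    intro i j
    -- Within one soup, the absence of touching pairs follows from equality in law; for two
    -- different soups, from independence and the product law.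
    rcases eq_or_ne i j with rfl | hij
    · refine ae_of_ae_map (hS i).measurable_enum.aemeasurable ?_
        (p := fun x => ∀ ξ ∈ pts x, ∀ η ∈ pts x, ¬ Touching ξ η)
      rwa [(hS i).map_enum_eq hΛ]
    · refine ae_of_ae_map ((hS i).measurable_enum.prodMk (hS j).measurable_enum).aemeasurable ?_
        (p := fun p => ∀ ξ ∈ pts p.1, ∀ η ∈ pts p.2, ¬ Touching ξ η)
      rwa [(indepFun_iff_map_prod_eq_prod_map_map (hS i).measurable_enum.aemeasurable
        (hS j).measurable_enum.aemeasurable).1 ((iIndepFun_enum hΓ).indepFun hij),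
        (hS i).map_enum_eq hΛ, (hS j).map_enum_eq hΛ]
  filter_upwards [ae_all_iff.2 fun i => ae_all_iff.2 (h3 i),
    ae_all_iff.2 fun n => (hS n).ae_pts_enum hν] with ω h4 h5
  refine exploreCluster_congr fun i j => ?_
  have := h4 i j
  rwa [h5, h5] at this

end Main

end RandomSoup

end

theorem mainTheorem10
    (μ : MeasureTheory.Measure RandomSoup.Curve)
    (hμ : RandomSoup.IsInvariantCurveMeasure μ)
    (hsimple : ∀ᵐ γ ∂μ, RandomSoup.IsSimpleLoop γ)
    (D : Set ℂ) (hDo : IsOpen D) (hDc : IsConnected D) (hDb : Bornology.IsBounded D)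
    (c : ℝ≥0) (hc : 0 < c)
    {Ω : Type*} [MeasurableSpace Ω] (P : MeasureTheory.Measure Ω)
    [MeasureTheory.IsProbabilityMeasure P]
    (Γ : ℕ → Ω → RandomSoup.Config)
    (hΓ : ∀ n, RandomSoup.IsSoup (Γ n) (c • RandomSoup.restrictTo μ D) P)
    (hind : ProbabilityTheory.iIndepFun Γ P)
    {Ω' : Type*} [MeasurableSpace Ω'] (P' : MeasureTheory.Measure Ω')
    [MeasureTheory.IsProbabilityMeasure P']
    (Λ : Ω' → RandomSoup.Config)
    (hΛ : RandomSoup.IsSoup Λ (c • RandomSoup.restrictTo μ D) P') :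
    RandomSoup.SameLaw
      (fun ω => RandomSoup.exploreCluster RandomSoup.AvoidsLinks (fun n => (Γ n ω).curves))
      (fun ω' => RandomSoup.soupCluster (Λ ω').curves) P P' ∧
    ((∀ᵐ ω' ∂P', ∀ γ ∈ (Λ ω').curves, ∀ η ∈ (Λ ω').curves, γ ≠ η →
        RandomSoup.Meets γ η → (RandomSoup.inside γ ∩ RandomSoup.inside η).Nonempty) →
      RandomSoup.SameLaw
        (fun ω => RandomSoup.exploreCluster RandomSoup.AvoidsTrace (fun n => (Γ n ω).curves))
        (fun ω' => RandomSoup.soupCluster (Λ ω').curves) P P') := by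
  have hν := hμ.isDiffuse hsimple hDb c
  have h1 := RandomSoup.IsSoup.sameLaw_exploreCluster hν hΓ hind hΛ
  refine ⟨h1, fun h => ?_⟩
  have h2 := RandomSoup.IsSoup.ae_exploreCluster_congr hν hΓ hind hΛ (by
    filter_upwards [h] with ω hω ξ hξ η hη ht
    exact ht.2.2 (hω ξ hξ η hη ht.1 ht.2.1))
  refine (IdentDistrib.of_ae_eq h1.aemeasurable_fst ?_).symm.trans h1
  filter_upwards [h2] with ω hω
  funext n
  rw [hω n]
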